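/- Let $k$ be an algebraically closed field of characteristic zero, let $G$ be a finite group, and let $H$ be a Hopf algebra over $k$ that is isomorphic to the group algebra $kG$ or to its dual $(kG)^*$. Let $R$ be a $k$-algebra that is prime, (left and right) noetherian, finitely generated as a module over its center, and a maximal order in its quotient ring. Suppose that $R$ is a left $H$-module algebra and that the action is inner faithful, that is, $I\cdot R\neq 0$ for every nonzero Hopf ideal $I$ of $H$. Let $R^H=\{r\in R : h\cdot r=\varepsilon(h)r \text{ for all } h\in H\}$, view $R$ as a right $R^H$-module, and let $$\gamma\colon R\otimes_{R^H}\operatorname{Hom}_{R^H}(R,R^H)\to\operatorname{End}_{R^H}(R),\qquad x\otimes f\mapsto\bigl(y\mapsto x f(y)\bigr).$$ Then $$\operatorname{Kdim}_R \operatorname{Coker}\gamma\le \operatorname{Kdim} R-2,$$ both for the left $R$-module structure on $\operatorname{Coker}\gamma$ induced by $(rg)(y)=r\,g(y)$ (compared with $\operatorname{Kdim}$ of the left module $R$) and for the right $R$-module structure induced by $(gr)(y)=g(ry)$ (compared with $\operatorname{Kdim}$ of the right module $R$). Here $\operatorname{Kdim}$ is the (Gabriel–Rentschler) Krull dimension of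 a module, that is, the deviation of its lattice of submodules, an ordinal or $-\infty$, with $\operatorname{Kdim} 0=-\infty$; the inequality means $\operatorname{Kdim}_R\operatorname{Coker}\gamma+2\le\operatorname{Kdim} R$. -/

import Mathlib

open scoped TensorProduct MulOpposite
open MulOpposite

universe u v w

/-! ### The Hopf algebra dual to a group algebra -/

/-- The dual `(kG)^*` of the group algebra of a finite group `G`, realized as the space of functions
`G → k` (a linear form on `kG` is determined by its values on the basis `G`).
The Hopf structure below is the transpose of the one of `kG`. -/
def DualGroupAlgebra (k : Type u) (G : Type w) : Type (max u w) := G → k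

namespace DualGroupAlgebra

variable (k : Type u) (G : Type w)

/-- Since the elements of `G` are group-like in `kG`, the product is pointwise. -/
instance [Field k] : CommRing (DualGroupAlgebra k G) := inferInstanceAs (CommRing (G → k))

instance [Field k] : Algebra k (DualGroupAlgebra k G) := inferInstanceAs (Algebra k (G → k))

variable {k G}

instance : FunLike (DualGroupAlgebra k G) G k where
  coe f := f
  coe_injective _ _ h := h

@[ext] theorem ext {f f' : DualGroupAlgebra k G} (h : ∀ x, f x = f' x) : f = f' := funext h

section
variable [Field k]

@[simp] theorem add_apply (f f' : DualGroupAlgebra k G) (x : G) : (f + f') x = f x + f' x := rfl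
@[simp] theorem mul_apply (f f' : DualGroupAlgebra k G) (x : G) : (f * f') x = f x * f' x := rfl
@[simp] theorem one_apply (x : G) : (1 : DualGroupAlgebra k G) x = 1 := rfl
@[simp] theorem zero_apply (x : G) : (0 : DualGroupAlgebra k G) x = 0 := rfl
@[simp] theorem smul_apply (c : k) (f : DualGroupAlgebra k G) (x : G) : (c • f) x = c * f x := rfl
theorem sum_apply {ι : Type*} (s : Finset ι) (f : ι → DualGroupAlgebra k G) (x : G) :
    (∑ i ∈ s, f i) x = ∑ i ∈ s, f i x :=
  Finset.sum_apply (M := fun _ : G => k) x s f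

variable (k) in
open Classical in
/-- The basis dual to the basis `G` of `kG`. -/
noncomputable def delta (g : G) : DualGroupAlgebra k G := fun x => if x = g then 1 else 0

open Classical in
theorem delta_apply (g x : G) : delta k g x = if x = g then 1 else 0 := rfl

open Classical in
theorem delta_mul_delta (g h : G) :
    delta k g * delta k h = if g = h then delta k g else 0 := by
  ext x
  by_cases hgh : g = h
  · subst hgh; simp [delta_apply]
  · simp only [mul_apply, delta_apply, hgh, if_false, zero_apply]
    by_cases hx : x = g
    · subst hx; simp [hgh]
    · simp [hx]

/-- The antipode is `S(f)(x) = f(x⁻¹)`. -/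
def antipodeMap [Group G] : DualGroupAlgebra k G →ₗ[k] DualGroupAlgebra k G where
  toFun f := (fun x => f x⁻¹ : G → k)
  map_add' _ _ := rfl
  map_smul' _ _ := rfl
theorem antipodeMap_apply [Group G] (f : DualGroupAlgebra k G) (x : G) : antipodeMap f x = f x⁻¹ := rfl

variable [Fintype G]

theorem sum_smul_delta (f : DualGroupAlgebra k G) : ∑ g, f g • delta k g = f := by
  classical
  ext x
  rw [sum_apply, Finset.sum_eq_single x]
  · simp [delta_apply]
  · intro g _ hg
    simp [delta_apply, hg.symm]
  · simp

variable [Group G]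

/-- `Δ(f) = ∑_{a,b} f(ab) δ_a ⊗ δ_b`, i.e. `⟨Δ f, a ⊗ b⟩ = ⟨f, ab⟩`, and `ε(f) = f(1)`. -/
noncomputable instance : CoalgebraStruct k (DualGroupAlgebra k G) where
  comul :=
    { toFun := fun f => ∑ a : G, ∑ b : G, f (a * b) • (delta k a ⊗ₜ[k] delta k b)
      map_add' := by
        intro f f'
        simp [add_smul, Finset.sum_add_distrib]
      map_smul' := by
        intro c f
        simp [mul_smul, Finset.smul_sum] }
  counit :=
    { toFun := fun f => f 1
      map_add' := fun _ _ => rfl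
      map_smul' := fun _ _ => rfl }

theorem comul_apply (f : DualGroupAlgebra k G) :
    Coalgebra.comul (R := k) f = ∑ a : G, ∑ b : G, f (a * b) • (delta k a ⊗ₜ[k] delta k b) := rfl

theorem counit_apply (f : DualGroupAlgebra k G) : Coalgebra.counit (R := k) f = f 1 := rfl

noncomputable instance : Coalgebra k (DualGroupAlgebra k G) where
  coassoc := by
    classical
    ext f
    have h1 : ∀ (c d : G) (F : G → DualGroupAlgebra k G ⊗[k]
        (DualGroupAlgebra k G ⊗[k] DualGroupAlgebra k G)),
        ∑ a : G, delta k a (c * d) • F a = F (c * d) := by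
      intro c d F
      rw [Finset.sum_eq_single (c * d)]
      · simp [delta_apply]
      · intro g _ hg
        simp [delta_apply, hg.symm]
      · simp
    have hL : ∀ b : G, ∑ a : G, f (a * b) • ∑ c : G, ∑ d : G, delta k a (c * d) •
        (delta k c ⊗ₜ[k] (delta k d ⊗ₜ[k] delta k b)) =
        ∑ c : G, ∑ d : G, f (c * d * b) • (delta k c ⊗ₜ[k] (delta k d ⊗ₜ[k] delta k b)) := by
      intro b
      simp only [Finset.smul_sum]
      rw [Finset.sum_comm]
      refine Finset.sum_congr rfl fun c _ => ?_
      rw [Finset.sum_comm]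
      refine Finset.sum_congr rfl fun d _ => ?_
      rw [← h1 c d (fun a => f (a * b) • (delta k c ⊗ₜ[k] (delta k d ⊗ₜ[k] delta k b)))]
      exact Finset.sum_congr rfl fun a _ => smul_comm _ _ _
    have hR : ∀ a : G, ∑ b : G, f (a * b) • ∑ c : G, ∑ d : G, delta k b (c * d) •
        (delta k a ⊗ₜ[k] (delta k c ⊗ₜ[k] delta k d)) =
        ∑ c : G, ∑ d : G, f (a * c * d) • (delta k a ⊗ₜ[k] (delta k c ⊗ₜ[k] delta k d)) := by
      intro a
      simp only [Finset.smul_sum]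
      rw [Finset.sum_comm]
      refine Finset.sum_congr rfl fun c _ => ?_
      rw [Finset.sum_comm]
      refine Finset.sum_congr rfl fun d _ => ?_
      rw [mul_assoc, ← h1 c d (fun b => f (a * b) • (delta k a ⊗ₜ[k] (delta k c ⊗ₜ[k] delta k d)))]
      exact Finset.sum_congr rfl fun a _ => smul_comm _ _ _
    have hl : ∀ b g : G, TensorProduct.assoc k _ _ _ (Coalgebra.comul (R := k) (delta k g) ⊗ₜ[k]
        delta k b) = ∑ c : G, ∑ d : G, delta k g (c * d) •
        (delta k c ⊗ₜ[k] (delta k d ⊗ₜ[k] delta k b)) := by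
      intro b g
      simp only [comul_apply, TensorProduct.sum_tmul, map_sum]
      simp only [← TensorProduct.smul_tmul', map_smul, TensorProduct.assoc_tmul]
    have hr : ∀ a g : G, delta k a ⊗ₜ[k] Coalgebra.comul (R := k) (delta k g) =
        ∑ c : G, ∑ d : G, delta k g (c * d) •
        (delta k a ⊗ₜ[k] (delta k c ⊗ₜ[k] delta k d)) := by
      intro a g
      simp only [comul_apply, TensorProduct.tmul_sum, TensorProduct.tmul_smul]
    simp only [LinearMap.coe_comp, LinearEquiv.coe_coe, Function.comp_apply]
    rw [comul_apply f]
    simp only [map_sum, map_smul, LinearMap.rTensor_tmul, LinearMap.lTensor_tmul, hl, hr]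
    rw [Finset.sum_comm]
    simp only [hL, hR]
    rw [Finset.sum_comm]
    refine Finset.sum_congr rfl fun c _ => ?_
    rw [Finset.sum_comm]
  rTensor_counit_comp_comul := by
    classical
    ext f
    simp only [LinearMap.coe_comp, Function.comp_apply, comul_apply, map_sum, map_smul,
      LinearMap.rTensor_tmul, counit_apply, TensorProduct.mk_apply]
    rw [Finset.sum_eq_single 1]
    · simp only [one_mul, delta_apply, if_true, ← TensorProduct.tmul_smul, ← TensorProduct.tmul_sum,
        sum_smul_delta]
    · intro a _ ha
      simp [delta_apply, ha.symm]
    · simp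
  lTensor_counit_comp_comul := by
    classical
    ext f
    simp only [LinearMap.coe_comp, Function.comp_apply, comul_apply, map_sum, map_smul,
      LinearMap.lTensor_tmul, counit_apply, TensorProduct.mk_apply, LinearMap.flip_apply]
    rw [Finset.sum_comm, Finset.sum_eq_single 1]
    · simp only [mul_one, delta_apply, if_true, TensorProduct.smul_tmul', ← TensorProduct.sum_tmul,
        sum_smul_delta]
    · intro a _ ha
      simp [delta_apply, ha.symm]
    · simp

noncomputable instance : Bialgebra k (DualGroupAlgebra k G) :=
  Bialgebra.mk' k (DualGroupAlgebra k G)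
    (by simp [counit_apply])
    (by intro a b; simp [counit_apply])
    (by
      have h1 : ∑ g : G, delta k g = 1 := by
        simpa using sum_smul_delta (1 : DualGroupAlgebra k G)
      simp only [comul_apply, one_apply, one_smul, ← TensorProduct.tmul_sum,
        ← TensorProduct.sum_tmul, h1]
      rfl)
    (by
      classical
      intro f f'
      simp only [comul_apply, mul_apply, Finset.sum_mul_sum, smul_mul_smul_comm,
        Algebra.TensorProduct.tmul_mul_tmul, delta_mul_delta]
      refine Finset.sum_congr rfl fun a _ => ?_
      symm
      rw [Finset.sum_eq_single a]
      · refine Finset.sum_congr rfl fun b _ => ?_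
        rw [Finset.sum_eq_single b]
        · simp
        · intro b' _ hb
          simp [hb.symm]
        · simp
      · intro a' _ ha
        refine Finset.sum_eq_zero fun b _ => Finset.sum_eq_zero fun b' _ => ?_
        rw [if_neg ha.symm, TensorProduct.zero_tmul, smul_zero]
      · simp)

noncomputable instance : HopfAlgebra k (DualGroupAlgebra k G) where
  antipode := antipodeMap
  mul_antipode_rTensor_comul := by
    ext f x
    simp only [LinearMap.coe_comp, Function.comp_apply, comul_apply, map_sum, map_smul,
      LinearMap.rTensor_tmul, LinearMap.mul'_apply, sum_apply, smul_apply, mul_apply,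
      antipodeMap_apply, counit_apply, Algebra.linearMap_apply,
      Algebra.algebraMap_eq_smul_one, one_apply]
    rw [Finset.sum_eq_single x⁻¹, Finset.sum_eq_single x]
    · simp [delta_apply]
    · intro b _ hb
      simp [delta_apply, hb.symm]
    · simp
    · intro a _ ha
      have ha' : x⁻¹ ≠ a := ha.symm
      simp [delta_apply, ha']
    · simp
  mul_antipode_lTensor_comul := by
    ext f x
    simp only [LinearMap.coe_comp, Function.comp_apply, comul_apply, map_sum, map_smul,
      LinearMap.lTensor_tmul, LinearMap.mul'_apply, sum_apply, smul_apply, mul_apply,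
      antipodeMap_apply, counit_apply, Algebra.linearMap_apply,
      Algebra.algebraMap_eq_smul_one, one_apply]
    rw [Finset.sum_eq_single x, Finset.sum_eq_single x⁻¹]
    · simp [delta_apply]
    · intro b _ hb
      simp [delta_apply, hb.symm]
    · simp
    · intro a _ ha
      simp [delta_apply, ha.symm]
    · simp

end

end DualGroupAlgebra

/-! ### Hopf actions -/

section HopfAction

variable (k : Type*) (H : Type*) (R : Type*) [Field k] [Ring H] [HopfAlgebra k H]
  [Ring R] [Algebra k R] [Module H R] [IsScalarTower k H R]

/-- `R` is a left `H`-module algebra: `h • 1 = ε(h) 1` and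
`h • (a b) = ∑ (h₁ • a) (h₂ • b)` where `Δ(h) = ∑ h₁ ⊗ h₂`. -/
class IsHopfModuleAlgebra : Prop where
  smul_one : ∀ h : H, h • (1 : R) = algebraMap k R (Coalgebra.counit h)
  smul_mul : ∀ (h : H) (a b : R), h • (a * b) =
    LinearMap.mul' k R (TensorProduct.map
      ((LinearMap.toSpanSingleton H R a).restrictScalars k)
      ((LinearMap.toSpanSingleton H R b).restrictScalars k) (Coalgebra.comul h))

/-- The action is inner faithful: no nonzero Hopf ideal of `H` annihilates `R`. -/
def IsInnerFaithful : Prop :=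
  ∀ (I : Ideal H) [I.IsTwoSided] [I.IsHopfIdeal k], I ≠ ⊥ → ∃ h ∈ I, ∃ r : R, h • r ≠ 0

/-- The invariant subring `R^H = {r | h • r = ε(h) r for all h}`. -/
def hopfInvariants [IsHopfModuleAlgebra k H R] : Subalgebra k R where
  carrier := {r | ∀ h : H, h • r = Coalgebra.counit (R := k) h • r}
  mul_mem' := by
    intro a b ha hb h
    have key : ∀ x : R, (∀ h : H, h • x = Coalgebra.counit (R := k) h • x) →
        (LinearMap.toSpanSingleton H R x).restrictScalars k =
          (Coalgebra.counit (R := k) (A := H)).smulRight x := by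
      intro x hx
      ext h
      simpa using hx h
    let r := Coalgebra.Repr.arbitrary k h
    have h2 := congrArg (Coalgebra.counit (R := k)) (Coalgebra.sum_counit_smul r)
    rw [IsHopfModuleAlgebra.smul_mul (k := k), key a ha, key b hb, ← h2, ← r.eq]
    simp [Finset.sum_smul, smul_smul, mul_comm]
  add_mem' := by
    intro a b ha hb h
    rw [smul_add, smul_add, ha, hb]
  algebraMap_mem' := by
    intro c h
    have hsc : h • c • (1 : R) = c • h • (1 : R) := by
      rw [← smul_one_smul H c (1 : R), ← smul_one_smul H c (h • (1 : R)), ← mul_smul, ← mul_smul,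
        mul_smul_comm, smul_mul_assoc, one_mul, mul_one]
    rw [Algebra.algebraMap_eq_smul_one, hsc, IsHopfModuleAlgebra.smul_one (k := k),
      Algebra.algebraMap_eq_smul_one, smul_comm]

end HopfAction

/-! ### The map `γ` -/

/-- Right multiplication makes `R` a right module over each of its subalgebras. -/
instance Subalgebra.rightModule {k R : Type*} [Field k] [Ring R] [Algebra k R]
    (A : Subalgebra k R) : Module (↥A)ᵐᵒᵖ R where
  smul a r := r * ((unop a : A) : R)
  one_smul r := mul_one r
  mul_smul _ _ r := (mul_assoc r _ _).symm
  smul_zero _ := zero_mul _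
  smul_add _ _ _ := add_mul _ _ _
  add_smul _ _ _ := mul_add _ _ _
  zero_smul _ := mul_zero _

theorem Subalgebra.op_smul_eq_mul {k R : Type*} [Field k] [Ring R] [Algebra k R]
    {A : Subalgebra k R} (a : A) (r : R) : op a • r = r * (a : R) := rfl

instance Subalgebra.rightModule_smulCommClass {k R : Type*} [Field k] [Ring R] [Algebra k R]
    (A : Subalgebra k R) : SMulCommClass (↥A)ᵐᵒᵖ R R where
  smul_comm _ r x := mul_assoc r x _

section Tensor

variable (A : Type*) [Ring A] (M : Type*) [AddCommGroup M] [Module Aᵐᵒᵖ M]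

/-- The abelian group `M ⊗_A N` for a right module `M` and a left module `N` over a (noncommutative)
ring `A`: the quotient of `M ⊗_ℤ N` by the relations `m a ⊗ n = m ⊗ a n`. -/
abbrev BalancedTensor (N : Type*) [AddCommGroup N] [Module A N] : Type _ :=
  (M ⊗[ℤ] N) ⧸ AddSubgroup.closure
    {t : M ⊗[ℤ] N | ∃ (m : M) (a : A) (n : N), t = (op a • m) ⊗ₜ[ℤ] n - m ⊗ₜ[ℤ] (a • n)}

/-- The natural map `γ_M : M ⊗_A Hom_A(M, A) → End_A(M)`, `x ⊗ f ↦ (y ↦ x f(y))`,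
for a right `A`-module `M`. Here the left `A`-action on `Hom_A(M, A)` is `(a f)(y) = a f(y)`. -/
def gammaMap : BalancedTensor A M (M →ₗ[Aᵐᵒᵖ] A) →+ Module.End Aᵐᵒᵖ M :=
  QuotientAddGroup.lift _
    (TensorProduct.liftAddHom
      (AddMonoidHom.mk' (fun x : M => AddMonoidHom.mk' (fun f : M →ₗ[Aᵐᵒᵖ] A =>
        ({ toFun := fun y => op (f y) • x
           map_add' := by intro y z; rw [map_add, op_add, add_smul]
           map_smul' := by
            intro a y
            rw [map_smul, RingHom.id_apply, ← mul_smul]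
            rfl } : Module.End Aᵐᵒᵖ M))
        (by intro f g; ext y; simp [add_smul]))
        (by intro x y; ext f z; simp))
      (by
        intro n x f
        ext y
        change op (f y) • n • x = op ((n • f) y) • x
        rw [LinearMap.smul_apply, op_smul, smul_assoc, smul_comm]))
    (by
      rw [AddSubgroup.closure_le]
      rintro _ ⟨m, a, n, rfl⟩
      rw [SetLike.mem_coe, AddMonoidHom.mem_ker, map_sub, sub_eq_zero]
      ext y
      change op (n y) • op a • m = op (a * n y) • m
      rw [op_mul, mul_smul])

theorem gammaMap_tmul (x : M) (f : M →ₗ[Aᵐᵒᵖ] A) (y : M) :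
    gammaMap A M (QuotientAddGroup.mk (x ⊗ₜ[ℤ] f)) y = op (f y) • x := rfl

variable (S : Type*) [Ring S] [Module S M] [SMulCommClass Aᵐᵒᵖ S M]

/-- If `M` is an `S`-`A`-bimodule, the image of `γ_M` as a left `S`-submodule of `End_A(M)`,
where `(s g)(y) = s g(y)`. -/
def gammaRange : Submodule S (Module.End Aᵐᵒᵖ M) where
  __ := (gammaMap A M).range
  smul_mem' := by
    rintro s _ ⟨t, rfl⟩
    induction t using QuotientAddGroup.induction_on with
    | H t =>
      change _ ∈ (gammaMap A M).range
      induction t using TensorProduct.induction_on with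
      | zero => simp
      | add t t' h h' =>
        rw [QuotientAddGroup.mk_add, map_add, smul_add]
        exact add_mem h h'
      | tmul x f =>
        refine ⟨QuotientAddGroup.mk ((s • x) ⊗ₜ[ℤ] f), ?_⟩
        ext y
        rw [LinearMap.smul_apply, gammaMap_tmul, gammaMap_tmul, smul_comm]

/-- If `M` is an `S`-`A`-bimodule, the image of `γ_M` as a right `S`-submodule of `End_A(M)`,
where `(g s)(y) = g(s y)`. -/
def gammaRangeRight : Submodule Sᵈᵐᵃ (Module.End Aᵐᵒᵖ M) where
  __ := (gammaMap A M).range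
  smul_mem' := by
    rintro s _ ⟨t, rfl⟩
    induction t using QuotientAddGroup.induction_on with
    | H t =>
      change _ ∈ (gammaMap A M).range
      induction t using TensorProduct.induction_on with
      | zero => simp
      | add t t' h h' =>
        rw [QuotientAddGroup.mk_add, map_add, smul_add]
        exact add_mem h h'
      | tmul x f =>
        refine ⟨QuotientAddGroup.mk (x ⊗ₜ[ℤ] (s • f)), ?_⟩
        ext y
        rw [DomMulAct.smul_linearMap_apply, gammaMap_tmul, gammaMap_tmul,
          DomMulAct.smul_linearMap_apply]

/-- `Coker γ_M` as a left `S`-module. -/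
abbrev CokerGamma : Type _ := Module.End Aᵐᵒᵖ M ⧸ gammaRange A M S

/-- `Coker γ_M` as a right `S`-module. (`Sᵈᵐᵃ` is a copy of the opposite ring `Sᵐᵒᵖ`.) -/
abbrev CokerGammaRight : Type _ := Module.End Aᵐᵒᵖ M ⧸ gammaRangeRight A M S

end Tensor

/-! ### Prime rings and maximal orders -/

/-- A prime ring: `R ≠ 0`, and `a R b = 0` implies `a = 0` or `b = 0`. -/
def IsPrimeRing (R : Type*) [Ring R] : Prop :=
  Nontrivial R ∧ ∀ a b : R, (∀ r : R, a * r * b = 0) → a = 0 ∨ b = 0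

/-- `Q` is a quotient ring (every regular element of `Q` is a unit), and `R`, embedded in `Q` by `i`,
is a left and right order in `Q`: every element of `Q` has the forms `r s⁻¹` and `s'⁻¹ r'` with
`r, s, r', s' ∈ R`. -/
structure IsOrderIn {R Q : Type*} [Ring R] [Ring Q] (i : R →+* Q) : Prop where
  injective : Function.Injective i
  isUnit_of_isRegular : ∀ q : Q, IsRegular q → IsUnit q
  exists_right_fraction : ∀ q : Q, ∃ (r s : R) (t : Qˣ), i s = t ∧ q = i r * ↑t⁻¹
  exists_left_fraction : ∀ q : Q, ∃ (r s : R) (t : Qˣ), i s = t ∧ q = ↑t⁻¹ * i r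

/-- Equivalence of orders in `Q`: `a S b ⊆ T` and `c T d ⊆ S` for some units `a, b, c, d` of `Q`. -/
def OrdersEquivalent {Q : Type*} [Ring Q] (S T : Subring Q) : Prop :=
  (∃ a b : Qˣ, ∀ x ∈ S, (a : Q) * x * b ∈ T) ∧ ∃ c d : Qˣ, ∀ x ∈ T, (c : Q) * x * d ∈ S

/-- `R` is a maximal order (in its quotient ring `Q`): it is an order in `Q` and no order of `Q`
that is equivalent to `R` strictly contains `R`. (`Q` is unique up to isomorphism over `R`; and a
subring of `Q` containing `R` is automatically an order in `Q`.) -/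
def IsMaximalOrder (R : Type v) [Ring R] : Prop :=
  ∃ (Q : Type v) (_ : Ring Q) (i : R →+* Q), IsOrderIn i ∧
    ∀ T : Subring Q, i.range ≤ T → OrdersEquivalent i.range T → T = i.range

/-! ### Krull dimension in the sense of Gabriel and Rentschler -/

/-- The interval `[a, b]` of a poset has deviation at most the ordinal `o`: in every descending chain
`f 0 ≥ f 1 ≥ ⋯` in `[a, b]`, all but finitely many of the factors `[f (n+1), f n]` have deviation less
than `o`. (A trivial factor, `f (n+1) = f n`, has deviation `-∞`.) -/
def DeviationLE {P : Type*} [PartialOrder P] (o : Ordinal.{v}) (a b : P) : Prop :=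
  ∀ f : ℕ → P, Antitone f → (∀ n, a ≤ f n ∧ f n ≤ b) →
    ∃ N, ∀ n ≥ N, f (n + 1) = f n ∨ ∃ o', ∃ _ : o' < o, DeviationLE o' (f (n + 1)) (f n)
termination_by o

open Classical in
/-- The Krull dimension of an `S`-module `M`, i.e. the deviation of its lattice of submodules:
`⊥` (standing for `-∞`) if `M = 0`, and otherwise the least ordinal bounding the deviation.
The value `⊤` means that there is no such ordinal, which does not occur for noetherian modules. -/
noncomputable def krullDimension (S : Type*) [Ring S] (M : Type v) [AddCommGroup M] [Module S M] :
    WithBot (WithTop Ordinal.{v}) :=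
  if Subsingleton M then ⊥
  else if ∃ o : Ordinal.{v}, DeviationLE o (⊥ : Submodule S M) ⊤ then
    (((sInf {o : Ordinal.{v} | DeviationLE o (⊥ : Submodule S M) ⊤} : Ordinal.{v}) :
      WithTop Ordinal.{v}) : WithBot (WithTop Ordinal.{v}))
  else ((⊤ : WithTop Ordinal.{v}) : WithBot (WithTop Ordinal.{v}))

/-! ### Deviation of intervals -/

section Deviation

/-! Write A for the ring of invariants, Z for the center of `R`, and C = Z ∩ A. In both cases `H`
has a normalized integral e (the average over the group, or the function δ_1), and r ↦ e • r is an
A-bimodule projection E : R → A that maps Z into C.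

The ring C is a good base. Since `R` is a maximal order, Z is integrally closed; restricting E to Z
makes C a linear retract of Z, so C is integrally closed too. The normalized trace R → Z followed by
E splits C off from `R`; hence the ideals of C embed in the lattice of one-sided ideals of `R`, and
C is noetherian. Elements of Z have bounded degree over C: a central element is a root of its orbit
polynomial for a group action, and a sum of homogeneous components of bounded degree for a grading.
By `Module.Finite.of_forall_natDegree_le`, Z and therefore `R` are finite over C.

Let p be a prime of C of height at most one. If p ≠ 0, then C_p is a discrete valuation ring, R_p is
still maximal, and an ideal J that plays the role of the radical satisfies J⁻¹J = R_p
(`IsMaximalAt.mem_scaledInverse_mul`). So J is projective, and so are full lattices in free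
R_p-modules. Generically `R` is projective over A, because semisimplicity descends along E. Applying
the lattice statement to a suitable N ⊆ R^m and pushing its dual basis down through E gives s ∈ C
outside p, elements x_i of `R` and A-linear f_i : R → A with s y = ∑ x_i f_i(y)
(`IsMaximalOrderOver.isRankOneSum`). For every A-endomorphism g this yields g(s y) = ∑ g(x_i)
f_i(y), so s kills Coker γ.

Thus Coker γ is a finitely generated C-module supported only at primes p with a chain 0 < q < p. The
deviation of the ideals above a prime drops strictly when the prime grows, so the deviation of Coker
γ is smaller by two than that of C (`exists_deviationLE_add_two`), which is at most that of `R`. -/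

theorem DeviationLE.mono {P : Type*} [PartialOrder P] {o o' : Ordinal.{v}} (h : o ≤ o') {a b : P}
    (hd : DeviationLE o a b) : DeviationLE o' a b := by
  rw [DeviationLE] at hd ⊢
  intro f hf hab
  obtain ⟨N, hN⟩ := hd f hf hab
  refine ⟨N, fun n hn => (hN n hn).imp_right ?_⟩
  rintro ⟨o₁, h₁, h₂⟩
  exact ⟨o₁, h₁.trans_le h, h₂⟩

theorem deviationLE_self {P : Type*} [PartialOrder P] (o : Ordinal.{v}) (a : P) :
    DeviationLE o a a := by
  rw [DeviationLE]
  intro f _ hab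
  have h : ∀ n, f n = a := fun n => le_antisymm (hab n).2 (hab n).1
  exact ⟨0, fun n _ => Or.inl (by rw [h, h])⟩

/-- Deviation does not increase along a strictly monotone map of intervals. -/
theorem DeviationLE.of_map {P Q : Type*} [PartialOrder P] [PartialOrder Q] (φ : P → Q)
    (o : Ordinal.{v}) : ∀ {a b : P} {a' b' : Q},
    (∀ x y, a ≤ x → x ≤ y → y ≤ b → φ x ≤ φ y) →
    (∀ x y, a ≤ x → x ≤ y → y ≤ b → φ x = φ y → x = y) →
    a ≤ b → a' ≤ φ a → φ b ≤ b' → DeviationLE o a' b' → DeviationLE o a b := by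
  induction o using WellFoundedLT.induction with
  | ind o ih =>
    intro a b a' b' hmono hinj hab ha hb hd
    rw [DeviationLE] at hd ⊢
    intro f hf hfab
    obtain ⟨N, hN⟩ := hd (fun n => φ (f n))
      (fun m n hmn => hmono _ _ (hfab n).1 (hf hmn) (hfab m).2)
      (fun n => ⟨ha.trans (hmono _ _ le_rfl (hfab n).1 (hfab n).2),
        (hmono _ _ (hfab n).1 (hfab n).2 le_rfl).trans hb⟩)
    refine ⟨N, fun n hn => ?_⟩
    have hle : f (n + 1) ≤ f n := hf (Nat.le_succ n)
    rcases hN n hn with h | ⟨o', ho', h⟩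
    · exact Or.inl (hinj _ _ (hfab _).1 hle (hfab _).2 h)
    · refine Or.inr ⟨o', ho', ih o' ho' (fun x y h1 h2 h3 => ?_) (fun x y h1 h2 h3 => ?_) hle
        le_rfl le_rfl h⟩
      · exact hmono x y ((hfab _).1.trans h1) h2 (h3.trans (hfab _).2)
      · exact hinj x y ((hfab _).1.trans h1) h2 (h3.trans (hfab _).2)

/-- In a modular lattice, the deviation of an interval `[x, y]` is bounded by the deviations of its
traces below and above an element `b`. -/
theorem DeviationLE.of_inf_sup {P : Type*} [Lattice P] [IsModularLattice P] (b : P)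
    (o : Ordinal.{v}) : ∀ {x y : P}, DeviationLE o (x ⊓ b) (y ⊓ b) → DeviationLE o (x ⊔ b) (y ⊔ b) →
    DeviationLE o x y := by
  induction o using WellFoundedLT.induction with
  | ind o ih =>
    intro x y h1 h2
    rw [DeviationLE] at h1 h2 ⊢
    intro f hf hxy
    obtain ⟨N₁, hN₁⟩ := h1 (fun n => f n ⊓ b) (fun m n h => inf_le_inf_right _ (hf h))
      (fun n => ⟨inf_le_inf_right _ (hxy n).1, inf_le_inf_right _ (hxy n).2⟩)
    obtain ⟨N₂, hN₂⟩ := h2 (fun n => f n ⊔ b) (fun m n h => sup_le_sup_right (hf h) _)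
      (fun n => ⟨sup_le_sup_right (hxy n).1 _, sup_le_sup_right (hxy n).2 _⟩)
    refine ⟨max N₁ N₂, fun n hn => ?_⟩
    have hle : f (n + 1) ≤ f n := hf (Nat.le_succ n)
    have key : ∀ o' < o, DeviationLE o' (f (n + 1) ⊓ b) (f n ⊓ b) →
        DeviationLE o' (f (n + 1) ⊔ b) (f n ⊔ b) →
        ∃ o', ∃ _ : o' < o, DeviationLE o' (f (n + 1)) (f n) :=
      fun o' ho' h1 h2 => ⟨o', ho', ih o' ho' h1 h2⟩
    rcases hN₁ n ((le_max_left _ _).trans hn) with e₁ | ⟨o₁, l₁, d₁⟩ <;>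
      rcases hN₂ n ((le_max_right _ _).trans hn) with e₂ | ⟨o₂, l₂, d₂⟩
    · exact Or.inl (eq_of_le_of_inf_le_of_sup_le hle e₁.ge e₂.ge)
    · exact Or.inr (key o₂ l₂ (by rw [e₁]; exact deviationLE_self _ _) d₂)
    · exact Or.inr (key o₁ l₁ d₁ (by rw [e₂]; exact deviationLE_self _ _))
    · exact Or.inr (key _ (max_lt l₁ l₂) (d₁.mono (le_max_left _ _)) (d₂.mono (le_max_right _ _)))

end Deviation

/-! ### Krull dimension and prime ideals of codimension at least two -/

section CommKrull

variable {C : Type*} [CommRing C]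

/-- Between primes `q < p` the deviation of the lattice of ideals above drops. -/
theorem Ideal.exists_deviationLE_lt {q p : Ideal C} (hq : q.IsPrime) (hp : p.IsPrime) (hqp : q < p)
    {o : Ordinal.{v}} (h : DeviationLE o q ⊤) : ∃ o' < o, DeviationLE o' p ⊤ := by
  obtain ⟨c, hcp, hcq⟩ := SetLike.exists_of_lt hqp
  rw [DeviationLE] at h
  -- Every factor of the chain q + (c^n) contains a copy of the ideals above p, by I ↦ q + c^n I: as
  -- q is prime and c ∉ q, the factor c^n can be cancelled modulo q.
  obtain ⟨N, hN⟩ := h (fun n => q ⊔ Ideal.span {c ^ n})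
    (fun m n hmn => sup_le_sup_left
      (Ideal.span_singleton_le_span_singleton.2 (pow_dvd_pow c hmn)) _)
    (fun n => ⟨le_sup_left, le_top⟩)
  have hmem : ∀ (n : ℕ) (I : Ideal C) (x : C), q ≤ I →
      c ^ n * x ∈ q ⊔ Ideal.span {c ^ n} * I → x ∈ I := by
    intro n I x hqI hx
    obtain ⟨y, hy, z, hz, hyz⟩ := Submodule.mem_sup.1 hx
    obtain ⟨w, hw, rfl⟩ := Ideal.mem_span_singleton_mul.1 hz
    have h1 : c ^ n * (x - w) ∈ q := by
      rw [mul_sub, ← hyz]; simpa using hy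
    have h2 := (hq.mem_or_mem h1).resolve_left fun h => hcq (hq.mem_of_pow_mem n h)
    simpa using I.add_mem (hqI h2) hw
  rcases hN N le_rfl with h | ⟨o', ho', h⟩
  -- If the chain stopped at N, then c^N would lie in q + c^N p, and cancelling c^N would give 1 ∈
  -- p.
  · exfalso
    have h1 : c ^ N * 1 ∈ q ⊔ Ideal.span {c ^ N} * p := by
      have h2 : c ^ N ∈ q ⊔ Ideal.span {c ^ N} :=
        Ideal.mem_sup_right (Ideal.mem_span_singleton_self _)
      have h3 : q ⊔ Ideal.span {c ^ (N + 1)} = q ⊔ Ideal.span {c ^ N} := h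
      rw [← h3] at h2
      rw [mul_one]
      refine (sup_le_sup_left ?_ q : q ⊔ Ideal.span {c ^ (N + 1)} ≤ _) h2
      rw [Ideal.span_singleton_le_iff_mem, pow_succ]
      exact Ideal.mul_mem_mul (Ideal.mem_span_singleton_self _) hcp
    exact hp.ne_top ((Ideal.eq_top_iff_one _).2 (hmem N p 1 hqp.le h1))
  · refine ⟨o', ho', DeviationLE.of_map (fun I => q ⊔ Ideal.span {c ^ N} * I) o' ?_ ?_ le_top
      ?_ ?_ h⟩
    · intro x y _ hxy _
      exact sup_le_sup_left (Ideal.mul_mono_right hxy) _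
    · intro x y hpx hxy _ hEq
      refine le_antisymm hxy fun z hz => hmem N x z (hqp.le.trans hpx) ?_
      rw [hEq]
      exact Ideal.mem_sup_right (Ideal.mul_mem_mul (Ideal.mem_span_singleton_self _) hz)
    · refine sup_le_sup_left ?_ _
      rw [Ideal.span_singleton_le_iff_mem, pow_succ]
      exact Ideal.mul_mem_mul (Ideal.mem_span_singleton_self _) hcp
    · simp

/-- A finitely generated module over a noetherian domain which vanishes in codimension at most one
has deviation smaller by two. -/
theorem exists_deviationLE_add_two [IsDomain C] {M : Type*} [AddCommGroup M] [Module C M]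
    [IsNoetherian C M] (hM : ∀ p : Ideal C, p.IsPrime → (∀ q : Ideal C, q.IsPrime → q < p → q = ⊥) →
      ∃ s ∉ p, ∀ x : M, s • x = 0) {o : Ordinal.{v}} (ho : DeviationLE o (⊥ : Ideal C) ⊤)
    [IsNoetherianRing C] [Nontrivial M] :
    ∃ o', o' + 2 ≤ o ∧ DeviationLE o' (⊥ : Submodule C M) ⊤ := by
  suffices H : (⊤ : Submodule C M) = ⊥ ∨
      ∃ o', o' + 2 ≤ o ∧ DeviationLE o' (⊥ : Submodule C M) ⊤ from
    H.resolve_left top_ne_bot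
  -- A prime filtration built from below: N grows by an element whose annihilator modulo N is prime.
  -- The case N = ⊥ is kept apart because no ordinal o' with o' + 2 ≤ o is known until a first
  -- factor has been found.
  refine WellFoundedGT.induction_top (P := fun N : Submodule C M => N = ⊥ ∨
      ∃ o', o' + 2 ≤ o ∧ DeviationLE o' (⊥ : Submodule C M) N) ⟨⊥, Or.inl rfl⟩ ?_
  intro N hN hNd
  have := Submodule.Quotient.nontrivial_iff.mpr hN
  obtain ⟨p, hp⟩ := associatedPrimes.nonempty C (M ⧸ N)
  rw [AssociatedPrimes.mem_iff, isAssociatedPrime_iff] at hp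
  obtain ⟨hp, x, rfl⟩ := hp
  obtain ⟨x, rfl⟩ := Submodule.mkQ_surjective _ x
  set p := (⊥ : Submodule C (M ⧸ N)).colon {N.mkQ x} with hpdef
  have hmem : ∀ c, c ∈ p ↔ c • x ∈ N := by
    intro c
    rw [hpdef, Submodule.mem_colon_singleton, ← map_smul, Submodule.mem_bot, Submodule.mkQ_apply,
      Submodule.Quotient.mk_eq_zero]
  have hxN : x ∉ N := fun h => hp.ne_top ((Ideal.eq_top_iff_one _).2 ((hmem 1).2 (by simpa)))
  -- In height at most one some s ∉ p would kill M, hence kill x modulo N, which is absurd. So there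
  -- is q with 0 < q < p, and the deviation drops twice.
  have hdev : ∃ o', o' + 2 ≤ o ∧ DeviationLE o' p ⊤ := by
    by_cases hh : ∀ q : Ideal C, q.IsPrime → q < p → q = ⊥
    · obtain ⟨s, hs, hsM⟩ := hM p hp hh
      exact absurd ((hmem s).2 (by rw [hsM]; exact N.zero_mem)) hs
    · push Not at hh
      obtain ⟨q, hq, hqp, hq0⟩ := hh
      obtain ⟨o₁, ho₁, h₁⟩ := Ideal.exists_deviationLE_lt Ideal.isPrime_bot hq
        (bot_lt_iff_ne_bot.2 hq0) ho
      obtain ⟨o₂, ho₂, h₂⟩ := Ideal.exists_deviationLE_lt hq hp hqp h₁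
      refine ⟨o₂, ?_, h₂⟩
      rw [← one_add_one_eq_two, ← add_assoc, ← Order.succ_eq_add_one, ← Order.succ_eq_add_one]
      exact Order.succ_le_of_lt ((Order.succ_le_of_lt ho₂).trans_lt ho₁)
  obtain ⟨o₁, ho₁, h₁⟩ := hdev
  -- The interval from N to N + Cx is a copy of the ideals above p, by K ↦ {c | c x ∈ K}.
  have hstep : DeviationLE o₁ N (N ⊔ Submodule.span C {x}) := by
    refine DeviationLE.of_map (fun K => K.comap (LinearMap.toSpanSingleton C M x)) o₁ ?_ ?_
      le_sup_left ?_ le_top h₁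
    · intro K K' _ h _
      exact Submodule.comap_mono h
    · intro K K' hNK hKK hK' hEq
      refine le_antisymm hKK fun y hy => ?_
      obtain ⟨n, hn, z, hz, rfl⟩ := Submodule.mem_sup.1 (hK' hy)
      obtain ⟨c, rfl⟩ := Submodule.mem_span_singleton.1 hz
      have hc : c ∈ K'.comap (LinearMap.toSpanSingleton C M x) := by
        simpa using K'.sub_mem hy (hKK (hNK hn))
      rw [← hEq] at hc
      exact K.add_mem (hNK hn) (by simpa using hc)
    · intro c hc
      simpa using (hmem c).1 hc
  have hlt : N < N ⊔ Submodule.span C {x} :=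
    left_lt_sup.2 fun h => hxN (h (Submodule.mem_span_singleton_self x))
  refine ⟨_, hlt, Or.inr ?_⟩
  rcases hNd with rfl | ⟨o₂, ho₂, h₂⟩
  · exact ⟨o₁, ho₁, hstep⟩
  · refine ⟨max o₁ o₂, by rcases max_choice o₁ o₂ with h | h <;> rwa [h], ?_⟩
    refine DeviationLE.of_inf_sup N _ ?_ ?_
    · simpa using h₂.mono (le_max_right _ _)
    · simpa using hstep.mono (le_max_left _ _)

/-- If `C` is a direct summand of an `S`-module `M` (with `C` acting by `S`-endomorphisms), then the
deviation of the lattice of ideals of `C` is at most that of `M`. -/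
theorem Ideal.exists_strictMono_of_retraction {S M : Type*} [Ring S] [AddCommGroup M] [Module S M]
    [Module C M] [SMulCommClass S C M] (t : M →ₗ[C] C) {m : M} (ht : t m = 1) :
    ∃ φ : Ideal C → Submodule S M, StrictMono φ := by
  refine ⟨fun I =>
    { toAddSubmonoid := (I • ⊤ : Submodule C M).toAddSubmonoid
      smul_mem' := ?_ }, ?_⟩
  · intro s x hx
    refine Submodule.smul_induction_on (p := fun x => s • x ∈ (I • ⊤ : Submodule C M)) hx ?_ ?_
    · intro c hc y _
      rw [smul_comm]
      exact Submodule.smul_mem_smul hc trivial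
    · intro x y hx hy
      rw [smul_add]
      exact add_mem hx hy
  · refine Monotone.strictMono_of_injective ?_ ?_
    · intro I J hIJ x hx
      exact Submodule.smul_mono_left hIJ hx
    · intro I J hIJ
      -- The map t sends I M into I and c m to c, so I is recovered from I M.
      have key : ∀ (I : Ideal C) (x : M), x ∈ (I • ⊤ : Submodule C M) → t x ∈ I := by
        intro I x hx
        refine Submodule.smul_induction_on (p := fun x => t x ∈ I) hx ?_ ?_
        · intro c hc y _
          rw [map_smul]
          exact I.mul_mem_right _ hc
        · intro x y hx hy
          rw [map_add]
          exact add_mem hx hy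
      have h2 : ∀ x : M, x ∈ (I • ⊤ : Submodule C M) ↔ x ∈ (J • ⊤ : Submodule C M) := fun x =>
        SetLike.ext_iff.1 hIJ x
      ext c
      constructor
      · intro hc
        simpa [ht] using key J (c • m) ((h2 _).1 (Submodule.smul_mem_smul hc trivial))
      · intro hc
        simpa [ht] using key I (c • m) ((h2 _).2 (Submodule.smul_mem_smul hc trivial))

theorem isNoetherianRing_of_retraction {S M : Type*} [Ring S] [AddCommGroup M] [Module S M]
    [IsNoetherian S M] [Module C M] [SMulCommClass S C M] (t : M →ₗ[C] C) {m : M} (ht : t m = 1) :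
    IsNoetherianRing C := by
  obtain ⟨φ, hφ⟩ := Ideal.exists_strictMono_of_retraction (S := S) t ht
  rw [isNoetherianRing_iff, isNoetherian_iff']
  exact hφ.wellFoundedGT

/-- Transfers the bound from C to the noncommutative rings. The embedding φ makes the deviation of C
at most that of M', and S-submodules of M are C-submodules, so the deviation of M over S is at most
that over C. If M' has no deviation, the right side is ⊤. -/
theorem krullDimension_add_two_le [IsDomain C] [IsNoetherianRing C]
    {S : Type*} [Ring S] {M : Type v} [AddCommGroup M] [Module S M]
    {S' : Type*} [Ring S'] {M' : Type v} [AddCommGroup M'] [Module S' M'] [Nontrivial M']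
    (φ : Ideal C → Submodule S' M') (hφ : StrictMono φ)
    [Module C M] [IsNoetherian C M] (f : C → S) (hf : ∀ (c : C) (x : M), c • x = f c • x)
    (hM : ∀ p : Ideal C, p.IsPrime → (∀ q : Ideal C, q.IsPrime → q < p → q = ⊥) →
      ∃ s ∉ p, ∀ x : M, s • x = 0) :
    krullDimension S M + 2 ≤ krullDimension S' M' := by
  classical
  by_cases hsub : Subsingleton M
  · rw [krullDimension, if_pos hsub, WithBot.bot_add]
    exact bot_le
  have hnt : Nontrivial M := not_subsingleton_iff_nontrivial.1 hsub
  have hsub' : ¬ Subsingleton M' := not_subsingleton_iff_nontrivial.2 inferInstance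
  rw [krullDimension, if_neg hsub, krullDimension, if_neg hsub']
  by_cases ho : ∃ o : Ordinal.{v}, DeviationLE o (⊥ : Submodule S' M') ⊤
  · rw [if_pos ho]
    set o := sInf {o : Ordinal.{v} | DeviationLE o (⊥ : Submodule S' M') ⊤}
    have hoC : DeviationLE o (⊥ : Ideal C) ⊤ :=
      DeviationLE.of_map φ o (fun x y _ h _ => hφ.monotone h)
        (fun x y _ h _ he => by_contra fun hne => (hφ (lt_of_le_of_ne h hne)).ne he)
        bot_le bot_le le_top (csInf_mem (s := {o | DeviationLE o (⊥ : Submodule S' M') ⊤}) ho)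
    obtain ⟨o', ho', hd⟩ := exists_deviationLE_add_two (M := M) hM hoC
    have hd' : DeviationLE o' (⊥ : Submodule S M) ⊤ := by
      refine DeviationLE.of_map (fun K : Submodule S M =>
        ({ toAddSubmonoid := K.toAddSubmonoid
           smul_mem' := fun c x hx => by rw [hf]; exact K.smul_mem _ hx } : Submodule C M))
        o' (fun x y _ h _ => h) (fun x y _ h _ he => ?_) bot_le bot_le le_top hd
      ext z
      exact SetLike.ext_iff.1 he z
    rw [if_pos ⟨o', hd'⟩]
    have h1 : sInf {o : Ordinal.{v} | DeviationLE o (⊥ : Submodule S M) ⊤} + 2 ≤ o :=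
      (add_le_add_left (csInf_le' (show o' ∈ {o : Ordinal.{v} |
        DeviationLE o (⊥ : Submodule S M) ⊤} from hd')) 2).trans ho'
    have h2 : (2 : WithBot (WithTop Ordinal.{v})) = (((2 : Ordinal.{v}) : WithTop Ordinal.{v}) :
      WithBot (WithTop Ordinal.{v})) := rfl
    rw [h2, ← WithBot.coe_add, ← WithTop.coe_add]
    exact WithBot.coe_le_coe.2 (WithTop.coe_le_coe.2 h1)
  · rw [if_neg ho]
    exact le_top

end CommKrull

/-! ### Invertibility of the radical of a maximal order over a discrete valuation ring -/

section Radical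

variable {Λ : Type*} [Ring Λ]

/-- A form of maximality for an order `Λ` with respect to a central element `π`: for two-sided
ideals `I` containing a power of `π`, the left and the right multiplier ring of `I` in `Λ[π⁻¹]`
is `Λ`. -/
def IsMaximalAt (π : Λ) : Prop :=
  ∀ I : Ideal Λ, I.IsTwoSided → (∃ n, π ^ n ∈ I) → ∀ x,
    (∀ y ∈ I, ∃ z ∈ I, x * y = π * z) ∨ (∀ y ∈ I, ∃ z ∈ I, y * x = π * z) → π ∣ x

variable {π : Λ}

theorem Ideal.mul_induction_left {I J : Ideal Λ} {p : Λ → Prop} {a : Λ} (ha : a ∈ I * J)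
    (hmul : ∀ x ∈ I, ∀ y ∈ J, p (x * y)) (hadd : ∀ x y, p x → p y → p (x + y)) : p a :=
  Submodule.smul_induction_on (p := p) (show a ∈ I • J from ha) hmul hadd

/-- For y ∈ I, the element x y multiplies I into π I from the right, because I x ⊆ π Λ and Λ y ⊆ I.
Maximality then gives π ∣ x y. This is the exchange of sides behind the cyclic rotations of products
below. -/
theorem IsMaximalAt.dvd_mul_of_dvd_mul (h : IsMaximalAt π)
    {I : Ideal Λ} [I.IsTwoSided] (hI : ∃ n, π ^ n ∈ I) {x : Λ} (hx : ∀ y ∈ I, π ∣ y * x) :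
    ∀ y ∈ I, π ∣ x * y := by
  intro y hy
  refine h I inferInstance hI _ (Or.inr fun z hz => ?_)
  obtain ⟨t, ht⟩ := hx z hz
  exact ⟨t * y, I.mul_mem_left _ hy, by rw [← mul_assoc, ht, mul_assoc]⟩

/-- Maximality is used twice: it gives x = π t, and cancelling π shows that t still multiplies I
into π I. -/
theorem IsMaximalAt.dvd_dvd (h : IsMaximalAt π) (hc : ∀ x, π * x = x * π)
    (hr : ∀ x y, π * x = π * y → x = y) {I : Ideal Λ} [I.IsTwoSided] (hI : ∃ n, π ^ n ∈ I) {x : Λ}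
    (hx : ∀ y ∈ I, ∃ z ∈ I, y * x = π * (π * z)) : ∃ t, x = π * (π * t) := by
  obtain ⟨t, rfl⟩ := h I inferInstance hI x (Or.inr fun y hy => by
    obtain ⟨z, hz, hyz⟩ := hx y hy
    exact ⟨π * z, I.mul_mem_left _ hz, hyz⟩)
  obtain ⟨s, rfl⟩ := h I inferInstance hI t (Or.inr fun y hy => by
    obtain ⟨z, hz, hyz⟩ := hx y hy
    exact ⟨z, hz, hr _ _ (by rw [← hyz, ← mul_assoc, hc, mul_assoc])⟩)
  exact ⟨s, rfl⟩

/-- `{x | J x ⊆ π Λ}`, that is `π J⁻¹`. -/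
def Ideal.scaledInverse (J : Ideal Λ) [J.IsTwoSided] (π : Λ) : Ideal Λ where
  carrier := {x | ∀ y ∈ J, π ∣ y * x}
  zero_mem' := fun y _ => by simp
  add_mem' := fun ha hb y hy => by rw [mul_add]; exact dvd_add (ha y hy) (hb y hy)
  smul_mem' := fun a x hx y hy => by
    rw [smul_eq_mul, ← mul_assoc]; exact hx _ (J.mul_mem_right _ hy)

instance (J : Ideal Λ) [J.IsTwoSided] : (J.scaledInverse π).IsTwoSided :=
  ⟨fun b hx y hy => by rw [← mul_assoc]; exact (hx y hy).mul_right b⟩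

/-- `{w | π w ∈ K}`. -/
def Ideal.divCentral (K : Ideal Λ) (hc : ∀ x, π * x = x * π) : Ideal Λ where
  carrier := {w | π * w ∈ K}
  zero_mem' := by simp
  add_mem' := fun ha hb => by
    simp only [Set.mem_ofPred_eq, mul_add] at *; exact K.add_mem ha hb
  smul_mem' := fun a x hx => by
    simp only [Set.mem_ofPred_eq, smul_eq_mul] at *
    rw [← mul_assoc, hc, mul_assoc]; exact K.mul_mem_left _ hx

theorem Ideal.mem_divCentral {K : Ideal Λ} {hc : ∀ x, π * x = x * π} {w : Λ} :
    w ∈ K.divCentral hc ↔ π * w ∈ K := Iff.rfl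

instance (K : Ideal Λ) [K.IsTwoSided] (hc : ∀ x, π * x = x * π) : (K.divCentral hc).IsTwoSided :=
  ⟨fun b hx => by
    rw [Ideal.mem_divCentral] at *; rw [← mul_assoc]; exact K.mul_mem_right _ hx⟩

variable (J : Ideal Λ) [J.IsTwoSided]

/-- In fractions, W = J⁻¹J and the claim is 1 ∈ W. The inverse of W is trivial, so W can be deleted
from products contained in π Λ. Let Y be the right annihilator of W modulo J. From (W Y)^n ⊆ J^n ⊆ π
Λ one gets Y^n ⊆ π Λ ⊆ W. Semisimplicity of Λ / J puts in Y an element 1 - f with f ∈ W, so (1 -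
f)^n ∈ W and hence 1 ∈ W. -/
theorem IsMaximalAt.mem_scaledInverse_mul (h : IsMaximalAt π) (hc : ∀ x, π * x = x * π)
    (hr : ∀ x y, π * x = π * y → x = y) (hπJ : π ∈ J) {n : ℕ} (hn : ∀ x ∈ J ^ n, π ∣ x)
    [IsSemisimpleRing (Λ ⧸ J)] : π ∈ J.scaledInverse π * J := by
  set J' := J.scaledInverse π with hJ'
  set W := (J' * J).divCentral hc with hW
  have hJ'π : π ∈ J' := fun y _ => ⟨y, (hc y).symm⟩
  have hJ'J : ∀ a ∈ J' * J, π ∣ a := by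
    intro a ha
    refine Ideal.mul_induction_left (p := fun a => π ∣ a) ha ?_ ?_
    · intro x hx y hy
      exact h.dvd_mul_of_dvd_mul ⟨1, by simpa using hπJ⟩ hx y hy
    · intro x y hx hy
      exact dvd_add hx hy
  have hJW : J ≤ W := fun y hy => Ideal.mul_mem_mul hJ'π hy
  -- the inverse of `W` is trivial
  have key : ∀ x, (∀ w ∈ W, π ∣ w * x) → π ∣ x := by
    intro x hx
    have h1 : ∀ a ∈ J' * J, ∃ t, a * x = π * (π * t) := by
      intro a ha
      obtain ⟨w, rfl⟩ := hJ'J a ha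
      obtain ⟨t, ht⟩ := hx w ha
      exact ⟨t, by rw [mul_assoc, ht]⟩
    -- Multiplication by y x x' from the right takes J' into π² J', so the double divisibility
    -- applies with the ideal J'.
    have h2 : ∀ y ∈ J, ∀ x' ∈ J', ∃ t, y * (x * x') = π * (π * t) := by
      intro y hy x' hx'
      refine h.dvd_dvd hc hr (I := J') ⟨1, by simpa using hJ'π⟩ fun z hz => ?_
      obtain ⟨t, ht⟩ := h1 (z * y) (Ideal.mul_mem_mul hz hy)
      exact ⟨t * x', J'.mul_mem_left _ hx', by
        rw [← mul_assoc, ← mul_assoc, ht]; simp only [mul_assoc]⟩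
    -- The case y = π of `h2` gives x x' = π t, and the other y ∈ J show t ∈ J'. So x multiplies J'
    -- into π J' from the left.
    refine h J' inferInstance ⟨1, by simpa using hJ'π⟩ x (Or.inl fun x' hx' => ?_)
    obtain ⟨t, ht⟩ := h2 π hπJ x' hx'
    have ht' := hr _ _ ht
    refine ⟨t, fun y hy => ?_, ht'⟩
    obtain ⟨s, hs⟩ := h2 y hy x' hx'
    refine ⟨s, hr _ _ ?_⟩
    rw [← hs, ht', ← mul_assoc, hc y, mul_assoc]
  -- If a W b ⊆ π Λ, exchanging sides gives W b a ⊆ π Λ, and triviality of the inverse of W removes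
  -- W. The price of deleting W is a rotation, which `rule'` can undo.
  have rule : ∀ a b : Ideal Λ, a.IsTwoSided → b.IsTwoSided → (∃ n, π ^ n ∈ a) →
      (∀ z ∈ a * (W * b), π ∣ z) → ∀ z ∈ b * a, π ∣ z := by
    intro a b ha hb hna hz z hz'
    refine Ideal.mul_induction_left (p := fun z => π ∣ z) hz' ?_ fun x y hx hy => dvd_add hx hy
    intro β hβ α hα
    refine key _ fun w hw => ?_
    rw [← mul_assoc]
    refine h.dvd_mul_of_dvd_mul hna (x := w * β) (fun α' hα' => ?_) α hα
    exact hz _ (Ideal.mul_mem_mul hα' (Ideal.mul_mem_mul hw hβ))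
  have rule' : ∀ a b : Ideal Λ, a.IsTwoSided → b.IsTwoSided → (∃ n, π ^ n ∈ a) →
      (∀ z ∈ a * b, π ∣ z) → ∀ z ∈ b * a, π ∣ z := fun a b ha hb hna hz =>
    rule a b ha hb hna fun z hz' => hz z (Ideal.mul_mono_right Ideal.mul_le_right hz')
  -- a complement of `W` modulo `J`
  obtain ⟨e, he, hspan⟩ := IsSemisimpleRing.ideal_eq_span_idempotent
    (W.map (Ideal.Quotient.mk J))
  obtain ⟨f, hf, rfl⟩ : ∃ f ∈ W, Ideal.Quotient.mk J f = e := by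
    have : e ∈ W.map (Ideal.Quotient.mk J) := by
      rw [hspan]; exact Ideal.mem_span_singleton_self e
    exact (Ideal.mem_map_iff_of_surjective _ Ideal.Quotient.mk_surjective).1 this
  have hfW : ∀ w ∈ W, w * (1 - f) ∈ J := by
    intro w hw
    have h1 : Ideal.Quotient.mk J w ∈ Ideal.span {Ideal.Quotient.mk J f} := by
      rw [← hspan]; exact Ideal.mem_map_of_mem _ hw
    obtain ⟨a, ha⟩ := Submodule.mem_span_singleton.1 h1
    rw [← Ideal.Quotient.eq_zero_iff_mem, map_mul, ← ha, map_sub, map_one, smul_eq_mul, mul_assoc,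
      mul_sub, he.eq, mul_one, sub_self, mul_zero]
  let Y : Ideal Λ :=
    { carrier := {y | ∀ w ∈ W, w * y ∈ J}
      zero_mem' := fun w _ => by simp
      add_mem' := fun ha hb w hw => by rw [mul_add]; exact J.add_mem (ha w hw) (hb w hw)
      smul_mem' := fun a y hy w hw => by
        rw [smul_eq_mul, ← mul_assoc]; exact hy _ (W.mul_mem_right _ hw) }
  have hY : Y.IsTwoSided := ⟨fun b hy w hw => by
    rw [← mul_assoc]; exact J.mul_mem_right _ (hy w hw)⟩
  have hπY : π ∈ Y := fun w _ => J.mul_mem_left _ hπJ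
  have hπW : π ∈ W := hJW hπJ
  have hWY : W * Y ≤ J := Ideal.mul_le.2 fun w hw y hy => hy w hw
  -- One factor W is deleted at a time: Y^i W Y (W Y)^j becomes Y (W Y)^j Y^i, and a second rotation
  -- gives Y^(i+1) (W Y)^j.
  have hpow : ∀ j i : ℕ, (∀ z ∈ Y ^ i * (W * Y) ^ j, π ∣ z) → ∀ z ∈ Y ^ (i + j), π ∣ z := by
    intro j
    induction j with
    | zero => intro i hi z hz; exact hi z (by simpa [Submodule.pow_zero, Ideal.IsTwoSided.mul_one])
    | succ j ih =>
      intro i hi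
      have e1 : i + (j + 1) = (i + 1) + j := by omega
      rw [e1]
      refine ih (i + 1) ?_
      have h1 : ∀ z ∈ (Y * (W * Y) ^ j) * Y ^ i, π ∣ z := by
        refine rule (Y ^ i) _ inferInstance inferInstance ⟨i, Ideal.pow_mem_pow hπY i⟩ ?_
        rwa [Ideal.IsTwoSided.pow_succ, Ideal.mul_assoc (I := W)] at hi
      have h2 := rule' _ _ inferInstance inferInstance ⟨1 + 2 * j, ?_⟩ h1
      · rwa [← Ideal.mul_assoc, ← Submodule.pow_succ] at h2
      · rw [pow_add, pow_one, pow_mul, sq]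
        exact Ideal.mul_mem_mul hπY (Ideal.pow_mem_pow (Ideal.mul_mem_mul hπW hπY) j)
  have hYn : ∀ z ∈ Y ^ n, π ∣ z := by
    have := hpow n 0 (fun z hz => hn z (Ideal.pow_right_mono hWY n (Ideal.mul_le_right hz)))
    rwa [zero_add] at this
  have h1f : ∀ m : ℕ, (1 - f) ^ m ∈ W → (1 : Λ) ∈ W := by
    intro m
    induction m with
    | zero => intro hm; simpa using hm
    | succ m ih =>
      intro hm
      refine ih ?_
      have : (1 - f) ^ m = (1 - f) ^ (m + 1) + (1 - f) ^ m * f := by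
        rw [pow_succ, mul_sub, mul_one, sub_add_cancel]
      rw [this]
      exact W.add_mem hm (W.mul_mem_left _ hf)
  have h1W : (1 : Λ) ∈ W := by
    refine h1f n ?_
    obtain ⟨t, ht⟩ := hYn _ (Ideal.pow_mem_pow (show (1 - f) ∈ Y from hfW) n)
    rw [ht]
    exact W.mul_mem_right _ hπW
  simpa [hW, Ideal.mem_divCentral] using h1W

theorem Ideal.exists_sum_of_mem_mul {I J : Ideal Λ} {a : Λ} (ha : a ∈ I * J) :
    ∃ (ι : Type) (_ : Fintype ι) (x m : ι → Λ), (∀ i, x i ∈ I) ∧ (∀ i, m i ∈ J) ∧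
      ∑ i, x i * m i = a := by
  refine Ideal.mul_induction_left (p := fun a => ∃ (ι : Type) (_ : Fintype ι) (x m : ι → Λ),
    (∀ i, x i ∈ I) ∧ (∀ i, m i ∈ J) ∧ ∑ i, x i * m i = a) ha ?_ ?_
  · intro x hx y hy
    exact ⟨Unit, inferInstance, fun _ => x, fun _ => y, fun _ => hx, fun _ => hy, by simp⟩
  · rintro _ _ ⟨ι, _, x, m, hx, hm, rfl⟩ ⟨κ, _, x', m', hx', hm', rfl⟩
    refine ⟨ι ⊕ κ, inferInstance, Sum.elim x x', Sum.elim m m', ?_, ?_, by simp⟩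
    · rintro (i | i); exacts [hx i, hx' i]
    · rintro (i | i); exacts [hm i, hm' i]

/-- If `π ∈ (π J⁻¹) J` then `J` is a projective left ideal. -/
theorem Ideal.projective_of_mem_scaledInverse_mul (hc : ∀ x, π * x = x * π)
    (hr : ∀ x y, π * x = π * y → x = y) (h : π ∈ J.scaledInverse π * J) :
    Module.Projective Λ J := by
  obtain ⟨ι, _, x, m, hx, hm, hsum⟩ := Ideal.exists_sum_of_mem_mul h
  choose q hq using fun (i : ι) (y : J) => hx i y y.2
  -- With π = ∑ x_i m_i, the functionals y ↦ y x_i / π and the elements m_i form a dual basis of J.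
  let α : J →ₗ[Λ] (ι → Λ) :=
    { toFun := fun y i => q i y
      map_add' := fun y z => by
        ext i
        refine hr _ _ ?_
        rw [Pi.add_apply, mul_add, ← hq, ← hq, ← hq, Submodule.coe_add, add_mul]
      map_smul' := fun a y => by
        ext i
        refine hr _ _ ?_
        rw [RingHom.id_apply, Pi.smul_apply, smul_eq_mul, ← mul_assoc, hc a, mul_assoc, ← hq, ← hq,
          Submodule.coe_smul, smul_eq_mul, mul_assoc] }
  let β : (ι → Λ) →ₗ[Λ] J := Fintype.linearCombination Λ (fun i => (⟨m i, hm i⟩ : J))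
  refine Module.Projective.of_split α β ?_
  ext y
  refine hr _ _ ?_
  simp only [LinearMap.comp_apply, β, α, Fintype.linearCombination_apply, LinearMap.coe_mk,
    AddHom.coe_mk, LinearMap.id_apply, AddSubmonoidClass.coe_finsetSum, Submodule.coe_smul,
    smul_eq_mul, Finset.mul_sum]
  simp only [← mul_assoc, ← hq]
  simp only [mul_assoc, ← Finset.mul_sum, hsum]
  exact (hc _).symm

/-- Submodules of a projective module `P` that contain `J P` are projective, when `J` is projective
as a left ideal and `Λ / J` is semisimple. -/
theorem Module.Projective.of_smul_top_le [Module.Projective Λ J] [IsSemisimpleRing (Λ ⧸ J)]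
    {P : Type*} [AddCommGroup P] [Module Λ P] [Module.Projective Λ P] (N : Submodule Λ P)
    (hN : J • (⊤ : Submodule Λ P) ≤ N) : Module.Projective Λ N := by
  classical
  have htors : Module.IsTorsionBySet Λ (P ⧸ J • (⊤ : Submodule Λ P)) J := by
    rintro x ⟨a, ha⟩
    obtain ⟨x, rfl⟩ := Submodule.mkQ_surjective _ x
    change a • _ = _
    rw [← map_smul, Submodule.mkQ_apply, Submodule.Quotient.mk_eq_zero]
    exact Submodule.smul_mem_smul ha trivial
  have hss : IsSemisimpleModule Λ (P ⧸ J • (⊤ : Submodule Λ P)) := by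
    let _ := htors.module
    exact htors.isSemisimpleModule_iff.1 inferInstance
  set mk := (J • (⊤ : Submodule Λ P)).mkQ
  obtain ⟨N', hN'⟩ := exists_isCompl (N.map mk)
  -- By semisimplicity N / J P is a summand of P / J P. Lifting the projection gives θ : P → N that
  -- is the identity on N modulo J P.
  obtain ⟨θ, hθ⟩ := Module.projective_lifting_property (mk.submoduleMap N)
    ((N.map mk).projectionOnto N' hN' ∘ₗ mk) (LinearMap.submoduleMap_surjective _ _)
  have hθN : ∀ n : N, (n : P) - θ n ∈ J • (⊤ : Submodule Λ P) := by
    intro n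
    have h1 := LinearMap.congr_fun hθ (n : P)
    have h2 : mk (θ n : P) = mk n := by
      have h3 := congrArg Subtype.val h1
      have h4 := Submodule.projectionOnto_apply_left hN' ⟨mk n, Submodule.mem_map_of_mem n.2⟩
      simp only [LinearMap.comp_apply] at h3
      rw [h4] at h3
      exact h3
    rw [← Submodule.ker_mkQ (J • (⊤ : Submodule Λ P)), LinearMap.mem_ker, map_sub, sub_eq_zero]
    exact h2.symm
  obtain ⟨s, hs⟩ := ‹Module.Projective Λ P›
  -- A section s of the free cover of P maps J P into the direct sum of copies of J, which is
  -- projective.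
  let inc : (P →₀ J) →ₗ[Λ] (P →₀ Λ) := Finsupp.mapRange.linearMap J.subtype
  have hinc : Function.Injective inc :=
    Finsupp.mapRange_injective _ (map_zero _) Subtype.val_injective
  have hrange : ∀ q ∈ J • (⊤ : Submodule Λ P), s q ∈ LinearMap.range inc := by
    intro q hq
    refine Submodule.smul_induction_on (p := fun q => s q ∈ LinearMap.range inc) hq ?_ ?_
    · intro a ha p _
      rw [map_smul]
      refine ⟨Finsupp.mapRange (fun r => (⟨a * r, J.mul_mem_right _ ha⟩ : J)) (by simp) (s p), ?_⟩
      ext i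
      simp [inc]
    · intro x y hx hy
      rw [map_add]
      exact add_mem hx hy
  let γ : (P →₀ J) →ₗ[Λ] N := Finsupp.lsum ℕ fun p =>
    { toFun := fun a => (⟨(a : Λ) • p, hN (Submodule.smul_mem_smul a.2 trivial)⟩ : N)
      map_add' := fun a b => by ext; simp [add_smul]
      map_smul' := fun a b => by ext; simp [mul_smul] }
  have hγ : ∀ g, (γ g : P) = Finsupp.linearCombination Λ id (inc g) := by
    intro g
    induction g using Finsupp.induction_linear with
    | zero => simp
    | add g g' h h' => simp [map_add, h, h']
    | single p a => simp [γ, inc]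
  let δ : N →ₗ[Λ] LinearMap.range inc :=
    LinearMap.codRestrict _ (s ∘ₗ (N.subtype - N.subtype ∘ₗ θ ∘ₗ N.subtype))
        (fun n => hrange _ (hθN n))
  let i₂ : N →ₗ[Λ] (P →₀ J) := (LinearEquiv.ofInjective inc hinc).symm.toLinearMap ∘ₗ δ
  have hi₂ : ∀ n : N, inc (i₂ n) = s ((n : P) - θ n) := by
    intro n
    exact congrArg Subtype.val ((LinearEquiv.ofInjective inc hinc).apply_symm_apply (δ n))
  have : Module.Projective Λ P := ⟨s, hs⟩
  have hfree : Module.Projective Λ (P →₀ J) :=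
    Module.Projective.of_equiv (finsuppLequivDFinsupp Λ).symm
  -- N is a retract of P ⊕ (P →₀ J): it embeds by n ↦ (n, s(n - θ n)), and θ + γ brings it back
  -- since γ undoes s on J P.
  refine Module.Projective.of_split (N.subtype.prod i₂) (θ.coprod γ) ?_
  ext n
  change (θ (n : P) : P) + γ (i₂ n) = n
  rw [hγ, hi₂, hs, add_sub_cancel]

/-- Full lattices in free modules over a maximal order over a discrete valuation ring are
projective. -/
theorem IsMaximalAt.projective (h : IsMaximalAt π) (hc : ∀ x, π * x = x * π)
    (hr : ∀ x y, π * x = π * y → x = y) (hπJ : π ∈ J) {n : ℕ} (hn : ∀ x ∈ J ^ n, π ∣ x)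
    [IsSemisimpleRing (Λ ⧸ J)] {F : Type*} [AddCommGroup F] [Module Λ F] [Module.Projective Λ F]
    (N : Submodule Λ F) {j : ℕ} (hN : ∀ v : F, π ^ j • v ∈ N) : Module.Projective Λ N := by
  have hJ : Module.Projective Λ J := J.projective_of_mem_scaledInverse_mul hc hr
    (h.mem_scaledInverse_mul J hc hr hπJ hn)
  have hpow : ∀ j : ℕ, ∀ x ∈ J ^ (n * j), π ^ j ∣ x := by
    intro j
    induction j with
    | zero => intro x _; simp
    | succ j ih =>
      intro x hx
      rw [Nat.mul_succ, Ideal.IsTwoSided.pow_add] at hx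
      refine Ideal.mul_induction_left (p := fun x => π ^ (j + 1) ∣ x) hx ?_
        fun x y hx hy => dvd_add hx hy
      intro a ha b hb
      obtain ⟨t, rfl⟩ := ih a ha
      obtain ⟨s, rfl⟩ := hn b hb
      exact ⟨t * s, by rw [pow_succ, mul_assoc, ← mul_assoc t, ← hc t]; simp only [mul_assoc]⟩
  -- Descent from F through N + J^i F, each containing J times its predecessor. At i = n j this is
  -- N, because J^(n j) ⊆ π^j Λ.
  have hstep : ∀ i : ℕ, Module.Projective Λ (N ⊔ J ^ i • (⊤ : Submodule Λ F) : Submodule Λ F) := by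
    intro i
    induction i with
    | zero =>
      rw [Submodule.pow_zero, Ideal.one_eq_top, Submodule.top_smul, sup_top_eq]
      exact Module.Projective.of_equiv (Submodule.topEquiv (R := Λ) (M := F)).symm
    | succ i ih =>
      set P := N ⊔ J ^ i • (⊤ : Submodule Λ F)
      have hle : N ⊔ J ^ (i + 1) • (⊤ : Submodule Λ F) ≤ P :=
        sup_le_sup_left (Submodule.smul_mono_left (Ideal.pow_le_pow_right (Nat.le_succ i))) _
      have h1 : Module.Projective Λ
          ((N ⊔ J ^ (i + 1) • (⊤ : Submodule Λ F)).comap P.subtype) := by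
        refine Module.Projective.of_smul_top_le J _ ?_
        rw [Submodule.smul_le]
        rintro a ha ⟨v, hv⟩ _
        rw [Submodule.mem_comap]
        obtain ⟨y, hy, z, hz, rfl⟩ := Submodule.mem_sup.1 hv
        change a • (y + z) ∈ _
        rw [smul_add]
        refine Submodule.add_mem_sup (N.smul_mem _ hy) ?_
        rw [Ideal.IsTwoSided.pow_succ, Submodule.mul_smul]
        exact Submodule.smul_mem_smul ha hz
      exact Module.Projective.of_equiv (Submodule.comapSubtypeEquivOfLe hle)
  have hlast := hstep (n * j)
  rwa [sup_eq_left.2] at hlast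
  rw [Submodule.smul_le]
  intro a ha v _
  obtain ⟨t, rfl⟩ := hpow j a ha
  rw [mul_smul]
  exact hN _

/-- The radical of `Λ` modulo a central element `π` with `Λ / π Λ` artinian. -/
theorem exists_isSemisimpleRing_quotient (π : Λ) [(Ideal.span {π}).IsTwoSided]
    [IsArtinianRing (Λ ⧸ Ideal.span {π})] : ∃ (J : Ideal Λ) (_ : J.IsTwoSided) (n : ℕ),
      IsSemisimpleRing (Λ ⧸ J) ∧ π ∈ J ∧ J ^ n ≤ Ideal.span {π} := by
  let q := Ideal.Quotient.mk (Ideal.span {π})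
  let B := Λ ⧸ Ideal.span {π}
  obtain ⟨n, hn⟩ := IsSemiprimaryRing.isNilpotent (R := B)
  have hq : Function.Surjective q := Ideal.Quotient.mk_surjective
  refine ⟨(Ring.jacobson B).comap q, inferInstance, n, ?_, ?_, ?_⟩
  · let f : B ⧸ Ring.jacobson B →+* Λ ⧸ (Ring.jacobson B).comap q :=
      Ideal.Quotient.lift _ (Ideal.Quotient.lift _ (Ideal.Quotient.mk _) (by
        intro a ha
        rw [Ideal.Quotient.eq_zero_iff_mem, Ideal.mem_comap]
        rw [show q a = 0 from Ideal.Quotient.eq_zero_iff_mem.2 ha]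
        exact zero_mem _)) (by
          intro a ha
          obtain ⟨a, rfl⟩ := hq a
          refine Ideal.Quotient.eq_zero_iff_mem.2 ?_
          exact ha)
    refine RingHom.isSemisimpleRing_of_surjective f ?_
    intro x
    obtain ⟨x, rfl⟩ := Ideal.Quotient.mk_surjective x
    exact ⟨Ideal.Quotient.mk _ (q x), rfl⟩
  · rw [Ideal.mem_comap, Ideal.Quotient.eq_zero_iff_mem.2 (Ideal.mem_span_singleton_self π)]
    exact zero_mem _
  · intro x hx
    rw [← Ideal.Quotient.eq_zero_iff_mem]
    have h1 : ∀ m : ℕ, ∀ x ∈ ((Ring.jacobson B).comap q) ^ m, q x ∈ (Ring.jacobson B) ^ m := by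
      intro m
      induction m with
      | zero => intro x _; simp [Submodule.pow_zero, Ideal.one_eq_top]
      | succ m ih =>
        intro x hx
        rw [Ideal.IsTwoSided.pow_succ] at hx ⊢
        refine Ideal.mul_induction_left (p := fun x => q x ∈ _) hx ?_ ?_
        · intro a ha b hb
          rw [map_mul]
          exact Ideal.mul_mem_mul ha (ih b hb)
        · intro a b ha hb
          rw [map_add]
          exact add_mem ha hb
    have h2 := h1 n x hx
    rw [hn] at h2
    exact h2

end Radical

/-! ### Orders over a noetherian normal domain at primes of height one -/

section Localization

variable {C : Type*} [CommRing C]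

theorem Submodule.exists_forall_smul_mem {M : Type*} [AddCommGroup M] [Module C M]
    (S : Submonoid C) {N N' : Submodule C M} (hN : N.FG) (h : ∀ y ∈ N, ∃ s ∈ S, s • y ∈ N') :
    ∃ s ∈ S, ∀ y ∈ N, s • y ∈ N' := by
  classical
  obtain ⟨t, rfl⟩ := hN
  have h' : ∃ s ∈ S, ∀ y ∈ t, s • y ∈ N' := by
    have h0 : ∀ y ∈ t, ∃ s ∈ S, s • y ∈ N' := fun y hy => h y (Submodule.subset_span hy)
    clear h
    induction t using Finset.induction_on with
    | empty => exact ⟨1, S.one_mem, by simp⟩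
    | insert a t _ ih =>
      obtain ⟨s, hs, h1⟩ := ih fun y hy => h0 y (Finset.mem_insert_of_mem hy)
      obtain ⟨r, hr, h2⟩ := h0 a (Finset.mem_insert_self _ _)
      refine ⟨s * r, S.mul_mem hs hr, fun y hy => ?_⟩
      rcases Finset.mem_insert.1 hy with rfl | hy
      · rw [mul_smul]; exact N'.smul_mem _ h2
      · rw [mul_comm, mul_smul]; exact N'.smul_mem _ (h1 y hy)
  obtain ⟨s, hs, h1⟩ := h'
  refine ⟨s, hs, fun y hy => ?_⟩
  have : Submodule.span C (t : Set M) ≤ N'.comap (LinearMap.lsmul C M s) :=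
    Submodule.span_le.2 fun y hy => h1 y hy
  exact this hy

/-- A form of maximality for an order `R` over `C`: left and right multiplier rings in
`R ⊗ Frac C` of two-sided ideals `I` of `R` with `I ∩ C ≠ 0` are trivial. -/
def IsMaximalOrderOver (C R : Type*) [CommRing C] [Ring R] [Algebra C R] : Prop :=
  ∀ I : Ideal R, I.IsTwoSided → (∃ c : C, c ≠ 0 ∧ algebraMap C R c ∈ I) → ∀ (x : R) (d : C), d ≠ 0 →
    (∀ y ∈ I, ∃ z ∈ I, x * y = d • z) ∨ (∀ y ∈ I, ∃ z ∈ I, y * x = d • z) → ∃ t, x = d • t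

variable {R : Type*} [Ring R] [Algebra C R] {Λ : Type*} [Ring Λ] [Algebra C Λ]

theorem IsLocalizedModule.algHom_smul_cancel (S : Submonoid C) (ι : R →ₐ[C] Λ)
    [IsLocalizedModule S ι.toLinearMap] {s : C} (hs : s ∈ S) {x y : Λ} (h : s • x = s • y) :
    x = y :=
  ((Module.End.isUnit_iff _).1 (IsLocalizedModule.map_units ι.toLinearMap ⟨s, hs⟩)).1 h

/-- The ideal I is contracted to R. As the contraction is finitely generated over C, one element of
S clears all denominators in the inclusion of the multiplied ideal in π I, so maximality over C
applies to a multiple of the numerator r of x. -/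
theorem IsMaximalOrderOver.isMaximalAt [IsDomain C] [IsNoetherianRing C] [Module.Finite C R]
    (h : IsMaximalOrderOver C R) (S : Submonoid C) (ι : R →ₐ[C] Λ)
    [IsLocalizedModule S ι.toLinearMap] (hι : Function.Injective ι) {c : C} (hc : c ≠ 0) :
    IsMaximalAt (algebraMap C Λ c) := by
  intro I hI hn x hx
  obtain ⟨n, hn⟩ := hn
  obtain ⟨⟨r, s⟩, hrs⟩ := IsLocalizedModule.surj S ι.toLinearMap x
  change (s : C) • x = ι r at hrs
  set I₀ : Ideal R := I.comap ι.toRingHom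
  have hI₀ : ∀ y, y ∈ I₀ ↔ ι y ∈ I := fun y => Iff.rfl
  have hI₀t : I₀.IsTwoSided := ⟨fun b hy => by
    rw [hI₀] at *; rw [map_mul]; exact I.mul_mem_right _ hy⟩
  have hsmulI : ∀ (a : C) (z : Λ), z ∈ I → a • z ∈ I := fun a z hz => by
    rw [Algebra.smul_def]; exact I.mul_mem_left _ hz
  have hsmulI₀ : ∀ (a : C) (z : R), z ∈ I₀ → a • z ∈ I₀ := fun a z hz => by
    rw [Algebra.smul_def]; exact I₀.mul_mem_left _ hz
  have hdesc : ∀ z ∈ I, ∃ t ∈ S, ∃ w ∈ I₀, t • z = ι w := by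
    intro z hz
    obtain ⟨⟨w, t⟩, hwt⟩ := IsLocalizedModule.surj S ι.toLinearMap z
    refine ⟨t, t.2, w, ?_, hwt⟩
    rw [hI₀]
    change _ = ι w at hwt
    rw [← hwt]
    exact hsmulI _ _ hz
  let cI : Submodule C R :=
    { carrier := {y | ∃ z ∈ I₀, y = c • z}
      zero_mem' := ⟨0, I₀.zero_mem, by simp⟩
      add_mem' := by
        rintro _ _ ⟨z, hz, rfl⟩ ⟨z', hz', rfl⟩
        exact ⟨z + z', I₀.add_mem hz hz', by rw [smul_add]⟩
      smul_mem' := by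
        rintro a _ ⟨z, hz, rfl⟩
        exact ⟨a • z, hsmulI₀ a z hz, smul_comm _ _ _⟩ }
  have hnoeth : IsNoetherian C R := inferInstance
  have hfg : (Submodule.restrictScalars C I₀).FG := hnoeth.noetherian _
  have key : ∀ f : R →ₗ[C] R, (∀ y ∈ I₀, ∃ z ∈ I, ι (f y) = (s : C) • c • z) →
      ∃ T ∈ S, ∀ y ∈ I₀, T • f y ∈ cI := by
    intro f hf
    obtain ⟨T, hT, hTy⟩ := Submodule.exists_forall_smul_mem S (N' := cI.comap f) hfg (by
      intro y hy
      obtain ⟨z, hz, hyz⟩ := hf y hy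
      obtain ⟨t, ht, w, hw, htw⟩ := hdesc z hz
      refine ⟨t, ht, (s : C) • w, hsmulI₀ _ _ hw, hι ?_⟩
      rw [map_smul, map_smul, map_smul, map_smul, ← htw, hyz, smul_comm t (s : C),
        smul_comm c (s : C), smul_comm t c])
    exact ⟨T, hT, fun y hy => by rw [← map_smul]; exact hTy y hy⟩
  have hfin : ∃ T ∈ S, ∃ t, T • r = c • t := by
    have hcI : ∃ c' : C, c' ≠ 0 ∧ algebraMap C R c' ∈ I₀ :=
      ⟨c ^ n, pow_ne_zero _ hc, by rw [hI₀, AlgHom.commutes, map_pow]; exact hn⟩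
    rcases hx with hx | hx
    · obtain ⟨T, hT, hTy⟩ := key (LinearMap.mulLeft C r) (fun y hy => by
        obtain ⟨z, hz, h1⟩ := hx (ι y) hy
        refine ⟨z, hz, ?_⟩
        rw [LinearMap.mulLeft_apply, map_mul, ← hrs, smul_mul_assoc, h1, ← Algebra.smul_def])
      refine ⟨T, hT, h I₀ hI₀t hcI _ c hc (Or.inl fun y hy => ?_)⟩
      rw [smul_mul_assoc]
      exact hTy y hy
    · obtain ⟨T, hT, hTy⟩ := key (LinearMap.mulRight C r) (fun y hy => by
        obtain ⟨z, hz, h1⟩ := hx (ι y) hy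
        refine ⟨z, hz, ?_⟩
        rw [LinearMap.mulRight_apply, map_mul, ← hrs, mul_smul_comm, h1, ← Algebra.smul_def])
      refine ⟨T, hT, h I₀ hI₀t hcI _ c hc (Or.inr fun y hy => ?_)⟩
      rw [mul_smul_comm]
      exact hTy y hy
  obtain ⟨T, hT, t, ht⟩ := hfin
  have hunit := (Module.End.isUnit_iff _).1 (IsLocalizedModule.map_units ι.toLinearMap
    ⟨T * s, S.mul_mem hT s.2⟩)
  obtain ⟨u, hu⟩ := hunit.2 (ι t)
  change (T * s) • u = ι t at hu
  refine ⟨u, IsLocalizedModule.algHom_smul_cancel S ι (S.mul_mem hT s.2) ?_⟩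
  rw [mul_smul, hrs, ← map_smul, ht, map_smul, ← hu, ← Algebra.smul_def, smul_comm]

/-- The localization is a noetherian integrally closed local domain, and the height condition leaves
the maximal ideal as its only nonzero prime. -/
theorem IsLocalization.AtPrime.isDiscreteValuationRing_of_forall [IsDomain C] [IsNoetherianRing C]
    [IsIntegrallyClosed C] (p : Ideal C) [p.IsPrime] (hp : p ≠ ⊥)
    (hp1 : ∀ q : Ideal C, q.IsPrime → q < p → q = ⊥) :
    IsDiscreteValuationRing (Localization.AtPrime p) := by
  have : IsNoetherianRing (Localization.AtPrime p) :=
    IsLocalization.isNoetherianRing p.primeCompl _ inferInstance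
  have : IsDomain (Localization.AtPrime p) :=
    IsLocalization.isDomain_localization p.primeCompl_le_nonZeroDivisors
  have hic : IsIntegrallyClosed (Localization.AtPrime p) :=
    isIntegrallyClosed_of_isLocalization _ p.primeCompl p.primeCompl_le_nonZeroDivisors
  have hcm : (IsLocalRing.maximalIdeal (Localization.AtPrime p)).comap (algebraMap C _) = p :=
    Localization.AtPrime.under_maximalIdeal
  have hcomap : ∀ q : Ideal (Localization.AtPrime p), q.IsPrime →
      (q.comap (algebraMap C _)).IsPrime ∧ q.comap (algebraMap C _) ≤ p := by
    intro q hq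
    refine ⟨inferInstance, ?_⟩
    have := IsLocalRing.le_maximalIdeal hq.ne_top
    exact (Ideal.comap_mono this).trans hcm.le
  have hpid : IsPrincipalIdealRing (Localization.AtPrime p) := by
    refine ((tfae_of_isNoetherianRing_of_isLocalRing_of_isDomain (Localization.AtPrime p)).out
      3 0 rfl rfl).1 ⟨hic, fun P hP hP' => ?_⟩
    obtain ⟨h1, h2⟩ := hcomap P hP'
    have hmap : (P.comap (algebraMap C (Localization.AtPrime p))).map (algebraMap C _) = P :=
      IsLocalization.map_under p.primeCompl _ P
    have h3 : P.comap (algebraMap C (Localization.AtPrime p)) ≠ ⊥ := by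
      intro h0
      refine hP ?_
      rw [h0, Ideal.map_bot] at hmap
      exact hmap.symm
    have h4 : P.comap (algebraMap C (Localization.AtPrime p)) = p :=
      h2.eq_of_not_lt fun hlt => h3 (hp1 _ h1 hlt)
    rw [h4, Localization.AtPrime.map_eq_maximalIdeal] at hmap
    exact hmap.symm
  have hnf : IsLocalRing.maximalIdeal (Localization.AtPrime p) ≠ ⊥ := by
    intro h0
    refine hp ?_
    rw [← hcm, h0]
    exact Ideal.comap_bot_of_injective _
      (IsLocalization.injective _ p.primeCompl_le_nonZeroDivisors)
  exact { not_a_field' := hnf }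

end Localization

/-! ### Dual bases of lattices at primes of height at most one -/

section DualBasis

theorem Module.Projective.exists_dualBasis (A M : Type*) [Ring A] [AddCommGroup M] [Module A M]
    [Module.Finite A M] [Module.Projective A M] :
    ∃ (l : ℕ) (φ : Fin l → M →ₗ[A] A) (n : Fin l → M), ∀ v, ∑ i, φ i v • n i = v := by
  obtain ⟨l, f, hf⟩ := Module.Finite.exists_fin' A M
  obtain ⟨g, hg⟩ := Module.projective_lifting_property f LinearMap.id hf
  refine ⟨l, fun i => LinearMap.proj i ∘ₗ g, fun i => f (Pi.single i 1), fun v => ?_⟩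
  have h1 := LinearMap.congr_fun hg v
  simp only [LinearMap.comp_apply, LinearMap.id_apply] at h1
  have h2 : g v = ∑ i, g v i • (Pi.single i 1 : Fin l → A) := by
    ext j
    simp [Finset.sum_apply, Pi.single_apply]
  conv_rhs => rw [← h1, h2, map_sum]
  exact Finset.sum_congr rfl fun i _ => (map_smul _ _ _).symm

variable {C : Type*} [CommRing C] [IsDomain C] [IsNoetherianRing C]

/-- The quotient is a finite-dimensional vector space over the residue field. -/
theorem isArtinianRing_quotient_span_uniformizer (O : Type*) [CommRing O] [IsDomain O]
    [IsDiscreteValuationRing O] {Λ : Type*} [Ring Λ] [Algebra O Λ] [Module.Finite O Λ]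
    {ϖ : O} (hϖ : Irreducible ϖ) [(Ideal.span {algebraMap O Λ ϖ}).IsTwoSided] :
    IsArtinianRing (Λ ⧸ Ideal.span {algebraMap O Λ ϖ}) := by
  let M := Λ ⧸ Ideal.span {algebraMap O Λ ϖ}
  have htors : Module.IsTorsionBySet O M (IsLocalRing.maximalIdeal O) := by
    rintro x ⟨a, ha⟩
    obtain ⟨x, rfl⟩ := Ideal.Quotient.mk_surjective x
    rw [hϖ.maximalIdeal_eq, SetLike.mem_coe, Ideal.mem_span_singleton] at ha
    obtain ⟨b, rfl⟩ := ha
    change Ideal.Quotient.mk _ ((ϖ * b) • x) = 0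
    rw [Ideal.Quotient.eq_zero_iff_mem, mul_comm, mul_smul, Algebra.smul_def ϖ, Algebra.commutes,
      ← smul_mul_assoc]
    exact Ideal.mul_mem_left _ _ (Ideal.mem_span_singleton_self _)
  have hfin : Module.Finite O M := inferInstance
  let _ := htors.module
  have : IsScalarTower O (O ⧸ IsLocalRing.maximalIdeal O) M := htors.isScalarTower
  have : Module.Finite (O ⧸ IsLocalRing.maximalIdeal O) M :=
    Module.Finite.of_restrictScalars_finite O _ _
  let _ : Field (O ⧸ IsLocalRing.maximalIdeal O) := Ideal.Quotient.field _
  have h1 : IsArtinian (O ⧸ IsLocalRing.maximalIdeal O) M := inferInstance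
  have h2 : IsArtinian O M := isArtinian_of_surjective_algebraMap
    (R := O ⧸ IsLocalRing.maximalIdeal O) Ideal.Quotient.mk_surjective
  exact isArtinian_of_tower O h2

variable {R : Type*} [Ring R] [Algebra C R]

/-- Full lattices in free modules over a maximal order are projective at primes of height at most
one. -/
theorem IsMaximalOrderOver.exists_dualBasis [IsIntegrallyClosed C] [Module.Finite C R]
    (hmax : IsMaximalOrderOver C R) (htf : ∀ (c : C) (r : R), c • r = 0 → c = 0 ∨ r = 0)
    (p : Ideal C) [p.IsPrime] (hp1 : ∀ q : Ideal C, q.IsPrime → q < p → q = ⊥)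
    {m : ℕ} (N : Submodule R (Fin m → R)) {d : C} (hd0 : d ≠ 0) (hd : ∀ v, d • v ∈ N) :
    ∃ s ∉ p, ∃ (l : ℕ) (φ : Fin l → N →ₗ[R] R) (n : Fin l → N),
      ∀ v : N, ∑ i, φ i v • (n i : Fin m → R) = s • (v : Fin m → R) := by
  -- At the zero prime d itself serves as s: the coordinate functions and the vectors d e_i form a
  -- dual basis up to the factor d.
  by_cases hp : p = ⊥
  · refine ⟨d, by rw [hp]; exact hd0, m, fun i => LinearMap.proj i ∘ₗ N.subtype,
      fun i => ⟨d • Pi.single i 1, hd _⟩, fun v => ?_⟩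
    ext j
    simp [Pi.single_apply, Finset.sum_apply]
  let O := Localization.AtPrime p
  have : IsDomain O := IsLocalization.isDomain_localization p.primeCompl_le_nonZeroDivisors
  have hdvr : IsDiscreteValuationRing O :=
    IsLocalization.AtPrime.isDiscreteValuationRing_of_forall p hp hp1
  let S := p.primeCompl
  let Λ := O ⊗[C] R
  let ι : R →ₐ[C] Λ := Algebra.TensorProduct.includeRight
  have hloc : IsLocalizedModule S ι.toLinearMap :=
    IsLocalization.tensorProduct_isLocalizedModule S O
  have hS0 : ∀ s ∈ S, s ≠ 0 := fun s hs h0 => hs (by rw [h0]; exact p.zero_mem)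
  have hι : Function.Injective ι := by
    intro x y hxy
    obtain ⟨c, hc⟩ := IsLocalizedModule.exists_of_eq (S := S) (f := ι.toLinearMap) hxy
    have h1 : (c : C) • (x - y) = 0 := by
      rw [smul_sub, sub_eq_zero]; exact hc
    exact sub_eq_zero.1 ((htf _ _ h1).resolve_left (hS0 _ c.2))
  -- The uniformizer is chosen in C, so that maximality over C can be applied to it.
  obtain ⟨ϖ, hϖ⟩ : ∃ c : C, Irreducible (algebraMap C O c) := by
    obtain ⟨ϖ, hϖ⟩ := IsDiscreteValuationRing.exists_irreducible O
    obtain ⟨⟨c, s⟩, hcs⟩ := IsLocalization.surj S ϖ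
    refine ⟨c, ?_⟩
    rw [← hcs]
    exact (irreducible_mul_isUnit (IsLocalization.map_units O s)).2 hϖ
  have hϖ0 : ϖ ≠ 0 := by
    rintro rfl
    rw [map_zero] at hϖ
    exact hϖ.ne_zero rfl
  set π : Λ := algebraMap O Λ (algebraMap C O ϖ) with hπ
  have hπ' : π = algebraMap C Λ ϖ := (IsScalarTower.algebraMap_apply C O Λ ϖ).symm
  have hmaxΛ : IsMaximalAt π := by
    rw [hπ']; exact hmax.isMaximalAt S ι hι hϖ0
  have hc : ∀ x, π * x = x * π := fun x => Algebra.commutes _ x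
  have hsmul : ∀ (a : C) (x y : Λ), a ≠ 0 → a • x = a • y → x = y := by
    intro a x y ha hxy
    obtain ⟨⟨r, s⟩, hrs⟩ := IsLocalizedModule.surj S ι.toLinearMap (x - y)
    change (s : C) • (x - y) = ι r at hrs
    have h1 : ι (a • r) = ι 0 := by
      rw [map_smul, ← hrs, smul_comm, smul_sub, hxy, sub_self, smul_zero, map_zero]
    have h2 := (htf _ _ (hι h1)).resolve_left ha
    rw [h2, map_zero] at hrs
    refine sub_eq_zero.1 (IsLocalizedModule.algHom_smul_cancel S ι s.2 (y := 0) ?_)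
    rw [hrs, smul_zero]
  have hr : ∀ x y, π * x = π * y → x = y := by
    intro x y hxy
    rw [hπ', ← Algebra.smul_def, ← Algebra.smul_def] at hxy
    exact hsmul ϖ x y hϖ0 hxy
  have hts : (Ideal.span {π}).IsTwoSided := ⟨fun {a} b ha => by
    obtain ⟨t, rfl⟩ := Submodule.mem_span_singleton.1 ha
    rw [smul_eq_mul, mul_assoc, hc, ← mul_assoc]
    exact Ideal.mul_mem_left _ _ (Ideal.mem_span_singleton_self π)⟩
  have hart : IsArtinianRing (Λ ⧸ Ideal.span {π}) :=
    isArtinianRing_quotient_span_uniformizer O hϖ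
  obtain ⟨J, hJ, e, hss, hπJ, hJe⟩ := exists_isSemisimpleRing_quotient π
  have hdvd : ∀ x ∈ J ^ e, π ∣ x := by
    intro x hx
    obtain ⟨t, ht⟩ := Submodule.mem_span_singleton.1 (hJe hx)
    exact ⟨t, by rw [hc, ← ht, smul_eq_mul]⟩
  let κ : (Fin m → R) →ₗ[C] (Fin m → Λ) := ι.toLinearMap.compLeft (Fin m)
  have hκ : ∀ (r : R) (v : Fin m → R), κ (r • v) = ι r • κ v := by
    intro r v; ext i; exact map_mul ι r (v i)
  have hκinj : Function.Injective κ := fun v w h => by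
    ext i; exact hι (congrFun h i)
  let NΛ : Submodule Λ (Fin m → Λ) := Submodule.span Λ (κ '' N)
  have hκN : ∀ v : N, κ v ∈ NΛ := fun v => Submodule.subset_span ⟨v, v.2, rfl⟩
  -- As d is a unit times ϖ^j, the lattice spanned by N contains π^j Λ^m.
  obtain ⟨j, u, hu⟩ := IsDiscreteValuationRing.eq_unit_mul_pow_irreducible
    (x := algebraMap C O d) (by
      rw [Ne, map_eq_zero_iff _ (IsLocalization.injective O p.primeCompl_le_nonZeroDivisors)]
      exact hd0) hϖ
  have hpow : ∀ v : Fin m → Λ, π ^ j • v ∈ NΛ := by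
    intro v
    have h1 : ∀ i, π ^ j • (Pi.single i 1 : Fin m → Λ) ∈ NΛ := by
      intro i
      have h2 : κ (d • Pi.single i 1) ∈ NΛ := hκN ⟨_, hd _⟩
      have h3 : κ (d • Pi.single i 1) = algebraMap O Λ u • π ^ j • (Pi.single i 1 : Fin m → Λ) := by
        ext t
        rw [map_smul]
        change d • κ (Pi.single i 1) t =
          algebraMap O Λ u * (π ^ j * (Pi.single i 1 : Fin m → Λ) t)
        refine (Algebra.smul_def (A := Λ) d (κ (Pi.single i 1) t)).trans ?_
        rw [IsScalarTower.algebraMap_apply C O Λ, hu, map_mul, map_pow, ← hπ, mul_assoc]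
        congr 2
        change ι ((Pi.single i 1 : Fin m → R) t) = _
        rw [Pi.single_apply, Pi.single_apply, apply_ite ι, map_one, map_zero]
      rw [h3] at h2
      have h4 := NΛ.smul_mem (algebraMap O Λ (↑u⁻¹ : O)) h2
      rwa [smul_smul, ← map_mul, Units.inv_mul, map_one, one_smul] at h4
    have h2 : π ^ j • v = ∑ i, v i • π ^ j • (Pi.single i 1 : Fin m → Λ) := by
      ext t
      have hcj : ∀ x : Λ, π ^ j * x = x * π ^ j := fun x =>
        (Commute.pow_left (show Commute π x from hc x) j)
      simp [Finset.sum_apply, Pi.single_apply, hcj]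
    rw [h2]
    exact NΛ.sum_mem fun i _ => NΛ.smul_mem _ (h1 i)
  have hproj : Module.Projective Λ NΛ :=
    hmaxΛ.projective J hc hr hπJ hdvd NΛ hpow
  have hnC : IsNoetherian C (Fin m → R) := inferInstance
  have hnO : IsNoetherian O Λ := inferInstance
  have hnΛ : IsNoetherianRing Λ := isNoetherian_of_tower O hnO
  have hfinΛ : Module.Finite Λ NΛ := inferInstance
  obtain ⟨l, φ, n, hφ⟩ := Module.Projective.exists_dualBasis Λ NΛ
  -- clear denominators
  have hnum : ∀ i, ∃ s ∈ S, ∀ v : N, ∃ r, ι r = s • φ i ⟨κ v, hκN v⟩ := by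
    intro i
    let ψ : N.restrictScalars C →ₗ[C] Λ :=
      { toFun := fun v => φ i ⟨κ v, hκN v⟩
        map_add' := fun v w => by
          rw [← map_add]; congr 1; ext1; simp
        map_smul' := fun a v => by
          have : (⟨κ (a • v : N.restrictScalars C), hκN (a • v : N.restrictScalars C)⟩ : NΛ) =
              algebraMap C Λ a • ⟨κ v, hκN v⟩ := by
            ext1
            simp [algebraMap_smul]
          rw [this, map_smul, algebraMap_smul, RingHom.id_apply] }
    have hNf : (⊤ : Submodule C (N.restrictScalars C)).FG := Module.Finite.fg_top
    obtain ⟨s, hs, h⟩ := Submodule.exists_forall_smul_mem S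
      (N' := (LinearMap.range ι.toLinearMap).comap ψ) hNf (by
        intro v _
        obtain ⟨⟨r, s⟩, hrs⟩ := IsLocalizedModule.surj S ι.toLinearMap (ψ v)
        exact ⟨s, s.2, by rw [Submodule.mem_comap, map_smul]; exact ⟨r, hrs.symm⟩⟩)
    refine ⟨s, hs, fun v => ?_⟩
    obtain ⟨r, hr⟩ := h v trivial
    exact ⟨r, hr.trans (ψ.map_smul s v)⟩
  choose s hs r hsr using hnum
  have hden : ∀ i, ∃ t ∈ S, ∃ w ∈ N, t • (n i : Fin m → Λ) = κ w := by
    intro i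
    have : ∀ x ∈ NΛ, ∃ t ∈ S, ∃ w ∈ N, t • x = κ w := by
      intro x hx
      refine Submodule.span_induction (p := fun x _ => ∃ t ∈ S, ∃ w ∈ N, t • x = κ w)
        ?_ ?_ ?_ ?_ hx
      · rintro _ ⟨w, hw, rfl⟩
        exact ⟨1, S.one_mem, w, hw, one_smul _ _⟩
      · exact ⟨1, S.one_mem, 0, N.zero_mem, by simp⟩
      · rintro x y _ _ ⟨t, ht, w, hw, e₁⟩ ⟨t', ht', w', hw', e₂⟩
        refine ⟨t * t', S.mul_mem ht ht', t' • w + t • w', N.add_mem ?_ ?_, ?_⟩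
        · exact (N.restrictScalars C).smul_mem _ hw
        · exact (N.restrictScalars C).smul_mem _ hw'
        · rw [smul_add, map_add, map_smul, map_smul, ← e₁, ← e₂, mul_smul, mul_smul, smul_comm t t']
      · rintro a x _ ⟨t, ht, w, hw, e₁⟩
        obtain ⟨⟨b, t'⟩, hb⟩ := IsLocalizedModule.surj S ι.toLinearMap a
        refine ⟨t' * t, S.mul_mem t'.2 ht, b • w, N.smul_mem _ hw, ?_⟩
        rw [hκ, ← e₁]
        change (t' : C) • a = ι b at hb
        rw [← hb, mul_smul, smul_comm t a, smul_assoc]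
    exact this _ (n i).2
  choose t ht w hw htw using hden
  -- T is a common denominator for the functionals and the vectors, and a_i = T / (s_i t_i) scales
  -- the i-th term up to it.
  let T : C := (∏ i, s i) * ∏ i, t i
  have hT : T ∈ S := S.mul_mem (S.prod_mem fun i _ => hs i) (S.prod_mem fun i _ => ht i)
  let a : Fin l → C := fun i => (∏ i' ∈ Finset.univ.erase i, s i') * ∏ i' ∈ Finset.univ.erase i, t i'
  have ha : ∀ i, T = a i * (s i * t i) := by
    intro i
    simp only [T, a]
    rw [← Finset.mul_prod_erase Finset.univ s (Finset.mem_univ i),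
      ← Finset.mul_prod_erase Finset.univ t (Finset.mem_univ i)]
    ring
  refine ⟨T, hT, l, fun i =>
    { toFun := fun v => r i v
      map_add' := fun v v' => hι ?_
      map_smul' := fun b v => hι ?_ }, fun i => a i • ⟨w i, hw i⟩, fun v => hκinj ?_⟩
  · rw [map_add, hsr, hsr, hsr, ← smul_add, ← map_add]
    congr 2
    ext1
    simp
  · rw [RingHom.id_apply, smul_eq_mul, map_mul, hsr, hsr, mul_smul_comm, ← smul_eq_mul (ι b),
      ← map_smul (φ i)]
    congr 2
    ext1
    simp [hκ]
  · have hterm : ∀ i, κ (r i v • a i • w i) =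
        T • (φ i ⟨κ v, hκN v⟩ • (n i : Fin m → Λ)) := by
      intro i
      rw [hκ, map_smul, ← htw, hsr, ha i]
      ext q
      simp only [Pi.smul_apply, smul_eq_mul, smul_mul_assoc, mul_smul_comm, mul_smul]
      rw [smul_comm (s i)]
    have h1 : ∑ i, φ i ⟨κ v, hκN v⟩ • (n i : Fin m → Λ) = κ v := by
      have := congrArg Subtype.val (hφ ⟨κ v, hκN v⟩)
      rwa [Submodule.coe_sum] at this
    have h2 : κ (∑ i, r i v • a i • w i) = κ (T • (v : Fin m → R)) := by
      rw [map_smul, map_sum, ← h1, Finset.smul_sum]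
      exact Finset.sum_congr rfl fun i _ => hterm i
    exact h2

end DualBasis

/-! ### Projectivity over a subring with a bimodule retraction -/

section Expectation

/-- If `B → Q` admits a `B`-bilinear retraction and `Q` is semisimple, then `B` is semisimple. -/
theorem isSemisimpleRing_of_bilinear_retraction {B Q : Type*} [Ring B] [Ring Q]
    [IsSemisimpleRing Q] (j : B →+* Q) (E : Q →+ B) (hE1 : E 1 = 1)
    (hEl : ∀ b q, E (j b * q) = b * E q) (hEr : ∀ b q, E (q * j b) = E q * b) :
    IsSemisimpleRing B := by
  -- The left ideal Q X is Q f with f idempotent. Then E f ∈ X, and applying E to x f = x gives x (E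
  -- f) = x. Right multiplication by this ε splits off X.
  have key : ∀ X : Ideal B, ∃ ε ∈ X, ∀ x ∈ X, x * ε = x := by
    intro X
    obtain ⟨f, hf, hspan⟩ := IsSemisimpleRing.ideal_eq_span_idempotent (Ideal.span (j '' X))
    refine ⟨E f, ?_, fun x hx => ?_⟩
    · have hfm : f ∈ Ideal.span (j '' X) := by
        rw [hspan]; exact Ideal.mem_span_singleton_self f
      have : ∀ q ∈ Ideal.span (j '' X), ∀ q', E (q' * q) ∈ X := by
        intro q hq
        refine Submodule.span_induction (p := fun q _ => ∀ q', E (q' * q) ∈ X) ?_ ?_ ?_ ?_ hq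
        · rintro _ ⟨x, hx, rfl⟩ q'
          rw [hEr]
          exact X.mul_mem_left _ hx
        · intro q'; simp
        · intro x y _ _ hx hy q'
          rw [mul_add, map_add]
          exact X.add_mem (hx q') (hy q')
        · intro a x _ hx q'
          rw [smul_eq_mul, ← mul_assoc]
          exact hx _
      simpa using this f hfm 1
    · have h1 : j x ∈ Ideal.span {f} := by
        rw [← hspan]; exact Ideal.subset_span ⟨x, hx, rfl⟩
      obtain ⟨a, ha⟩ := Submodule.mem_span_singleton.1 h1
      have h2 : j x * f = j x * 1 := by
        rw [← ha, smul_eq_mul, mul_assoc, hf.eq, mul_one]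
      rw [← hEl, h2, hEl, hE1, mul_one]
  refine (isSemisimpleModule_iff B B).2 ⟨fun X => ?_⟩
  obtain ⟨ε, hε, hX⟩ := key X
  refine ⟨LinearMap.ker (LinearMap.toSpanSingleton B B ε), ?_, ?_⟩
  · rw [disjoint_iff, eq_bot_iff]
    rintro x ⟨hx, hx'⟩
    have h : x * ε = 0 := by simpa using hx'
    rw [hX x hx] at h
    simpa using h
  · rw [codisjoint_iff, eq_top_iff]
    intro b _
    refine Submodule.mem_sup.2 ⟨b * ε, X.smul_mem b hε, b - b * ε, ?_, by abel⟩
    have : b * ε * ε = b * ε := by rw [mul_assoc, hX ε hε]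
    simp [sub_mul, this]

theorem IsSemisimpleRing.exists_dualBasis_of_algHom {K B Q : Type*} [Field K] [Ring B] [Ring Q]
    [Algebra K B] [Algebra K Q] [Module.Finite K Q] [IsSemisimpleRing B] (j : B →ₐ[K] Q) :
    ∃ (l : ℕ) (f : Fin l → Q →ₗ[K] B) (x : Fin l → Q), (∀ i b q, f i (j b * q) = b * f i q) ∧
      ∀ q, ∑ i, j (f i q) * x i = q := by
  let _ : Module B Q := Module.compHom Q j.toRingHom
  have hsm : ∀ (b : B) (q : Q), b • q = j b * q := fun _ _ => rfl
  have : IsScalarTower K B Q := ⟨fun a b q => by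
    rw [hsm, hsm, map_smul, smul_mul_assoc]⟩
  have : Module.Finite B Q := Module.Finite.of_restrictScalars_finite K B Q
  have : Module.Projective B Q := Module.projective_of_isSemisimpleRing B Q
  obtain ⟨l, φ, x, h⟩ := Module.Projective.exists_dualBasis B Q
  exact ⟨l, fun i => (φ i).restrictScalars K, x, fun i b q => (φ i).map_smul b q, h⟩

theorem IsPrimeRing.eq_zero_of_pow_eq_bot {R : Type*} [Ring R] (hR : IsPrimeRing R) (I : Ideal R)
    [I.IsTwoSided] : ∀ n : ℕ, (∀ x ∈ I ^ n, x = 0) → ∀ x ∈ I, x = 0 := by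
  intro n
  induction n with
  | zero =>
    intro h x _
    exact h x (by rw [Submodule.pow_zero, Ideal.one_eq_top]; trivial)
  | succ n ih =>
    intro h a ha
    by_contra hne
    refine hne (ih (fun b hb => ?_) a ha)
    refine (hR.2 a b fun r => ?_).resolve_left hne
    refine h _ ?_
    rw [Ideal.IsTwoSided.pow_succ]
    exact Ideal.mul_mem_mul (I.mul_mem_right _ ha) hb

variable {C : Type*} [CommRing C] {R : Type*} [Ring R] [Algebra C R]

theorem IsLocalization.includeRight_injective [IsDomain C] (S : Submonoid C) (hS : S ≤ nonZeroDivisors C)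
    (O : Type*) [CommRing O] [Algebra C O] [IsLocalization S O]
    (htf : ∀ (c : C) (r : R), c • r = 0 → c = 0 ∨ r = 0) :
    Function.Injective (Algebra.TensorProduct.includeRight : R →ₐ[C] O ⊗[C] R) := by
  intro x y hxy
  have hloc : IsLocalizedModule S
      (Algebra.TensorProduct.includeRight : R →ₐ[C] O ⊗[C] R).toLinearMap :=
    IsLocalization.tensorProduct_isLocalizedModule S O
  obtain ⟨c, hc⟩ := IsLocalizedModule.exists_of_eq (S := S)
    (f := (Algebra.TensorProduct.includeRight : R →ₐ[C] O ⊗[C] R).toLinearMap) hxy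
  have h1 : (c : C) • (x - y) = 0 := by
    rw [smul_sub, sub_eq_zero]; exact hc
  exact sub_eq_zero.1 ((htf _ _ h1).resolve_left (nonZeroDivisors.ne_zero (hS c.2)))

/-- The radical of the artinian ring Frac(C) ⊗ R is nilpotent, so its contraction to the prime ring
R is zero. Every element of the radical has a nonzero C-multiple in that contraction. -/
theorem IsPrimeRing.isSemisimpleRing_tensor [IsDomain C] [Module.Finite C R] (hR : IsPrimeRing R)
    (htf : ∀ (c : C) (r : R), c • r = 0 → c = 0 ∨ r = 0) :
    IsSemisimpleRing (FractionRing C ⊗[C] R) := by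
  let Q := FractionRing C ⊗[C] R
  let ι : R →ₐ[C] Q := Algebra.TensorProduct.includeRight
  have hloc : IsLocalizedModule (nonZeroDivisors C) ι.toLinearMap :=
    IsLocalization.tensorProduct_isLocalizedModule _ (FractionRing C)
  have hι : Function.Injective ι :=
    IsLocalization.includeRight_injective _ le_rfl (FractionRing C) htf
  have h1 : IsArtinian (FractionRing C) Q := inferInstance
  have hart : IsArtinianRing Q := isArtinian_of_tower (FractionRing C) h1
  rw [IsArtinianRing.isSemisimpleRing_iff_jacobson]
  obtain ⟨n, hn⟩ := IsSemiprimaryRing.isNilpotent (R := Q)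
  let I : Ideal R := (Ring.jacobson Q).comap ι.toRingHom
  have hI : I.IsTwoSided := ⟨fun {a} b ha => by
    change ι (a * b) ∈ Ring.jacobson Q
    rw [map_mul]; exact Ideal.mul_mem_right _ _ ha⟩
  have hpow : ∀ m : ℕ, ∀ x ∈ I ^ m, ι x ∈ Ring.jacobson Q ^ m := by
    intro m
    induction m with
    | zero => intro x _; simp [Submodule.pow_zero, Ideal.one_eq_top]
    | succ m ih =>
      intro x hx
      rw [Ideal.IsTwoSided.pow_succ] at hx ⊢
      refine Ideal.mul_induction_left (p := fun x => ι x ∈ _) hx ?_ ?_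
      · intro a ha b hb
        rw [map_mul]
        exact Ideal.mul_mem_mul ha (ih b hb)
      · intro a b ha hb
        rw [map_add]
        exact add_mem ha hb
  have hI0 := hR.eq_zero_of_pow_eq_bot I n (fun x hx => hι (by
    have := hpow n x hx
    rw [hn] at this
    rw [map_zero]
    exact this))
  rw [eq_bot_iff]
  intro x hx
  obtain ⟨⟨r, s⟩, hrs⟩ := IsLocalizedModule.surj (nonZeroDivisors C) ι.toLinearMap x
  change (s : C) • x = ι r at hrs
  have h2 : r = 0 := hI0 r (by
    change ι r ∈ Ring.jacobson Q
    rw [← hrs]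
    have h3 : (s : C) • x = algebraMap C Q s * x := Algebra.smul_def (A := Q) (s : C) x
    rw [h3]
    exact Ideal.mul_mem_left _ _ hx)
  rw [h2, map_zero] at hrs
  exact IsLocalizedModule.algHom_smul_cancel (nonZeroDivisors C) ι s.2 (y := 0)
    (by rw [hrs, smul_zero])

variable {A : Type*} [Ring A] [Algebra C A]

/-- `F : R → R` is a finite sum of maps `y ↦ g(y) x` with `g : R → A` left `A`-linear. -/
def IsRankOneSum (j : A →ₐ[C] R) (F : R → R) : Prop :=
  ∃ (ι : Type) (_ : Fintype ι) (g : ι → R →ₗ[C] A) (x : ι → R),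
    (∀ i a y, g i (j a * y) = a * g i y) ∧ ∀ y, F y = ∑ i, j (g i y) * x i

theorem IsRankOneSum.zero (j : A →ₐ[C] R) : IsRankOneSum j 0 :=
  ⟨Empty, inferInstance, fun _ => 0, fun _ => 0, fun i => i.elim, fun y => by simp⟩

theorem IsRankOneSum.add {j : A →ₐ[C] R} {F F' : R → R} (h : IsRankOneSum j F)
    (h' : IsRankOneSum j F') : IsRankOneSum j (F + F') := by
  obtain ⟨ι, _, g, x, hg, hF⟩ := h
  obtain ⟨κ, _, g', x', hg', hF'⟩ := h'
  refine ⟨ι ⊕ κ, inferInstance, Sum.elim g g', Sum.elim x x', ?_, fun y => ?_⟩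
  · rintro (i | i); exacts [hg i, hg' i]
  · simp [hF, hF']

theorem IsRankOneSum.sum {j : A →ₐ[C] R} {ι : Type*} (s : Finset ι) (F : ι → R → R)
    (h : ∀ i ∈ s, IsRankOneSum j (F i)) : IsRankOneSum j (∑ i ∈ s, F i) :=
  Finset.sum_induction F (IsRankOneSum j) (fun _ _ => IsRankOneSum.add) (IsRankOneSum.zero j) h

/-- Generic projectivity of `R` over the image `A` of a bilinear retraction. -/
theorem exists_generic_dualBasis [IsDomain C] [Module.Finite C R] (hR : IsPrimeRing R)
    (htf : ∀ (c : C) (r : R), c • r = 0 → c = 0 ∨ r = 0) (j : A →ₐ[C] R) (E : R →ₗ[C] A)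
    (hE1 : E 1 = 1) (hEl : ∀ a r, E (j a * r) = a * E r) (hEr : ∀ a r, E (r * j a) = E r * a) :
    ∃ c : C, c ≠ 0 ∧ ∃ (l : ℕ) (f : Fin l → R →ₗ[C] A) (x : Fin l → R),
      (∀ i a y, f i (j a * y) = a * f i y) ∧ ∀ y, ∑ i, j (f i y) * x i = c • y := by
  classical
  have hEj : ∀ a, E (j a) = a := fun a => by simpa [hE1] using hEl a 1
  have hfinA : Module.Finite C A := Module.Finite.of_surjective E fun a => ⟨j a, hEj a⟩
  have htfA : ∀ (c : C) (a : A), c • a = 0 → c = 0 ∨ a = 0 := by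
    intro c a h
    have h1 : c • j a = 0 := by rw [← map_smul, h, map_zero]
    exact (htf _ _ h1).imp_right fun h2 => by rw [← hEj a, h2, map_zero]
  let K := FractionRing C
  let Q := K ⊗[C] R
  let B := K ⊗[C] A
  let S := nonZeroDivisors C
  let ιR : R →ₐ[C] Q := Algebra.TensorProduct.includeRight
  let ιA : A →ₐ[C] B := Algebra.TensorProduct.includeRight
  have hlocR : IsLocalizedModule S ιR.toLinearMap :=
    IsLocalization.tensorProduct_isLocalizedModule _ K
  have hlocA : IsLocalizedModule S ιA.toLinearMap :=
    IsLocalization.tensorProduct_isLocalizedModule _ K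
  have hιR : Function.Injective ιR := IsLocalization.includeRight_injective _ le_rfl K htf
  have hιA : Function.Injective ιA := IsLocalization.includeRight_injective _ le_rfl K htfA
  have hQ : IsSemisimpleRing Q := hR.isSemisimpleRing_tensor htf
  let jK : B →ₐ[K] Q := Algebra.TensorProduct.map (AlgHom.id K K) j
  let EK : Q →ₗ[K] B := E.baseChange K
  have hjKι : ∀ a, jK (ιA a) = ιR (j a) := fun a => rfl
  have hmul : ∀ (x y : K) (a b : A), ((x ⊗ₜ[C] a) * (y ⊗ₜ[C] b) : B) = (x * y) ⊗ₜ[C] (a * b) :=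
    fun x y a b => Algebra.TensorProduct.tmul_mul_tmul x y a b
  have hmulR : ∀ (x y : K) (a b : R), ((x ⊗ₜ[C] a) * (y ⊗ₜ[C] b) : Q) = (x * y) ⊗ₜ[C] (a * b) :=
    fun x y a b => Algebra.TensorProduct.tmul_mul_tmul x y a b
  have hBs : IsSemisimpleRing B := by
    refine isSemisimpleRing_of_bilinear_retraction jK.toRingHom EK.toAddMonoidHom ?_ ?_ ?_
    · change EK ((1 : K) ⊗ₜ[C] (1 : R)) = (1 : K) ⊗ₜ[C] (1 : A)
      rw [← hE1]
      rfl
    · intro b q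
      change EK (jK b * q) = b * EK q
      induction b using TensorProduct.induction_on with
      | zero => simp
      | add b b' h h' => rw [map_add, add_mul, map_add, h, h', add_mul]
      | tmul x a =>
        induction q using TensorProduct.induction_on with
        | zero => simp
        | add q q' h h' => rw [mul_add, map_add, h, h', map_add, mul_add]
        | tmul y r =>
          change EK ((x ⊗ₜ[C] j a : Q) * (y ⊗ₜ[C] r : Q)) = (x ⊗ₜ[C] a : B) * (y ⊗ₜ[C] E r : B)
          rw [hmul, hmulR, ← hEl]
          rfl
    · intro b q
      change EK (q * jK b) = EK q * b
      induction b using TensorProduct.induction_on with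
      | zero => simp
      | add b b' h h' => rw [map_add, mul_add, map_add, h, h', mul_add]
      | tmul x a =>
        induction q using TensorProduct.induction_on with
        | zero => simp
        | add q q' h h' => rw [add_mul, map_add, h, h', map_add, add_mul]
        | tmul y r =>
          change EK ((y ⊗ₜ[C] r : Q) * (x ⊗ₜ[C] j a : Q)) = (y ⊗ₜ[C] E r : B) * (x ⊗ₜ[C] a : B)
          rw [hmul, hmulR, ← hEr]
          rfl
  obtain ⟨l, f, x, hf, hx⟩ := IsSemisimpleRing.exists_dualBasis_of_algHom (K := K) jK
  have hnum : ∀ i, ∃ s ∈ S, ∀ r, ∃ a, ιA a = s • f i (ιR r) := by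
    intro i
    obtain ⟨s, hs, h⟩ := Submodule.exists_forall_smul_mem S
      (N' := (LinearMap.range ιA.toLinearMap).comap ((f i).restrictScalars C ∘ₗ ιR.toLinearMap))
      (Module.Finite.fg_top (R := C) (M := R)) (by
        intro r _
        obtain ⟨⟨a, s⟩, has⟩ := IsLocalizedModule.surj S ιA.toLinearMap (f i (ιR r))
        exact ⟨s, s.2, by rw [Submodule.mem_comap, map_smul]; exact ⟨a, has.symm⟩⟩)
    refine ⟨s, hs, fun r => ?_⟩
    obtain ⟨a, ha⟩ := h r trivial
    exact ⟨a, ha.trans (((f i).restrictScalars C ∘ₗ ιR.toLinearMap).map_smul s r)⟩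
  choose s hs g hg using hnum
  have hden : ∀ i, ∃ t ∈ S, ∃ w, t • x i = ιR w := by
    intro i
    obtain ⟨⟨r, s⟩, hrs⟩ := IsLocalizedModule.surj S ιR.toLinearMap (x i)
    exact ⟨s, s.2, r, hrs⟩
  choose t ht w hw using hden
  let T : C := (∏ i, s i) * ∏ i, t i
  have hT : T ∈ S := S.mul_mem (S.prod_mem fun i _ => hs i) (S.prod_mem fun i _ => ht i)
  let a : Fin l → C := fun i => (∏ i' ∈ Finset.univ.erase i, s i') * ∏ i' ∈ Finset.univ.erase i, t i'
  have ha : ∀ i, T = a i * (s i * t i) := by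
    intro i
    simp only [T, a]
    rw [← Finset.mul_prod_erase Finset.univ s (Finset.mem_univ i),
      ← Finset.mul_prod_erase Finset.univ t (Finset.mem_univ i)]
    ring
  refine ⟨T, nonZeroDivisors.ne_zero hT, l, fun i =>
    { toFun := g i
      map_add' := fun y y' => hιA ?_
      map_smul' := fun b y => hιA ?_ }, fun i => a i • w i, fun i b y => hιA ?_, fun y => hιR ?_⟩
  · rw [map_add, hg, hg, hg, map_add, map_add, smul_add]
  · rw [RingHom.id_apply, map_smul, hg, hg, map_smul, smul_comm b, 
      show f i (b • ιR y) = b • f i (ιR y) from ((f i).restrictScalars C).map_smul b _]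
  · change ιA (g i (j b * y)) = ιA (b * g i y)
    rw [map_mul, hg, hg, map_mul, ← hjKι, hf, mul_smul_comm]
  · have h1 : ∀ i, ιR (j (g i y) * a i • w i) = T • (jK (f i (ιR y)) * x i) := by
      intro i
      have e1 : jK (s i • f i (ιR y)) = s i • jK (f i (ιR y)) :=
        (jK.toLinearMap.restrictScalars C).map_smul _ _
      have e2 : ιR (a i • w i) = a i • t i • x i := by rw [map_smul, hw]
      rw [map_mul, ← hjKι, hg, e1, e2, ha i]
      simp only [smul_mul_assoc, mul_smul_comm, mul_smul]
      rw [smul_comm (s i)]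
    have h2 : ιR (∑ i, j (g i y) * a i • w i) = ιR (T • y) := by
      rw [map_sum, Finset.sum_congr rfl fun i _ => h1 i, ← Finset.smul_sum, hx, map_smul]
    exact h2

/-- In the presence of a bilinear retraction `E : R → A`, a maximal order `R` is projective over `A`
at primes of height at most one. -/
theorem IsMaximalOrderOver.isRankOneSum [IsDomain C] [IsNoetherianRing C] [IsIntegrallyClosed C]
    [Module.Finite C R] (hmax : IsMaximalOrderOver C R) (hR : IsPrimeRing R)
    (htf : ∀ (c : C) (r : R), c • r = 0 → c = 0 ∨ r = 0) (j : A →ₐ[C] R) (E : R →ₗ[C] A)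
    (hE1 : E 1 = 1) (hEl : ∀ a r, E (j a * r) = a * E r) (hEr : ∀ a r, E (r * j a) = E r * a)
    (p : Ideal C) [p.IsPrime] (hp1 : ∀ q : Ideal C, q.IsPrime → q < p → q = ⊥) :
    ∃ s ∉ p, IsRankOneSum j fun y => s • y := by
  obtain ⟨c, hc, m, f, x, hf, hx⟩ := exists_generic_dualBasis hR htf j E hE1 hEl hEr
  have hEj : ∀ a, E (j a) = a := fun a => by simpa [hE1] using hEl a 1
  let ι : R →ₗ[C] (Fin m → A) := LinearMap.pi f
  let ρ : (Fin m → A) →ₗ[C] R := ∑ i, (LinearMap.mulRight C (x i)) ∘ₗ j.toLinearMap ∘ₗ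
    LinearMap.proj i
  have hρ : ∀ a, ρ a = ∑ i, j (a i) * x i := fun a => by simp [ρ]
  have hρι : ∀ y, ρ (ι y) = c • y := fun y => by rw [hρ]; exact hx y
  let κ : (Fin m → A) →ₗ[C] (Fin m → R) := j.toLinearMap.compLeft (Fin m)
  let Em : (Fin m → R) →ₗ[C] (Fin m → A) := E.compLeft (Fin m)
  have hEm : ∀ r w, ρ (Em (r • κ w)) = j (E r) * ρ w := by
    intro r w
    rw [hρ, hρ, Finset.mul_sum]
    refine Finset.sum_congr rfl fun i _ => ?_
    change j (E (r * j (w i))) * x i = _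
    rw [hEr, map_mul, mul_assoc]
  have hEκ : ∀ w, Em (κ w) = w := fun w => by ext i; exact hEj _
  -- The maps ι : R → A^m and ρ : A^m → R compose to c on R, so X is where ρ / c takes values in R.
  -- Its R-span N is a full lattice, as it contains c R^m; this brings in projectivity over the
  -- maximal order R.
  let X : Set (Fin m → A) := {w | ∃ y, ρ w = c • y}
  let N : Submodule R (Fin m → R) := Submodule.span R (κ '' X)
  have hιX : ∀ y, κ (ι y) ∈ N := fun y => Submodule.subset_span ⟨_, ⟨y, hρι y⟩, rfl⟩
  have hN : ∀ v, c • v ∈ N := by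
    intro v
    have h1 : ∀ i, κ (c • Pi.single i 1) ∈ N := fun i =>
      Submodule.subset_span ⟨_, ⟨ρ (Pi.single i 1), map_smul _ _ _⟩, rfl⟩
    have h2 : c • v = ∑ i, v i • κ (c • Pi.single i 1) := by
      ext t
      rw [Finset.sum_apply, Finset.sum_eq_single t]
      · change c • v t = v t * j ((c • Pi.single t 1 : Fin m → A) t)
        simp
      · intro b _ hb
        change v b * j ((c • Pi.single b 1 : Fin m → A) t) = 0
        simp [hb.symm]
      · simp
    rw [h2]
    exact N.sum_mem fun i _ => N.smul_mem _ (h1 i)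
  obtain ⟨s, hs, l, φ, n, hφ⟩ := hmax.exists_dualBasis htf p hp1 N hc hN
  -- On a generator n = κ w with ρ w = c y', bilinearity of E gives ρ(E(φ n)) = c E(φ) y', a rank
  -- one map times c. A coefficient b in front of n is absorbed into φ.
  have key : ∀ n ∈ N, ∀ φ : N →ₗ[R] R, ∃ F : R → R, IsRankOneSum j F ∧
      ∀ y, ρ (Em (φ ⟨κ (ι y), hιX y⟩ • n)) = c • F y := by
    intro n hn
    refine Submodule.span_induction (p := fun n _ => ∀ φ : N →ₗ[R] R, ∃ F : R → R,
      IsRankOneSum j F ∧ ∀ y, ρ (Em (φ ⟨κ (ι y), hιX y⟩ • n)) = c • F y) ?_ ?_ ?_ ?_ hn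
    · rintro _ ⟨w, ⟨y', hw⟩, rfl⟩ φ
      refine ⟨fun y => j (E (φ ⟨κ (ι y), hιX y⟩)) * y', ⟨Unit, inferInstance, fun _ =>
        { toFun := fun y => E (φ ⟨κ (ι y), hιX y⟩)
          map_add' := fun y z => ?_
          map_smul' := fun b y => ?_ }, fun _ => y', fun _ a y => ?_, fun y => by simp⟩,
        fun y => ?_⟩
      · rw [← map_add, ← map_add]
        congr 2
        ext1
        simp
      · have e : (⟨κ (ι (b • y)), hιX (b • y)⟩ : N) = algebraMap C R b • ⟨κ (ι y), hιX y⟩ := by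
          ext1
          change κ (ι (b • y)) = algebraMap C R b • κ (ι y)
          rw [map_smul, map_smul, algebraMap_smul]
        rw [RingHom.id_apply, e, map_smul, smul_eq_mul, ← Algebra.smul_def, map_smul]
      · change E (φ _) = a * E (φ _)
        have e : (⟨κ (ι (j a * y)), hιX (j a * y)⟩ : N) = j a • ⟨κ (ι y), hιX y⟩ := by
          ext1
          ext i
          change j (f i (j a * y)) = j a * j (f i y)
          rw [hf, map_mul]
        rw [← hEl, e, map_smul, smul_eq_mul]
      · rw [hEm, hw, mul_smul_comm]
    · intro φ
      exact ⟨0, IsRankOneSum.zero j, fun y => by simp⟩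
    · intro n n' _ _ h h' φ
      obtain ⟨F, hF, e⟩ := h φ
      obtain ⟨F', hF', e'⟩ := h' φ
      exact ⟨F + F', hF.add hF', fun y => by
        rw [smul_add, map_add, map_add, e, e', Pi.add_apply, smul_add]⟩
    · intro b n _ h φ
      obtain ⟨F, hF, e⟩ := h ((LinearMap.toSpanSingleton R R b) ∘ₗ φ)
      refine ⟨F, hF, fun y => ?_⟩
      rw [← e y, ← mul_smul]
      rfl
  choose F hF hFe using fun i => key (n i) (n i).2 (φ i)
  refine ⟨s, hs, ?_⟩
  convert IsRankOneSum.sum Finset.univ F fun i _ => hF i using 1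
  funext y
  have h1 : c • (s • y - (∑ i, F i) y) = 0 := by
    rw [smul_sub, sub_eq_zero, Finset.sum_apply, Finset.smul_sum]
    have h2 : ρ (Em (∑ i, φ i ⟨κ (ι y), hιX y⟩ • (n i : Fin m → R))) = c • s • y := by
      rw [hφ, map_smul, hEκ, map_smul, hρι, smul_comm]
    rw [← h2, map_sum, map_sum]
    exact Finset.sum_congr rfl fun i _ => hFe i y
  exact sub_eq_zero.1 ((htf _ _ h1).resolve_left hc)

end Expectation

/-! ### Maximal orders over central subrings, and normality of the center -/

section MaximalOrder

/-- The left (or right) multiplier ring T of I in Q contains R, and multiplying T by the central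
element c ∈ I lands in R. So T is equivalent to R and equals it by maximality, while x / d lies in
T. -/
theorem IsMaximalOrder.isMaximalOrderOver {R : Type v} [Ring R] (h : IsMaximalOrder R)
    {C : Type*} [CommRing C] [Algebra C R]
    (htf : ∀ (c : C) (r : R), c • r = 0 → c = 0 ∨ r = 0) : IsMaximalOrderOver C R := by
  obtain ⟨Q, _, i, hi, hmax⟩ := h
  have hcomm : ∀ (c : C) (q : Q), i (algebraMap C R c) * q = q * i (algebraMap C R c) := by
    intro c q
    obtain ⟨r, s, t, hst, rfl⟩ := hi.exists_right_fraction q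
    have h1 : ∀ r, i (algebraMap C R c) * i r = i r * i (algebraMap C R c) := fun r => by
      rw [← map_mul, ← map_mul, Algebra.commutes]
    have h2 : i (algebraMap C R c) * (↑t⁻¹ : Q) = ↑t⁻¹ * i (algebraMap C R c) := by
      have h3 : Commute (i (algebraMap C R c)) (t : Q) := by
        rw [← hst]; exact h1 s
      exact h3.units_inv_right
    rw [← mul_assoc, h1, mul_assoc, h2, mul_assoc]
  have hunit : ∀ c : C, c ≠ 0 → IsUnit (i (algebraMap C R c)) := by
    intro c hc
    have h0 : ∀ q, i (algebraMap C R c) * q = 0 → q = 0 := by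
      intro q hq
      obtain ⟨r, s, t, hst, rfl⟩ := hi.exists_right_fraction q
      rw [← mul_assoc, Units.mul_left_eq_zero, ← map_mul, ← Algebra.smul_def] at hq
      have h1 := (htf c r (hi.injective (hq.trans (map_zero i).symm))).resolve_left hc
      rw [h1, map_zero, zero_mul]
    refine hi.isUnit_of_isRegular _ ⟨?_, ?_⟩
    · intro a b hab
      exact sub_eq_zero.1 (h0 _ (by rw [mul_sub, sub_eq_zero]; exact hab))
    · intro a b hab
      exact sub_eq_zero.1 (h0 _ (by rw [mul_sub, sub_eq_zero, hcomm, hcomm]; exact hab))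
  intro I hI ⟨c, hc, hcI⟩ x d hd hx
  obtain ⟨ud, hud⟩ := hunit d hd
  obtain ⟨uc, huc⟩ := hunit c hc
  have hdi : ∀ z, i (d • z) = ud * i z := fun z => by
    rw [Algebra.smul_def, map_mul, hud]
  have hudc : ∀ q : Q, ((ud⁻¹ : Qˣ) : Q) * q = q * ((ud⁻¹ : Qˣ) : Q) := fun q => by
    have : Commute (ud : Q) q := by rw [hud]; exact hcomm d q
    exact this.units_inv_left
  suffices hmem : ((ud⁻¹ : Qˣ) : Q) * i x ∈ i.range by
    obtain ⟨t, ht⟩ := hmem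
    refine ⟨t, hi.injective ?_⟩
    rw [hdi, ht, Units.mul_inv_cancel_left]
  rcases hx with hx | hx
  · let T : Subring Q :=
      { carrier := {q | ∀ y ∈ I, ∃ z ∈ I, q * i y = i z}
        mul_mem' := fun {a b} ha hb y hy => by
          obtain ⟨z, hz, e⟩ := hb y hy
          obtain ⟨w, hw, e'⟩ := ha z hz
          exact ⟨w, hw, by rw [mul_assoc, e, e']⟩
        one_mem' := fun y hy => ⟨y, hy, one_mul _⟩
        add_mem' := fun {a b} ha hb y hy => by
          obtain ⟨z, hz, e⟩ := hb y hy
          obtain ⟨w, hw, e'⟩ := ha y hy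
          exact ⟨w + z, I.add_mem hw hz, by rw [add_mul, e, e', map_add]⟩
        zero_mem' := fun y hy => ⟨0, I.zero_mem, by simp⟩
        neg_mem' := fun {a} ha y hy => by
          obtain ⟨w, hw, e'⟩ := ha y hy
          exact ⟨-w, I.neg_mem hw, by rw [neg_mul, e', map_neg]⟩ }
    have hRT : i.range ≤ T := by
      rintro _ ⟨r, rfl⟩ y hy
      exact ⟨r * y, I.mul_mem_left _ hy, (map_mul i r y).symm⟩
    rw [← hmax T hRT ⟨⟨1, 1, fun x hx => by simpa using hRT hx⟩, 1, uc, fun q hq => ?_⟩]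
    · intro y hy
      obtain ⟨z, hz, e⟩ := hx y hy
      exact ⟨z, hz, by rw [mul_assoc, ← map_mul, e, hdi, Units.inv_mul_cancel_left]⟩
    · obtain ⟨z, -, e⟩ := hq _ hcI
      exact ⟨z, by rw [← e, huc, Units.val_one, one_mul]⟩
  · let T : Subring Q :=
      { carrier := {q | ∀ y ∈ I, ∃ z ∈ I, i y * q = i z}
        mul_mem' := fun {a b} ha hb y hy => by
          obtain ⟨z, hz, e⟩ := ha y hy
          obtain ⟨w, hw, e'⟩ := hb z hz
          exact ⟨w, hw, by rw [← mul_assoc, e, e']⟩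
        one_mem' := fun y hy => ⟨y, hy, mul_one _⟩
        add_mem' := fun {a b} ha hb y hy => by
          obtain ⟨z, hz, e⟩ := hb y hy
          obtain ⟨w, hw, e'⟩ := ha y hy
          exact ⟨w + z, I.add_mem hw hz, by rw [mul_add, e, e', map_add]⟩
        zero_mem' := fun y hy => ⟨0, I.zero_mem, by simp⟩
        neg_mem' := fun {a} ha y hy => by
          obtain ⟨w, hw, e'⟩ := ha y hy
          exact ⟨-w, I.neg_mem hw, by rw [mul_neg, e', map_neg]⟩ }
    have hRT : i.range ≤ T := by
      rintro _ ⟨r, rfl⟩ y hy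
      exact ⟨y * r, I.mul_mem_right _ hy, (map_mul i y r).symm⟩
    rw [← hmax T hRT ⟨⟨1, 1, fun x hx => by simpa using hRT hx⟩, uc, 1, fun q hq => ?_⟩]
    · intro y hy
      obtain ⟨z, hz, e⟩ := hx y hy
      exact ⟨z, hz, by rw [hudc, ← mul_assoc, ← map_mul, e, hdi, ← hudc,
        Units.inv_mul_cancel_left]⟩
    · obtain ⟨z, -, e⟩ := hq _ hcI
      exact ⟨z, by rw [← e, huc, Units.val_one, mul_one]⟩

theorem IsMaximalOrderOver.mulOpposite {C R : Type*} [CommRing C] [Ring R] [Algebra C R]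
    (h : IsMaximalOrderOver C R) : IsMaximalOrderOver C Rᵐᵒᵖ := by
  intro I hI hc x d hd hx
  let J : Ideal R :=
    { carrier := {y | MulOpposite.op y ∈ I}
      add_mem' := fun {a b} ha hb => I.add_mem ha hb
      zero_mem' := I.zero_mem
      smul_mem' := fun r y hy => I.mul_mem_right (MulOpposite.op r) hy }
  have hJ : J.IsTwoSided := ⟨fun {a} b ha => I.mul_mem_left (MulOpposite.op b) ha⟩
  obtain ⟨t, ht⟩ := h J hJ hc (unop x) d hd (hx.symm.imp
    (fun hx y hy => by
      obtain ⟨z, hz, e⟩ := hx (MulOpposite.op y) hy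
      exact ⟨unop z, hz, op_injective e⟩)
    (fun hx y hy => by
      obtain ⟨z, hz, e⟩ := hx (MulOpposite.op y) hy
      exact ⟨unop z, hz, op_injective e⟩))
  exact ⟨MulOpposite.op t, unop_injective ht⟩

theorem IsPrimeRing.mulOpposite {R : Type*} [Ring R] (h : IsPrimeRing R) : IsPrimeRing Rᵐᵒᵖ := by
  have := h.1
  refine ⟨inferInstance, fun a b hab => ?_⟩
  have := h.2 (unop b) (unop a) fun r => op_injective (by simpa [mul_assoc] using hab (MulOpposite.op r))
  exact this.symm.imp (fun h => unop_injective h) (fun h => unop_injective h)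

/-- If the scalars are the whole center, a maximal order has integrally closed center. -/
theorem IsMaximalOrderOver.isIntegrallyClosed {Z R : Type*} [CommRing Z] [IsDomain Z] [Ring R]
    [Algebra Z R] (h : IsMaximalOrderOver Z R) [Nontrivial R]
    (htf : ∀ (c : Z) (r : R), c • r = 0 → c = 0 ∨ r = 0)
    (hcen : ∀ r : R, (∀ s, r * s = s * r) → ∃ z, algebraMap Z R z = r) :
    IsIntegrallyClosed Z := by
  refine (isIntegrallyClosed_iff (FractionRing Z)).2 fun {x} hx => ?_
  obtain ⟨c, hc, hcx⟩ := hx.isAlmostIntegral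
  obtain ⟨a, b, hb, rfl⟩ := IsFractionRing.div_surjective (A := Z) x
  have hb0 : b ≠ 0 := nonZeroDivisors.ne_zero hb
  have hbK : algebraMap Z (FractionRing Z) b ≠ 0 := by simpa using hb0
  -- For x = a / b integral over Z, this is the two-sided ideal of all y with x^m y ∈ R for every m.
  -- It contains a nonzero central c by almost integrality and is stable under x, so maximality puts
  -- x in R.
  let I : Ideal R :=
    { carrier := {y | ∀ m : ℕ, ∃ z : R, a ^ m • y = b ^ m • z}
      add_mem' := fun {y y'} hy hy' m => by
        obtain ⟨z, e⟩ := hy m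
        obtain ⟨z', e'⟩ := hy' m
        exact ⟨z + z', by rw [smul_add, smul_add, e, e']⟩
      zero_mem' := fun m => ⟨0, by simp⟩
      smul_mem' := fun r y hy m => by
        obtain ⟨z, e⟩ := hy m
        exact ⟨r • z, by rw [smul_eq_mul, smul_eq_mul, ← mul_smul_comm, e, mul_smul_comm]⟩ }
  have hI : I.IsTwoSided := ⟨fun {y} r hy m => by
    obtain ⟨z, e⟩ := hy m
    exact ⟨z * r, by rw [← smul_mul_assoc, e, smul_mul_assoc]⟩⟩
  have hcI : algebraMap Z R c ∈ I := by
    intro m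
    obtain ⟨z, hz⟩ := hcx m
    refine ⟨algebraMap Z R z, ?_⟩
    have h1 : a ^ m * c = b ^ m * z := by
      apply IsFractionRing.injective Z (FractionRing Z)
      rw [map_mul, map_mul, hz, Algebra.smul_def, div_pow, map_pow, map_pow]
      field_simp
    rw [Algebra.smul_def, Algebra.smul_def, ← map_mul, ← map_mul, h1]
  have hcanc : ∀ (m : ℕ) (y y' : R), b ^ m • y = b ^ m • y' → y = y' := fun m y y' e =>
    sub_eq_zero.1 ((htf (b ^ m) _ (by rw [smul_sub, e, sub_self])).resolve_left (pow_ne_zero m hb0))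
  obtain ⟨t, ht⟩ := h I hI ⟨c, nonZeroDivisors.ne_zero hc, hcI⟩ (algebraMap Z R a) b hb0
    (Or.inl fun y hy => by
      obtain ⟨z, e⟩ := hy 1
      refine ⟨z, fun m => ?_, by rw [← Algebra.smul_def, ← pow_one a, e, pow_one]⟩
      obtain ⟨z', e'⟩ := hy (m + 1)
      refine ⟨z', hcanc 1 _ _ ?_⟩
      rw [smul_comm, ← e, smul_smul, smul_smul, ← pow_add, ← pow_add, e', add_comm])
  obtain ⟨z, hz⟩ := hcen t fun s => hcanc 1 _ _ (by
    rw [pow_one, ← smul_mul_assoc, ← mul_smul_comm, ← ht, Algebra.commutes])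
  refine ⟨z, ?_⟩
  have h2 : a = b * z := by
    have h3 : (a - b * z) • (1 : R) = 0 := by
      rw [sub_smul, ← Algebra.algebraMap_eq_smul_one, ht, ← hz, mul_smul,
        ← Algebra.algebraMap_eq_smul_one, sub_self]
    exact sub_eq_zero.1 ((htf _ _ h3).resolve_right one_ne_zero)
  rw [h2, map_mul]
  field_simp

end MaximalOrder

/-! ### A trace that splits off the center -/

section Trace

/-- The trace of left multiplication is a sum of eigenvalues in an algebraic closure, and each
eigenvalue is a root of the monic equation of x. Commutativity of V plays no role. -/
theorem Algebra.isIntegral_trace_of_ring {Z K V : Type*} [CommRing Z] [Field K] [Algebra Z K]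
    [Ring V] [Algebra K V] [Algebra Z V] [IsScalarTower Z K V] [Module.Finite K V] {x : V}
    (hx : IsIntegral Z x) : IsIntegral Z (LinearMap.trace K V (Algebra.lmul K V x)) := by
  classical
  let L := AlgebraicClosure K
  let b := Module.finBasis K V
  let f : V →ₐ[Z] Matrix _ _ L :=
    (((Algebra.ofId K L).mapMatrix.comp (Algebra.leftMulMatrix b)).restrictScalars Z)
  rw [← isIntegral_algebraMap_iff (algebraMap K L).injective, LinearMap.trace_eq_matrix_trace K b]
  have h1 : algebraMap K L (LinearMap.toMatrix b b (Algebra.lmul K V x)).trace = (f x).trace :=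
    AddMonoidHom.map_trace (algebraMap K L) _
  rw [h1, Matrix.trace_eq_sum_roots_charpoly]
  refine IsIntegral.multiset_sum fun μ hμ => ?_
  have h2 : μ ∈ spectrum L (f x) :=
    Matrix.mem_spectrum_of_isRoot_charpoly (Polynomial.isRoot_of_mem_roots hμ)
  obtain ⟨p, hp, hpx⟩ := hx
  refine ⟨p, hp, ?_⟩
  have h3 := spectrum.subset_polynomial_aeval (f x) (p.map (algebraMap Z L)) ⟨μ, h2, rfl⟩
  have h4 : Polynomial.aeval (f x) (p.map (algebraMap Z L)) = 0 := by
    rw [Polynomial.aeval_map_algebraMap, Polynomial.aeval_algHom_apply, Polynomial.aeval_def, hpx,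
      map_zero]
  have : Nonempty (Fin (Module.finrank K V)) := by
    by_contra hne
    rw [not_nonempty_iff] at hne
    have h5 : (f x) = 0 := Subsingleton.elim _ _
    exact h2 ((isUnit_of_subsingleton _))
  rw [h4, spectrum.zero_eq, Set.mem_singleton_iff] at h3
  simpa [Polynomial.eval_map] using h3

/-- The trace of left multiplication on Frac(Z) ⊗ R takes integral values on R, hence values in Z.
Its value at 1 is the dimension, which is invertible. -/
theorem exists_linearMap_one_eq_one {Z R : Type*} [CommRing Z] [IsDomain Z] [IsIntegrallyClosed Z]
    [Ring R] [Nontrivial R] [Algebra Z R] [Module.Finite Z R]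
    (htf : ∀ (c : Z) (r : R), c • r = 0 → c = 0 ∨ r = 0)
    (hZ : ∀ n : ℕ, n ≠ 0 → IsUnit (n : Z)) : ∃ t : R →ₗ[Z] Z, t 1 = 1 := by
  let K := FractionRing Z
  let V := K ⊗[Z] R
  let ι : R →ₐ[Z] V := Algebra.TensorProduct.includeRight
  have hι : Function.Injective ι := IsLocalization.includeRight_injective _ le_rfl K htf
  have : Nontrivial V := hι.nontrivial
  let τ : R →ₗ[Z] K := (LinearMap.trace K V ∘ₗ (Algebra.lmul K V).toLinearMap).restrictScalars Z ∘ₗ ι.toLinearMap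
  have hint : ∀ r, ∃ z, algebraMap Z K z = τ r := fun r =>
    IsIntegrallyClosed.algebraMap_eq_of_integral
      (Algebra.isIntegral_trace_of_ring ((Algebra.IsIntegral.isIntegral (R := Z) r).map ι))
  choose t ht using hint
  have hinj := IsFractionRing.injective Z K
  obtain ⟨u, hu⟩ := hZ (Module.finrank K V) (Module.finrank_pos (R := K) (M := V)).ne'
  let t' : R →ₗ[Z] Z :=
    { toFun := t
      map_add' := fun a b => hinj (by rw [map_add, ht, ht, ht, map_add])
      map_smul' := fun z a => hinj (by
        rw [RingHom.id_apply, smul_eq_mul, map_mul, ht, ht, map_smul, Algebra.smul_def]) }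
  refine ⟨(↑u⁻¹ : Z) • t', ?_⟩
  have h1 : t 1 = u := hinj (by
    rw [ht, hu]
    change LinearMap.trace K V (Algebra.lmul K V (ι 1)) = _
    rw [map_one, map_one, LinearMap.trace_one]
    simp)
  change (↑u⁻¹ : Z) * t 1 = 1
  rw [h1, Units.inv_mul]

end Trace

/-! ### Descent of normality and finiteness along a retraction -/

section BoundedDegree

theorem exists_smul_eq_algebraMap {C Z : Type*} [CommRing C] [CommRing Z] [IsDomain Z]
    [Algebra C Z] [Algebra.IsAlgebraic C Z] {L : Type*} [Field L] [Algebra Z L]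
    [IsFractionRing Z L] [Algebra C L] [IsScalarTower C Z L] (x : L) :
    ∃ c : C, c ≠ 0 ∧ ∃ z : Z, c • x = algebraMap Z L z := by
  obtain ⟨a, b, hb, rfl⟩ := IsFractionRing.div_surjective (A := Z) x
  obtain ⟨c, hc, w, hw⟩ :=
    (Algebra.IsAlgebraic.isAlgebraic (R := C) b).exists_nonzero_dvd hb
  have hb0 : algebraMap Z L b ≠ 0 := by simpa using nonZeroDivisors.ne_zero hb
  refine ⟨c, hc, w * a, ?_⟩
  rw [Algebra.smul_def, IsScalarTower.algebraMap_apply C Z L, hw, map_mul, map_mul]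
  field_simp

variable {C Z : Type*} [CommRing C] [IsDomain C] [CommRing Z] [IsDomain Z] [Algebra C Z]
  [FaithfulSMul C Z]

/-- A fraction a / b integral over C equals some z in Z. Applying E to b z = a gives b E(z) = a, so
the fraction is E(z). -/
theorem isIntegrallyClosed_of_retraction [IsIntegrallyClosed Z] (E : Z →ₗ[C] C) (hE : E 1 = 1) :
    IsIntegrallyClosed C := by
  let F := FractionRing C
  let L := FractionRing Z
  have : FaithfulSMul C L := FaithfulSMul.trans C Z L
  let _ : Algebra F L := FractionRing.liftAlgebra C L
  refine (isIntegrallyClosed_iff F).2 fun {x} hx => ?_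
  have h1 : IsIntegral C (algebraMap F L x) := hx.algebraMap
  have h2 : IsIntegral Z (algebraMap F L x) := h1.tower_top
  obtain ⟨z, hz⟩ := IsIntegrallyClosed.algebraMap_eq_of_integral h2
  obtain ⟨a, b, hb, rfl⟩ := IsFractionRing.div_surjective (A := C) x
  have hb0 : algebraMap C F b ≠ 0 := by simpa using nonZeroDivisors.ne_zero hb
  have h3 : b • z = algebraMap C Z a := by
    apply IsFractionRing.injective Z L
    rw [Algebra.smul_def, map_mul, hz, ← IsScalarTower.algebraMap_apply C Z L,
      ← IsScalarTower.algebraMap_apply C Z L, IsScalarTower.algebraMap_apply C F L,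
      IsScalarTower.algebraMap_apply C F L, ← map_mul]
    congr 1
    rw [mul_comm]
    exact div_mul_cancel₀ _ hb0
  refine ⟨E z, ?_⟩
  have h4 := congrArg E h3
  rw [map_smul, Algebra.algebraMap_eq_smul_one, map_smul, hE, smul_eq_mul, smul_eq_mul,
    mul_one] at h4
  rw [← h4, map_mul, mul_comm]
  exact (eq_div_iff hb0).2 rfl

/-- Otherwise there is a finite subextension of degree greater than d, and its primitive element has
too large a degree. -/
theorem finiteDimensional_of_forall_natDegree_le {F L : Type*} [Field F] [CharZero F] [Field L]
    [Algebra F L] (d : ℕ) (hd : ∀ x : L, ∃ P : Polynomial F, P ≠ 0 ∧ P.natDegree ≤ d ∧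
      Polynomial.aeval x P = 0) : FiniteDimensional F L := by
  have halg : Algebra.IsAlgebraic F L := ⟨fun x => by
    obtain ⟨P, hP, -, h⟩ := hd x
    exact ⟨P, hP, h⟩⟩
  by_contra hinf
  obtain ⟨N, hN, hlt⟩ := IntermediateField.exists_lt_finrank_of_infinite_dimensional hinf d
  obtain ⟨α, hα⟩ := Field.exists_primitive_element F N
  rw [Field.primitive_element_iff_minpoly_natDegree_eq] at hα
  obtain ⟨P, hP, hPd, h⟩ := hd (α : L)
  have h1 : Polynomial.aeval α P = 0 := by
    apply (algebraMap N L).injective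
    rw [map_zero, ← Polynomial.aeval_algebraMap_apply]
    exact h
  have h2 := Polynomial.natDegree_le_natDegree (minpoly.degree_le_of_ne_zero F α hP h1)
  omega

/-- A domain whose elements have bounded degree over a noetherian subring of characteristic zero
which is a linear retract is a finite module over that subring. -/
theorem Module.Finite.of_forall_natDegree_le [CharZero C] [IsNoetherianRing C] (E : Z →ₗ[C] C)
    (hE : E 1 = 1) (d : ℕ) (hd : ∀ z : Z, ∃ P : Polynomial C, P ≠ 0 ∧ P.natDegree ≤ d ∧
      Polynomial.aeval z P = 0) : Module.Finite C Z := by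
  have halg : Algebra.IsAlgebraic C Z := ⟨fun x => by
    obtain ⟨P, hP, -, h⟩ := hd x
    exact ⟨P, hP, h⟩⟩
  let F := FractionRing C
  let L := FractionRing Z
  have : FaithfulSMul C L := FaithfulSMul.trans C Z L
  let _ : Algebra F L := FractionRing.liftAlgebra C L
  have hFC := IsFractionRing.injective C F
  have hLZ := IsFractionRing.injective Z L
  have : CharZero F := charZero_of_injective_algebraMap hFC
  have hfd : FiniteDimensional F L := by
    refine finiteDimensional_of_forall_natDegree_le d fun x => ?_
    obtain ⟨c, hc, z, hz⟩ := exists_smul_eq_algebraMap (C := C) (Z := Z) x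
    obtain ⟨P, hP, hPd, h⟩ := hd z
    refine ⟨(P.comp (Polynomial.C c * Polynomial.X)).map (algebraMap C F), ?_, ?_, ?_⟩
    · rw [Polynomial.map_ne_zero_iff hFC, Ne, Polynomial.comp_C_mul_X_eq_zero_iff
        (mem_nonZeroDivisors_of_ne_zero hc)]
      exact hP
    · rw [Polynomial.natDegree_map_eq_of_injective hFC, Polynomial.natDegree_comp,
        Polynomial.natDegree_C_mul_X c hc, mul_one]
      exact hPd
    · rw [Polynomial.aeval_map_algebraMap, Polynomial.aeval_comp]
      have : Polynomial.aeval x (Polynomial.C c * Polynomial.X) = algebraMap Z L z := by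
        rw [← hz, map_mul, Polynomial.aeval_C, Polynomial.aeval_X, Algebra.smul_def]
      rw [this, Polynomial.aeval_algebraMap_apply, h, map_zero]
  let b := Module.finBasis F L
  choose c hc z hz using fun i => exists_smul_eq_algebraMap (C := C) (Z := Z) (b i)
  -- The z_i are multiples in Z of a basis of Frac(Z) over Frac(C). If x ≠ 0 and all E(x z_i)
  -- vanish, choose w with x w = e ≠ 0 in C; a multiple c' w is a C-combination of the z_i, so c' e
  -- = E(c' x w) = 0. Thus Z embeds in a finite free module over the noetherian ring C.
  let Φ : Z →ₗ[C] (Fin _ → C) := LinearMap.pi fun i => E ∘ₗ LinearMap.mulRight C (z i)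
  refine Module.Finite.of_injective Φ ?_
  rw [injective_iff_map_eq_zero]
  intro x hx
  by_contra hx0
  have hx' : ∀ i, E (x * z i) = 0 := fun i => congrFun hx i
  obtain ⟨e, he, w, hw⟩ := (Algebra.IsAlgebraic.isAlgebraic (R := C) x).exists_nonzero_dvd
    (mem_nonZeroDivisors_of_ne_zero hx0)
  obtain ⟨c', hc'⟩ := IsLocalization.exist_integer_multiples_of_finite (nonZeroDivisors C)
    fun i => b.repr (algebraMap Z L w) i / algebraMap C F (c i)
  choose m hm using hc'
  have h1 : (c' : C) • w = ∑ i, m i • z i := by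
    apply hLZ
    have h2 : ∀ i, algebraMap Z L (m i • z i) =
        (c' : C) • (b.repr (algebraMap Z L w) i • b i) := by
      intro i
      have hci : algebraMap C F (c i) ≠ 0 := by simpa using hc i
      rw [Algebra.smul_def, map_mul, ← IsScalarTower.algebraMap_apply, ← hz, Algebra.smul_def (c i),
        ← mul_assoc, IsScalarTower.algebraMap_apply C F L, IsScalarTower.algebraMap_apply C F L (c i),
        hm, ← map_mul, ← Algebra.smul_def, ← smul_assoc]
      congr 1
      rw [smul_mul_assoc, div_mul_cancel₀ _ hci]
    rw [map_sum, Finset.sum_congr rfl fun i _ => h2 i, ← Finset.smul_sum, b.sum_repr,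
      Algebra.smul_def, map_mul, ← IsScalarTower.algebraMap_apply, ← Algebra.smul_def]
  have h2 : E ((c' : C) • (x * w)) = c' * e := by
    rw [← hw, map_smul, Algebra.algebraMap_eq_smul_one, map_smul, hE, smul_eq_mul, smul_eq_mul,
      mul_one]
  rw [← mul_smul_comm, h1, Finset.mul_sum, map_sum, Finset.sum_eq_zero] at h2
  · exact mul_ne_zero (nonZeroDivisors.ne_zero c'.2) he h2.symm
  · intro i _
    rw [mul_smul_comm, map_smul, hx', smul_zero]

end BoundedDegree

/-! ### From local dual bases to the cokernel of γ -/

section Gamma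

/-- The passage to opposite rings turns the left A-linear functionals of
`IsMaximalOrderOver.isRankOneSum` into the right A-linear ones needed for γ. -/
theorem IsMaximalOrderOver.exists_sum_mul_eq {C : Type*} [CommRing C] [IsDomain C]
    [IsNoetherianRing C] [IsIntegrallyClosed C] {k : Type*} [Field k] {R : Type*} [Ring R]
    [Algebra k R] [Algebra C R] [Module.Finite C R] (hmax : IsMaximalOrderOver C R)
    (hR : IsPrimeRing R) (htf : ∀ (c : C) (r : R), c • r = 0 → c = 0 ∨ r = 0)
    (A : Subalgebra k R) (hCA : ∀ c, algebraMap C R c ∈ A) (E : R →+ A) (hE1 : E 1 = 1)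
    (hEl : ∀ (a : A) r, E (a * r) = a * E r) (hEr : ∀ (a : A) r, E (r * a) = E r * a)
    (p : Ideal C) [p.IsPrime] (hp1 : ∀ q : Ideal C, q.IsPrime → q < p → q = ⊥) :
    ∃ s ∉ p, ∃ (ι : Type) (_ : Fintype ι) (f : ι → R →ₗ[(↥A)ᵐᵒᵖ] A) (x : ι → R),
      ∀ y, algebraMap C R s * y = ∑ i, x i * f i y := by
  let algA : Algebra C A :=
    { smul := fun c a => ⟨algebraMap C R c, hCA c⟩ * a
      algebraMap := (algebraMap C R).codRestrict A.toSubring hCA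
      commutes' := fun c a => Subtype.ext (Algebra.commutes c (a : R))
      smul_def' := fun _ _ => rfl }
  have halg : ∀ c : C, ((algebraMap C A c : A) : R) = algebraMap C R c := fun _ => rfl
  let j : A →ₐ[C] R := { A.val.toRingHom with commutes' := fun c => rfl }
  let E' : Rᵐᵒᵖ →ₗ[C] Aᵐᵒᵖ :=
    { toFun := fun r => op (E (unop r))
      map_add' := fun a b => by rw [unop_add, map_add, op_add]
      map_smul' := fun c r => unop_injective (by
        rw [RingHom.id_apply, unop_op, unop_smul, unop_smul, unop_op, Algebra.smul_def,
          Algebra.smul_def, ← halg, hEl]) }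
  have htf' : ∀ (c : C) (r : Rᵐᵒᵖ), c • r = 0 → c = 0 ∨ r = 0 := fun c r h =>
    (htf c (unop r) (op_injective h)).imp_right fun h => unop_injective h
  obtain ⟨s, hs, ι, _, g, x, hg, hx⟩ := hmax.mulOpposite.isRankOneSum hR.mulOpposite htf' (AlgHom.op j) E'
    (unop_injective hE1) (fun a r => unop_injective (hEr (unop a) (unop r)))
    (fun a r => unop_injective (hEl (unop a) (unop r))) p hp1
  refine ⟨s, hs, ι, inferInstance, fun i =>
    { toFun := fun y => unop (g i (op y))
      map_add' := fun a b => by rw [op_add, map_add, unop_add]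
      map_smul' := fun a y => op_injective (hg i a (op y)) }, fun i => unop (x i), fun y => ?_⟩
  have h1 := congrArg unop (hx (op y))
  rw [unop_smul, unop_op, Algebra.smul_def, Finset.unop_sum] at h1
  exact h1

theorem isNoetherian_quotient_compHom {C S M V : Type*} [CommRing C] [Ring S] [AddCommGroup M]
    [Module S M] (N : Submodule S M) (f : C →+* S) [AddCommGroup V] [Module C V]
    [IsNoetherian C V] (e : M →+ V) (he : Function.Injective e)
    (hsm : ∀ c m, e (f c • m) = c • e m) :
    @IsNoetherian C (M ⧸ N) _ _ (Module.compHom _ f) := by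
  let _ : Module C M := Module.compHom M f
  let _ : Module C (M ⧸ N) := Module.compHom _ f
  let e' : M →ₗ[C] V := { e with map_smul' := hsm }
  have : IsNoetherian C M := isNoetherian_of_injective e' he
  let q : M →ₗ[C] M ⧸ N :=
    { toFun := Submodule.Quotient.mk
      map_add' := fun _ _ => rfl
      map_smul' := fun _ _ => rfl }
  exact isNoetherian_of_surjective q (LinearMap.range_eq_top.2 (Submodule.mkQ_surjective N))

variable {k : Type*} [Field k] {R : Type v} [Ring R] [Algebra k R] {A : Subalgebra k R}

/-- By right A-linearity g(s y) = ∑ g(x_i) f_i(y), which is the image of ∑ g(x_i) ⊗ f_i. -/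
theorem mem_range_gammaMap_of_eq_sum {ι : Type*} [Fintype ι] {s : R}
    {f : ι → R →ₗ[(↥A)ᵐᵒᵖ] A} {x : ι → R} (hs : ∀ y, s * y = ∑ i, x i * f i y)
    (g g' : Module.End (↥A)ᵐᵒᵖ R) (hg : ∀ y, g' y = g (s * y)) : g' ∈ (gammaMap A R).range := by
  refine ⟨∑ i, QuotientAddGroup.mk (g (x i) ⊗ₜ[ℤ] f i), ?_⟩
  ext y
  rw [hg, hs, map_sum, map_sum, LinearMap.sum_apply]
  refine Finset.sum_congr rfl fun i _ => ?_
  rw [gammaMap_tmul]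
  exact (g.map_smul (op (f i y)) (x i)).symm

variable {C : Type*} [CommRing C] [Algebra C R]

theorem map_algebraMap_mul (hCA : ∀ c, algebraMap C R c ∈ A) (g : Module.End (↥A)ᵐᵒᵖ R) (c : C)
    (y : R) : g (algebraMap C R c * y) = algebraMap C R c * g y := by
  rw [Algebra.commutes, Algebra.commutes]
  exact g.map_smul (op ⟨_, hCA c⟩) y

/-- Evaluation at generators embeds the endomorphism ring into a noetherian module. -/
theorem exists_evaluation_injective [Module.Finite C R] (hCA : ∀ c, algebraMap C R c ∈ A) :
    ∃ (n : ℕ) (e : Module.End (↥A)ᵐᵒᵖ R →+ (Fin n → R)), Function.Injective e ∧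
      ∀ g i (c : C) (g' : Module.End (↥A)ᵐᵒᵖ R), (∀ y, g' y = algebraMap C R c * g y) →
        e g' i = c • e g i := by
  obtain ⟨n, v, hv⟩ := Module.Finite.exists_fin (R := C) (M := R)
  refine ⟨n, { toFun := fun g i => g (v i), map_zero' := rfl, map_add' := fun _ _ => rfl },
    fun g g' h => ?_, fun g i c g' h => (h _).trans (Algebra.smul_def _ _).symm⟩
  ext y
  have hy : y ∈ Submodule.span C (Set.range v) := by rw [hv]; trivial
  induction hy using Submodule.span_induction with
  | mem x hx => obtain ⟨i, rfl⟩ := hx; exact congrFun h i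
  | zero => rw [map_zero, map_zero]
  | add x y _ _ hx hy => rw [map_add, map_add, hx, hy]
  | smul c x _ hx =>
    rw [Algebra.smul_def, map_algebraMap_mul hCA, map_algebraMap_mul hCA, hx]

/-- The endomorphism ring embeds in some R^n over C, so the cokernel is noetherian over C. For
central s the left action s g(y) and the right action g(s y) agree, so the same s kills the cokernel
on both sides. -/
theorem krullDimension_cokerGamma_add_two_le [IsDomain C] [IsNoetherianRing C]
    [Module.Finite C R] [Nontrivial R] (hCA : ∀ c, algebraMap C R c ∈ A)
    (t : R →ₗ[C] C) (ht : t 1 = 1)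
    (h : ∀ p : Ideal C, p.IsPrime → (∀ q : Ideal C, q.IsPrime → q < p → q = ⊥) →
      ∃ s ∉ p, ∃ (ι : Type) (_ : Fintype ι) (f : ι → R →ₗ[(↥A)ᵐᵒᵖ] A) (x : ι → R),
        ∀ y, algebraMap C R s * y = ∑ i, x i * f i y) :
    krullDimension R (CokerGamma A R R) + 2 ≤ krullDimension R R ∧
      krullDimension Rᵈᵐᵃ (CokerGammaRight A R R) + 2 ≤ krullDimension Rᵐᵒᵖ R := by
  obtain ⟨n, e, he, hsm⟩ := exists_evaluation_injective hCA
  have hnoeth : IsNoetherian C (Fin n → R) := inferInstance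
  constructor
  · obtain ⟨φ, hφ⟩ := Ideal.exists_strictMono_of_retraction (S := R) t ht
    let _ : Module C (CokerGamma A R R) := Module.compHom _ (algebraMap C R)
    have : IsNoetherian C (CokerGamma A R R) :=
      isNoetherian_quotient_compHom (gammaRange A R R) (algebraMap C R) e he fun c g => by
        ext i
        exact hsm g i c _ fun y => rfl
    refine krullDimension_add_two_le φ hφ (algebraMap C R) (fun _ _ => rfl) fun p hp hp1 => ?_
    obtain ⟨s, hs, ι, _, f, x, hx⟩ := h p hp hp1
    refine ⟨s, hs, fun y => ?_⟩
    induction y using Submodule.Quotient.induction_on with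
    | H g =>
      refine (Submodule.Quotient.mk_eq_zero (gammaRange A R R)
        (x := algebraMap C R s • g)).2 ?_
      exact mem_range_gammaMap_of_eq_sum hx g _ fun y => (map_algebraMap_mul hCA g s y).symm
  · obtain ⟨φ, hφ⟩ := Ideal.exists_strictMono_of_retraction (S := Rᵐᵒᵖ) t ht
    let f : C →+* Rᵈᵐᵃ :=
      { toFun := fun c => DomMulAct.mk (algebraMap C R c)
        map_one' := congrArg DomMulAct.mk (map_one (algebraMap C R))
        map_mul' := fun a b => congrArg DomMulAct.mk ((map_mul _ a b).trans (Algebra.commutes _ _))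
        map_zero' := congrArg DomMulAct.mk (map_zero (algebraMap C R))
        map_add' := fun a b => congrArg DomMulAct.mk (map_add (algebraMap C R) a b) }
    let _ : Module C (CokerGammaRight A R R) := Module.compHom _ f
    have : IsNoetherian C (CokerGammaRight A R R) :=
      isNoetherian_quotient_compHom (gammaRangeRight A R R) f e he fun c g => by
        ext i
        exact hsm g i c _ fun y => map_algebraMap_mul hCA g c y
    refine krullDimension_add_two_le φ hφ f (fun _ _ => rfl) fun p hp hp1 => ?_
    obtain ⟨s, hs, ι, _, f', x, hx⟩ := h p hp hp1
    refine ⟨s, hs, fun y => ?_⟩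
    induction y using Submodule.Quotient.induction_on with
    | H g =>
      refine (Submodule.Quotient.mk_eq_zero (gammaRangeRight A R R) (x := f s • g)).2 ?_
      exact mem_range_gammaMap_of_eq_sum hx g _ fun y => rfl

end Gamma

/-! ### The central part of the subalgebra as base ring -/

section CentralInvariants

variable {k : Type*} [Field k] {R : Type v} [Ring R] [Algebra k R]

/-- The intersection of a subalgebra with the center. -/
abbrev Subalgebra.centralPart (A : Subalgebra k R) : Subring (Subring.center R) :=
  A.toSubring.comap (Subring.center R).subtype

theorem IsPrimeRing.smul_eq_zero_of_center (hR : IsPrimeRing R) (z : Subring.center R) (r : R)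
    (h : z • r = 0) : z = 0 ∨ r = 0 := by
  have hz := fun s => Subring.mem_center_iff.1 z.2 s
  refine (hR.2 z r fun s => ?_).imp_left fun h => Subtype.ext h
  rw [← hz, mul_assoc]
  exact (congrArg (s * ·) h).trans (mul_zero s)

theorem IsPrimeRing.isDomain_center (hR : IsPrimeRing R) : IsDomain (Subring.center R) := by
  have := hR.1
  have : NoZeroDivisors (Subring.center R) := ⟨fun {a b} h => by
    refine (hR.smul_eq_zero_of_center a b ?_).imp_right fun h => Subtype.ext h
    exact congrArg Subtype.val h⟩
  exact NoZeroDivisors.to_isDomain _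

/-- The inequality for a maximal order `R` that is finite over its center, and a subalgebra `A`
onto which there is a bilinear projection preserving the center, provided that central elements
have bounded degree over `A`. -/
theorem krullDimension_cokerGamma_add_two_le_of_retraction [CharZero k]
    [IsNoetherianRing R] (hR : IsPrimeRing R)
    (hfin : Module.Finite (Subring.center R) R) (hmax : IsMaximalOrder R) (A : Subalgebra k R)
    (E : R →+ A) (hE1 : E 1 = 1) (hEl : ∀ (a : A) r, E (a * r) = a * E r)
    (hEr : ∀ (a : A) r, E (r * a) = E r * a)
    (hEZ : ∀ z ∈ Subring.center R, (E z : R) ∈ Subring.center R) (d : ℕ)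
    (hd : ∀ z : Subring.center R, ∃ P : Polynomial A.centralPart, P ≠ 0 ∧ P.natDegree ≤ d ∧
      Polynomial.aeval z P = 0) :
    krullDimension R (CokerGamma A R R) + 2 ≤ krullDimension R R ∧
      krullDimension Rᵈᵐᵃ (CokerGammaRight A R R) + 2 ≤ krullDimension Rᵐᵒᵖ R := by
  let Z := Subring.center R
  let C : Subring Z := A.centralPart
  have := hR.1
  have hZdom : IsDomain Z := hR.isDomain_center
  have hZmax : IsMaximalOrderOver Z R := hmax.isMaximalOrderOver hR.smul_eq_zero_of_center
  have hZcl : IsIntegrallyClosed Z := hZmax.isIntegrallyClosed hR.smul_eq_zero_of_center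
    fun r hr => ⟨⟨r, Subring.mem_center_iff.2 fun s => (hr s).symm⟩, rfl⟩
  have hunit : ∀ n : ℕ, n ≠ 0 → IsUnit (n : Z) := by
    intro n hn
    refine IsUnit.of_mul_eq_one ⟨algebraMap k R (n : k)⁻¹, Subring.mem_center_iff.2 fun s =>
      (Algebra.commutes _ s).symm⟩ (Subtype.ext ?_)
    change ((n : Z) : R) * algebraMap k R (n : k)⁻¹ = 1
    have h1 : ((n : Z) : R) = algebraMap k R (n : k) := by rw [map_natCast]; norm_cast
    rw [h1, ← map_mul, mul_inv_cancel₀ (Nat.cast_ne_zero.2 hn), map_one]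
  obtain ⟨t, ht⟩ := exists_linearMap_one_eq_one hR.smul_eq_zero_of_center hunit
  let EZ : Z →ₗ[C] C :=
    { toFun := fun z => ⟨⟨E z, hEZ z z.2⟩, (E z).2⟩
      map_add' := fun a b => Subtype.ext (Subtype.ext
        (congrArg (Subtype.val : A → R) (map_add E (a : R) b)))
      map_smul' := fun c z => Subtype.ext (Subtype.ext
        (congrArg (Subtype.val : A → R) (hEl ⟨c, c.2⟩ z))) }
  have hEZ1 : EZ 1 = 1 := Subtype.ext (Subtype.ext (congrArg (Subtype.val : A → R) hE1))
  -- The normalized trace onto Z followed by the projection to C. It makes C noetherian before R is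
  -- known to be finite over C.
  let tC : R →ₗ[C] C := EZ ∘ₗ t.restrictScalars C
  have htC : tC 1 = 1 := by
    change EZ (t 1) = 1
    rw [ht, hEZ1]
  have hCnoeth : IsNoetherianRing C := isNoetherianRing_of_retraction (S := R) tC htC
  have hCcl : IsIntegrallyClosed C := isIntegrallyClosed_of_retraction EZ hEZ1
  have hCchar : CharZero C := by
    refine charZero_of_inj_zero fun n hn => ?_
    by_contra hne
    refine (hunit n hne).ne_zero ?_
    rw [← Subring.coe_natCast C, hn]
    rfl
  have hZfin : Module.Finite C Z := Module.Finite.of_forall_natDegree_le EZ hEZ1 d hd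
  have hRfin : Module.Finite C R := Module.Finite.trans Z R
  have htf : ∀ (c : C) (r : R), c • r = 0 → c = 0 ∨ r = 0 := fun c r h =>
    (hR.smul_eq_zero_of_center (c : Z) r h).imp_left fun h => Subtype.ext h
  have hCA : ∀ c : C, algebraMap C R c ∈ A := fun c => c.2
  exact krullDimension_cokerGamma_add_two_le hCA tC htC fun p hp hp1 =>
    (hmax.isMaximalOrderOver htf).exists_sum_mul_eq hR htf A hCA E hE1 hEl hEr p hp1

end CentralInvariants

/-! ### Bounded degree of sums of elements that commute up to relabelling -/

section Words

/-- If the generators satisfy `f a * f b = f b * f (c a b)`, every word can be sorted. -/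
theorem exists_pairwise_le_prod_eq {α M : Type*} [LinearOrder α] [WellFoundedLT α] [Monoid M]
    (f : α → M) (c : α → α → α) (hc : ∀ a b, f a * f b = f b * f (c a b)) :
    ∀ (n : ℕ) (l : List α), l.length = n →
      ∃ l' : List α, l'.length = n ∧ l'.Pairwise (· ≤ ·) ∧ (l'.map f).prod = (l.map f).prod := by
  intro n
  induction n with
  | zero =>
    intro l hl
    exact ⟨l, hl, by rw [List.length_eq_zero_iff.1 hl]; exact List.Pairwise.nil, rfl⟩
  | succ n ih =>
    -- After sorting the tail, a first letter a larger than the next letter b is moved past it. The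
    -- new first letter b is smaller and the tail keeps its length, so induction on the first letter
    -- ends the process.
    have key : ∀ (a : α) (l : List α), l.length = n → ∃ l' : List α, l'.length = n + 1 ∧
        l'.Pairwise (· ≤ ·) ∧ (l'.map f).prod = f a * (l.map f).prod := by
      intro a
      induction a using WellFoundedLT.induction with
      | ind a iha =>
        intro l hl
        obtain ⟨l', hl', hs, hp⟩ := ih l hl
        rcases l' with _ | ⟨b, l''⟩
        · exact ⟨[a], by simpa using hl'.symm, List.pairwise_singleton _ _, by simp [← hp]⟩
        · by_cases hab : a ≤ b
          · refine ⟨a :: b :: l'', by simpa using hl', List.pairwise_cons.2 ⟨fun y hy => ?_, hs⟩,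
              by rw [← hp, List.map_cons, List.prod_cons]⟩
            rcases List.mem_cons.1 hy with rfl | hy
            · exact hab
            · exact hab.trans ((List.pairwise_cons.1 hs).1 y hy)
          · obtain ⟨m, hm, hms, hmp⟩ := iha b (not_le.1 hab) (c a b :: l'') (by simpa using hl')
            refine ⟨m, hm, hms, ?_⟩
            rw [hmp, ← hp, List.map_cons, List.map_cons, List.prod_cons, List.prod_cons,
              ← mul_assoc, ← mul_assoc, hc a b]
    intro l hl
    rcases l with _ | ⟨a, l⟩
    · simp at hl
    · obtain ⟨l', h1, h2, h3⟩ := key a l (by simpa using hl)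
      exact ⟨l', h1, h2, by rw [h3, List.map_cons, List.prod_cons]⟩

variable {C R : Type*} [CommRing C] [Ring R] [Algebra C R]

/-- A sorted word is a product of powers of the letters in the order of e, and each P a absorbs its
power; a letter that does not occur contributes 1. -/
theorem prod_map_mem_prod_of_pairwise {α : Type*} [LinearOrder α] (f : α → R)
    (P : α → Submodule C R) (hP1 : ∀ a, 1 ∈ P a) (hP : ∀ a, ∀ x ∈ P a, f a * x ∈ P a) :
    ∀ e : List α, e.Pairwise (· ≤ ·) → ∀ l : List α, l.Pairwise (· ≤ ·) → (∀ a ∈ l, a ∈ e) →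
      (l.map f).prod ∈ (e.map P).prod := by
  intro e
  induction e with
  | nil =>
    intro _ l _ hl
    rw [List.eq_nil_iff_forall_not_mem.2 fun a ha => List.not_mem_nil (hl a ha)]
    exact Submodule.one_le.1 le_rfl
  | cons x e ih =>
    intro he l
    rw [List.pairwise_cons] at he
    rw [List.map_cons, List.prod_cons]
    induction l with
    | nil =>
      intro _ _
      have := Submodule.mul_mem_mul (hP1 x) (ih he.2 [] List.Pairwise.nil (by simp))
      simpa using this
    | cons y l ihl =>
      intro hl hmem
      by_cases hyx : y = x
      · subst hyx
        have h1 := ihl (List.pairwise_cons.1 hl).2 fun a ha => hmem a (List.mem_cons_of_mem _ ha)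
        rw [List.map_cons, List.prod_cons]
        refine Submodule.mul_induction_on h1 ?_ ?_
        · intro p hp m hm
          rw [← mul_assoc]
          exact Submodule.mul_mem_mul (hP y p hp) hm
        · intro a b ha hb
          rw [mul_add]
          exact add_mem ha hb
      · have h2 : ∀ a ∈ y :: l, a ∈ e := by
          intro a ha
          refine (List.mem_cons.1 (hmem a ha)).resolve_left ?_
          rintro rfl
          have hye := (List.mem_cons.1 (hmem y List.mem_cons_self)).resolve_left hyx
          refine hyx (le_antisymm ?_ (he.1 y hye))
          rcases List.mem_cons.1 ha with h | h
          · exact h.symm.le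
          · exact (List.pairwise_cons.1 hl).1 _ h
        have := Submodule.mul_mem_mul (hP1 x) (ih he.2 _ hl h2)
        simpa using this

theorem exists_card_le_prod_le_span {α : Type*} (P : α → Submodule C R) (d : ℕ)
    (hP : ∀ a, ∃ s : Finset R, s.card ≤ d ∧ P a ≤ Submodule.span C (s : Set R)) (e : List α) :
    ∃ s : Finset R, s.card ≤ d ^ e.length ∧ (e.map P).prod ≤ Submodule.span C (s : Set R) := by
  classical
  induction e with
  | nil => exact ⟨{1}, by simp, by simp [Submodule.one_eq_span]⟩
  | cons a e ih =>
    obtain ⟨s, hs, h⟩ := ih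
    obtain ⟨s', hs', h'⟩ := hP a
    open scoped Pointwise in
    refine ⟨s' * s, ?_, ?_⟩
    · rw [List.length_cons, pow_succ, mul_comm]
      exact Finset.card_mul_le.trans (Nat.mul_le_mul hs' hs)
    · rw [List.map_cons, List.prod_cons, Finset.coe_mul, ← Submodule.span_mul_span]
      exact mul_le_mul' h' h

/-- The D + 1 powers 1, z, …, z^D lie in a module with at most D generators, so they are linearly
dependent over C. -/
theorem exists_polynomial_of_pow_mem_span [IsDomain C] {D : ℕ} {z : R} (s : Finset R)
    (hs : s.card ≤ D) (hz : ∀ n, z ^ n ∈ Submodule.span C (s : Set R)) :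
    ∃ P : Polynomial C, P ≠ 0 ∧ P.natDegree ≤ D ∧ Polynomial.aeval z P = 0 := by
  have hdep : ¬ LinearIndependent C fun i : Fin (D + 1) => z ^ (i : ℕ) := by
    intro hli
    have h1 := linearIndependent_le_span' _ hli (s : Set R) (by rintro _ ⟨i, rfl⟩; exact hz i)
    have h2 : D + 1 ≤ s.card := by simpa using h1
    omega
  rw [Fintype.not_linearIndependent_iff] at hdep
  obtain ⟨c, hc, i, hi⟩ := hdep
  refine ⟨∑ i : Fin (D + 1), Polynomial.monomial i (c i), fun h => hi ?_, ?_, ?_⟩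
  · have := congrArg (fun P => Polynomial.coeff P i) h
    simp only [Polynomial.finsetSum_coeff, Polynomial.coeff_monomial, Polynomial.coeff_zero] at this
    rwa [Finset.sum_eq_single i, if_pos rfl] at this
    · intro j _ hj
      rw [if_neg]
      exact fun h => hj (Fin.ext h)
    · simp
  · refine Polynomial.natDegree_sum_le_of_forall_le _ _ fun i _ => ?_
    exact (Polynomial.natDegree_monomial_le _).trans (Nat.lt_succ_iff.1 i.2)
  · rw [map_sum, ← hc]
    exact Finset.sum_congr rfl fun i _ => by rw [Polynomial.aeval_monomial, Algebra.smul_def]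

/-- Bounded degree for a sum of elements `f g` that commute up to permutation and are integral
of bounded degree. -/
theorem exists_polynomial_of_sum_of_commute [IsDomain C] {G : Type*} [Fintype G] (f : G → R)
    (c : G → G → G) (hc : ∀ a b, f a * f b = f b * f (c a b)) {d : ℕ} (hd0 : d ≠ 0)
    (hd : ∀ a, f a ^ d ∈ Submodule.span C ((fun i => f a ^ i) '' (Finset.range d : Set ℕ))) :
    ∃ P : Polynomial C, P ≠ 0 ∧ P.natDegree ≤ d ^ Fintype.card G ∧
      Polynomial.aeval (∑ a, f a) P = 0 := by
  classical
  obtain ⟨_, _⟩ := exists_wellFoundedLT (α := G)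
  let P : G → Submodule C R := fun a =>
    Submodule.span C ((fun i => f a ^ i) '' (Finset.range d : Set ℕ))
  have hP1 : ∀ a, 1 ∈ P a := fun a =>
    Submodule.subset_span ⟨0, by simpa using Nat.pos_of_ne_zero hd0, pow_zero _⟩
  have hP : ∀ a, ∀ x ∈ P a, f a * x ∈ P a := by
    intro a x hx
    induction hx using Submodule.span_induction with
    | mem x hx =>
      obtain ⟨i, hi, rfl⟩ := hx
      change f a * f a ^ i ∈ P a
      rw [← pow_succ']
      have hi : i < d := by simpa using hi
      rcases (Nat.succ_le_of_lt hi).lt_or_eq with h | h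
      · exact Submodule.subset_span ⟨i + 1, by simpa using h, rfl⟩
      · rw [← Nat.succ_eq_add_one, h]
        exact hd a
    | zero => rw [mul_zero]; exact zero_mem _
    | add x y _ _ hx hy => rw [mul_add]; exact add_mem hx hy
    | smul r x _ hx => rw [mul_smul_comm]; exact Submodule.smul_mem _ _ hx
  let e : List G := Finset.univ.sort (· ≤ ·)
  obtain ⟨s, hs, hes⟩ := exists_card_le_prod_le_span P d (fun a =>
    ⟨(Finset.range d).image fun i => f a ^ i, Finset.card_image_le.trans (by simp),
      by rw [Finset.coe_image]⟩) e
  have helen : e.length = Fintype.card G := Finset.length_sort _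
  rw [helen] at hs
  refine exists_polynomial_of_pow_mem_span s hs fun n => hes ?_
  have hwords : ∀ n, (∑ a, f a) ^ n ∈
      Submodule.span C (Set.range fun l : List G => (l.map f).prod) := by
    intro n
    induction n with
    | zero => exact Submodule.subset_span ⟨[], by simp⟩
    | succ n ih =>
      rw [pow_succ', Finset.sum_mul]
      refine Submodule.sum_mem _ fun a _ => ?_
      generalize (∑ a, f a) ^ n = y at ih ⊢
      induction ih using Submodule.span_induction with
      | mem x hx =>
        obtain ⟨l, rfl⟩ := hx
        exact Submodule.subset_span ⟨a :: l, by simp⟩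
      | zero => rw [mul_zero]; exact zero_mem _
      | add x y _ _ hx hy => rw [mul_add]; exact add_mem hx hy
      | smul r x _ hx => rw [mul_smul_comm]; exact Submodule.smul_mem _ _ hx
  -- Each word is sorted first, so it lies in the product of the spans P a, which has at most d^|G|
  -- generators independently of n.
  refine Submodule.span_le.2 ?_ (hwords n)
  rintro _ ⟨l, rfl⟩
  obtain ⟨l', -, hl', hp⟩ := exists_pairwise_le_prod_eq f c hc _ l rfl
  change (l.map f).prod ∈ _
  rw [← hp]
  exact prod_map_mem_prod_of_pairwise f P hP1 hP e (Finset.pairwise_sort _ _) l' hl'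
    fun a _ => (Finset.mem_sort _).2 (Finset.mem_univ a)

end Words

/-! ### Central elements of a graded ring -/

section Graded

variable {k : Type*} [Field k] {R : Type v} [Ring R] [Algebra k R] {G : Type*} [Group G]
  [Fintype G]

/-- The projections onto the components of a grading of `R` by `G` with identity component `A`. -/
structure IsGradingProjection (A : Subalgebra k R) (π : G → R →+ R) : Prop where
  self : ∀ g r, π g (π g r) = π g r
  ne : ∀ g h r, g ≠ h → π g (π h r) = 0
  sum : ∀ r, ∑ g, π g r = r
  mul : ∀ g r s, π g (r * s) = ∑ a, π a r * π (a⁻¹ * g) s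
  mem_iff : ∀ r, r ∈ A ↔ π 1 r = r

namespace IsGradingProjection

variable {A : Subalgebra k R} {π : G → R →+ R} (hπ : IsGradingProjection A π)
include hπ

theorem apply_mul_right {g h : G} {r s : R} (hs : π h s = s) :
    π g (r * s) = π (g * h⁻¹) r * s := by
  rw [hπ.mul, Finset.sum_eq_single (g * h⁻¹)]
  · rw [show (g * h⁻¹)⁻¹ * g = h by group, hs]
  · intro a _ ha
    rw [← hs, hπ.ne _ h, mul_zero]
    rintro rfl
    exact ha (by group)
  · simp

theorem apply_mul_left {g h : G} {r s : R} (hs : π h s = s) :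
    π g (s * r) = s * π (h⁻¹ * g) r := by
  rw [hπ.mul, Finset.sum_eq_single h]
  · rw [hs]
  · intro a _ ha
    rw [← hs, hπ.ne _ h _ ha, zero_mul]
  · simp

/-- Compare the components of degree g h in s z = z s. A homogeneous s thus permutes the components
of a central element by conjugating their degrees. -/
theorem component_mul {z : R} (hz : z ∈ Subring.center R) (g : G) {h : G} {s : R}
    (hs : π h s = s) : π g z * s = s * π (h⁻¹ * g * h) z := by
  have h1 := congrArg (π (g * h)) (Subring.mem_center_iff.1 hz s)
  rw [hπ.apply_mul_left hs, hπ.apply_mul_right hs] at h1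
  rw [mul_assoc h⁻¹, h1, mul_inv_cancel_right]

theorem mem_center_of_forall {x : R} (hx : ∀ (h : G) s, π h s = s → x * s = s * x) :
    x ∈ Subring.center R := by
  refine Subring.mem_center_iff.2 fun s => ?_
  rw [← hπ.sum s, Finset.mul_sum, Finset.sum_mul]
  exact Finset.sum_congr rfl fun g _ => (hx g _ (hπ.self g s)).symm

theorem component_one_mem_center {z : R} (hz : z ∈ Subring.center R) :
    π 1 z ∈ Subring.center R :=
  hπ.mem_center_of_forall fun h s hs => by
    rw [hπ.component_mul hz 1 hs, mul_one, inv_mul_cancel]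

theorem apply_one : π 1 1 = 1 := (hπ.mem_iff 1).1 A.one_mem

theorem apply_pow {g : G} {x : R} (hx : π g x = x) (n : ℕ) : π (g ^ n) (x ^ n) = x ^ n := by
  induction n with
  | zero => rw [pow_zero, pow_zero, hπ.apply_one]
  | succ n ih =>
    rw [pow_succ, pow_succ, hπ.apply_mul_right hx, mul_inv_cancel_right, ih]

theorem pow_card_mem (g : G) (z : R) : π g z ^ Fintype.card G ∈ A := by
  rw [hπ.mem_iff]
  have := hπ.apply_pow (hπ.self g z) (Fintype.card G)
  rwa [pow_card_eq_one] at this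

theorem component_pow_mul {z : R} (hz : z ∈ Subring.center R) (g : G) {h : G} {s : R}
    (hs : π h s = s) (n : ℕ) : π g z ^ n * s = s * π (h⁻¹ * g * h) z ^ n := by
  induction n with
  | zero => simp
  | succ n ih =>
    rw [pow_succ, mul_assoc, hπ.component_mul hz g hs, ← mul_assoc, ih, mul_assoc, pow_succ]

/-- The `|G|`-th powers of the components of a central element are roots of a monic polynomial of
degree `|G|` over the central part of `A`. -/
theorem exists_coeff_component {z : R} (hz : z ∈ Subring.center R) :
    ∃ c : ℕ → A.centralPart, ∀ g, (π g z ^ Fintype.card G) ^ Fintype.card G =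
      ∑ m ∈ Finset.range (Fintype.card G), c m • (π g z ^ Fintype.card G) ^ m := by
  classical
  let N := Fintype.card G
  -- The |G|-th powers have degree 1 and commute with A, so they commute with one another and
  -- polynomials can be evaluated at them.
  let a : G → Subring.center A := fun g => ⟨⟨π g z ^ N, hπ.pow_card_mem g z⟩,
    Subring.mem_center_iff.2 fun s => Subtype.ext (by
      have := hπ.component_pow_mul hz g ((hπ.mem_iff s).1 s.2) N
      rw [inv_one, one_mul, mul_one] at this
      exact this.symm)⟩
  let P := MvPolynomial G ℤ
  let Ψ : P →+* Subring.center A := (MvPolynomial.aeval a).toRingHom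
  let σ : G → P →+* P := fun h => (MvPolynomial.rename fun g => h⁻¹ * g * h).toRingHom
  let val : Subring.center A →+* R := A.val.toRingHom.comp (Subring.center A).subtype
  have hΨX : ∀ g, Ψ (MvPolynomial.X g) = a g := fun g => MvPolynomial.aeval_X a g
  have hσX : ∀ h g, σ h (MvPolynomial.X g) = MvPolynomial.X (h⁻¹ * g * h) := fun h g =>
    MvPolynomial.rename_X _ _
  -- Since s need not be invertible, conjugation by s is replaced by the permutation σ h of the
  -- variables of a polynomial ring.
  have hΨ : ∀ (h : G) (s : R), π h s = s → ∀ q : P, val (Ψ q) * s = s * val (Ψ (σ h q)) := by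
    intro h s hs q
    induction q using MvPolynomial.induction_on with
    | C n =>
      rw [show (MvPolynomial.C n : P) = (n : P) by simp]
      simp only [map_intCast]
      exact (Int.cast_commute n s)
    | add p q hp hq => simp only [map_add, add_mul, mul_add, hp, hq]
    | mul_X p g hp =>
      rw [map_mul, map_mul, mul_assoc, hΨX, show val (a g) = π g z ^ N from rfl,
        hπ.component_pow_mul hz g hs, ← mul_assoc, hp, map_mul, map_mul, map_mul, hσX, hΨX,
        mul_assoc]
      rfl
  -- The permutations only reorder the factors of χ, so its coefficients evaluate to elements that
  -- commute with all homogeneous elements, that is, to central ones.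
  let χ : Polynomial P := ∏ g : G, (Polynomial.X - Polynomial.C (MvPolynomial.X g))
  have hχσ : ∀ h m, σ h (χ.coeff m) = χ.coeff m := by
    intro h m
    rw [← Polynomial.coeff_map]
    congr 1
    simp only [χ, Polynomial.map_prod, Polynomial.map_sub, Polynomial.map_X, Polynomial.map_C, hσX]
    exact Fintype.prod_equiv ((MulAut.conj h⁻¹).toEquiv) _ _ fun g => by simp
  have hcen : ∀ m, val (Ψ (χ.coeff m)) ∈ Subring.center R := fun m =>
    hπ.mem_center_of_forall fun h s hs => by rw [hΨ h s hs, hχσ]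
  have hmonic : χ.Monic := Polynomial.monic_prod_of_monic _ _ fun g _ => Polynomial.monic_X_sub_C _
  have hdeg : χ.natDegree = N := by
    rw [Polynomial.natDegree_prod_of_monic _ _ fun g _ => Polynomial.monic_X_sub_C _]
    simp [N]
  refine ⟨fun m => ⟨⟨-val (Ψ (χ.coeff m)), neg_mem (hcen m)⟩,
    A.neg_mem (Ψ (χ.coeff m) : A).2⟩, fun g => ?_⟩
  have h0 : (χ.map Ψ).eval (a g) = 0 := by
    simp only [χ, Polynomial.map_prod, Polynomial.map_sub, Polynomial.map_X, Polynomial.map_C, hΨX,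
      Polynomial.eval_prod]
    exact Finset.prod_eq_zero (Finset.mem_univ g) (by simp)
  rw [Polynomial.eval_map, Polynomial.eval₂_eq_sum_range, hdeg, Finset.sum_range_succ, ← hdeg,
    hmonic.coeff_natDegree, hdeg, map_one, one_mul, add_comm, add_eq_zero_iff_eq_neg] at h0
  have h1 := congrArg val h0
  rw [map_pow, map_neg, map_sum, ← Finset.sum_neg_distrib] at h1
  refine h1.trans (Finset.sum_congr rfl fun m _ => ?_)
  rw [map_mul, map_pow, ← neg_mul]
  rfl

/-- Each component of z satisfies a monic equation of degree |G|² over the central part, z is the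
sum of its components, and these commute up to conjugation of degrees. -/
theorem exists_polynomial [IsDomain A.centralPart] (z : Subring.center R) :
    ∃ P : Polynomial A.centralPart, P ≠ 0 ∧
      P.natDegree ≤ (Fintype.card G * Fintype.card G) ^ Fintype.card G ∧
      Polynomial.aeval z P = 0 := by
  obtain ⟨c, hc⟩ := hπ.exists_coeff_component z.2
  have hN : Fintype.card G ≠ 0 := Fintype.card_ne_zero
  obtain ⟨P, hP, hPd, h⟩ := exists_polynomial_of_sum_of_commute (C := A.centralPart)
    (fun g => π g z) (fun g h => h⁻¹ * g * h)
    (fun g h => hπ.component_mul z.2 g (hπ.self h z)) (mul_ne_zero hN hN) fun g => by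
      rw [pow_mul, hc g]
      refine Submodule.sum_mem _ fun m hm => Submodule.smul_mem _ _ (Submodule.subset_span
        ⟨Fintype.card G * m, ?_, pow_mul _ _ _⟩)
      exact Finset.mem_coe.2 (Finset.mem_range.2
        (mul_lt_mul_of_pos_left (Finset.mem_range.1 hm) Fintype.card_pos))
  refine ⟨P, hP, hPd, Subtype.ext ?_⟩
  rw [hπ.sum] at h
  have h2 := Polynomial.aeval_algebraMap_apply R z P
  exact h2.symm.trans h

end IsGradingProjection

end Graded

/-! ### The projection given by an integral, and the two kinds of Hopf algebra -/

section HopfExpectation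

variable {k H : Type*} {R : Type v} [Field k] [Ring H] [HopfAlgebra k H] [Ring R] [Algebra k R]
  [Module H R] [IsScalarTower k H R] [IsHopfModuleAlgebra k H R]

theorem toSpanSingleton_eq_of_invariant {k H R : Type*} [Field k] [Ring H] [HopfAlgebra k H]
    [Ring R] [Algebra k R] [Module H R] [IsScalarTower k H R] {x : R}
    (hx : ∀ h : H, h • x = Coalgebra.counit (R := k) h • x) :
    (LinearMap.toSpanSingleton H R x).restrictScalars k =
      (Coalgebra.counit (R := k) (A := H)).smulRight x := by
  ext h
  simpa using hx h

theorem hopf_smul_mul_of_mem_left {a : R} (ha : a ∈ hopfInvariants k H R) (h : H) (r : R) :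
    h • (a * r) = a * h • r := by
  let ρ := Coalgebra.Repr.arbitrary k h
  have h2 := congrArg (· • r) (Coalgebra.sum_counit_smul ρ)
  rw [IsHopfModuleAlgebra.smul_mul (k := k), toSpanSingleton_eq_of_invariant ha, ← ρ.eq]
  simp only [Finset.sum_smul] at h2
  rw [← h2, map_sum, map_sum, Finset.mul_sum]
  exact Finset.sum_congr rfl fun i _ => by simp [smul_assoc]

theorem hopf_smul_mul_of_mem_right {a : R} (ha : a ∈ hopfInvariants k H R) (h : H) (r : R) :
    h • (r * a) = h • r * a := by
  let ρ := Coalgebra.Repr.arbitrary k h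
  have h1 := congrArg (TensorProduct.rid k H) (Coalgebra.sum_tmul_counit_eq ρ)
  simp only [map_sum, TensorProduct.rid_tmul, one_smul] at h1
  have h2 := congrArg (· • r) h1
  rw [IsHopfModuleAlgebra.smul_mul (k := k), toSpanSingleton_eq_of_invariant ha, ← ρ.eq]
  simp only [Finset.sum_smul] at h2
  rw [← h2, map_sum, map_sum, Finset.sum_mul]
  exact Finset.sum_congr rfl fun i _ => by simp [smul_assoc]

/-- The projection onto the invariants given by a normalized left integral `e`. -/
def integralProjection (e : H) (he : ∀ h : H, h * e = Coalgebra.counit (R := k) h • e) :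
    R →+ hopfInvariants k H R where
  toFun r := ⟨e • r, fun h => by rw [← mul_smul, he, smul_assoc]⟩
  map_zero' := Subtype.ext (smul_zero e)
  map_add' a b := Subtype.ext (smul_add e a b)

theorem krullDimension_cokerGamma_add_two_le_of_integral [CharZero k] [IsNoetherianRing R]
    (hR : IsPrimeRing R) (hfin : Module.Finite (Subring.center R) R) (hmax : IsMaximalOrder R)
    (e : H) (he : ∀ h : H, h * e = Coalgebra.counit (R := k) h • e)
    (he1 : Coalgebra.counit (R := k) e = 1)
    (heZ : ∀ z ∈ Subring.center R, e • z ∈ Subring.center R) (d : ℕ)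
    (hd : ∀ z : Subring.center R, ∃ P : Polynomial (hopfInvariants k H R).centralPart,
      P ≠ 0 ∧ P.natDegree ≤ d ∧ Polynomial.aeval z P = 0) :
    krullDimension R (CokerGamma (hopfInvariants k H R) R R) + 2 ≤ krullDimension R R ∧
      krullDimension Rᵈᵐᵃ (CokerGammaRight (hopfInvariants k H R) R R) + 2 ≤
        krullDimension Rᵐᵒᵖ R :=
  krullDimension_cokerGamma_add_two_le_of_retraction hR hfin hmax _ (integralProjection e he)
    (Subtype.ext (by
      change e • (1 : R) = 1
      rw [IsHopfModuleAlgebra.smul_one (k := k), he1, map_one]))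
    (fun a r => Subtype.ext (hopf_smul_mul_of_mem_left a.2 e r))
    (fun a r => Subtype.ext (hopf_smul_mul_of_mem_right a.2 e r)) heZ d hd

/-- A Hopf algebra spanned by group-like elements indexed by a finite group. -/
theorem krullDimension_cokerGamma_add_two_le_of_groupLike [CharZero k] [IsNoetherianRing R]
    (hR : IsPrimeRing R) (hfin : Module.Finite (Subring.center R) R) (hmax : IsMaximalOrder R)
    {G : Type*} [Group G] [Fintype G] (u : G →* H)
    (hcomul : ∀ g, Coalgebra.comul (R := k) (u g) = u g ⊗ₜ[k] u g)
    (hcounit : ∀ g, Coalgebra.counit (R := k) (u g) = 1)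
    (hspan : ∀ h, h ∈ Submodule.span k (Set.range u)) :
    krullDimension R (CokerGamma (hopfInvariants k H R) R R) + 2 ≤ krullDimension R R ∧
      krullDimension Rᵈᵐᵃ (CokerGammaRight (hopfInvariants k H R) R R) + 2 ≤
        krullDimension Rᵐᵒᵖ R := by
  classical
  have hinv : ∀ r : R, (∀ g, u g • r = r) → r ∈ hopfInvariants k H R := by
    intro r hr h
    induction hspan h using Submodule.span_induction with
    | mem x hx => obtain ⟨g, rfl⟩ := hx; rw [hcounit, one_smul, hr]
    | zero => rw [map_zero, zero_smul, zero_smul]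
    | add x y _ _ hx hy => rw [map_add, add_smul, add_smul, hx, hy]
    | smul c x _ hx => rw [map_smul, smul_assoc, hx, smul_eq_mul, mul_smul]
  have hmul : ∀ g (a b : R), u g • (a * b) = (u g • a) * (u g • b) := by
    intro g a b
    rw [IsHopfModuleAlgebra.smul_mul (k := k), hcomul]
    rfl
  have hone : ∀ g, u g • (1 : R) = 1 := fun g => by
    rw [IsHopfModuleAlgebra.smul_one (k := k), hcounit, map_one]
  have hcen : ∀ g, ∀ z ∈ Subring.center R, u g • z ∈ Subring.center R := by
    intro g z hz
    refine Subring.mem_center_iff.2 fun s => ?_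
    have h1 : s = u g • u g⁻¹ • s := by
      rw [← mul_smul, ← map_mul, mul_inv_cancel, map_one, one_smul]
    rw [h1, ← hmul, ← hmul, Subring.mem_center_iff.1 hz]
  have hcard : (Fintype.card G : k) ≠ 0 := Nat.cast_ne_zero.2 Fintype.card_ne_zero
  -- The average over the group; characteristic zero makes it available.
  let e : H := (Fintype.card G : k)⁻¹ • ∑ g, u g
  have he : ∀ h : H, h * e = Coalgebra.counit (R := k) h • e := by
    intro h
    induction hspan h using Submodule.span_induction with
    | mem x hx =>
      obtain ⟨g, rfl⟩ := hx
      rw [hcounit, one_smul, mul_smul_comm, Finset.mul_sum]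
      congr 1
      exact Fintype.sum_equiv (Equiv.mulLeft g) _ _ fun x => (map_mul u g x).symm
    | zero => rw [map_zero, zero_mul, zero_smul]
    | add x y _ _ hx hy => rw [map_add, add_mul, add_smul, hx, hy]
    | smul c x _ hx => rw [map_smul, smul_mul_assoc, hx, smul_eq_mul, mul_smul]
  have he1 : Coalgebra.counit (R := k) e = 1 := by
    simp only [e, map_smul, map_sum, hcounit]
    simp [hcard]
  let act : MulSemiringAction G (Subring.center R) :=
    { smul := fun g z => ⟨u g • (z : R), hcen g z z.2⟩
      one_smul := fun z => Subtype.ext (by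
        change u 1 • (z : R) = z
        rw [map_one, one_smul])
      mul_smul := fun g h z => Subtype.ext (by
        change u (g * h) • (z : R) = u g • u h • (z : R)
        rw [map_mul, mul_smul])
      smul_zero := fun g => Subtype.ext (smul_zero (u g))
      smul_add := fun g a b => Subtype.ext (smul_add (u g) (a : R) b)
      smul_one := fun g => Subtype.ext (hone g)
      smul_mul := fun g a b => Subtype.ext (hmul g a b) }
  refine krullDimension_cokerGamma_add_two_le_of_integral hR hfin hmax e he he1 ?_
    (Fintype.card G) ?_
  · intro z hz
    have h1 : e • z = algebraMap k R (Fintype.card G : k)⁻¹ * ∑ g, u g • z := by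
      rw [smul_assoc, Finset.sum_smul, Algebra.smul_def]
    rw [h1]
    exact mul_mem (Subring.mem_center_iff.2 fun s => (Algebra.commutes _ s).symm)
      (sum_mem fun g _ => hcen g z hz)
  · intro z
    -- The orbit polynomial ∏ (X - g z) has invariant coefficients and degree |G|.
    let χ := MulSemiringAction.charpoly G z
    have hχ : (χ.coeffs : Set (Subring.center R)) ⊆ (hopfInvariants k H R).centralPart := by
      intro c hc
      obtain ⟨n, -, rfl⟩ := Polynomial.mem_coeffs_iff.1 hc
      exact hinv _ fun g => congrArg Subtype.val (MulSemiringAction.smul_coeff_charpoly z n g)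
    have := hR.isDomain_center
    have hmonic := MulSemiringAction.monic_charpoly G z
    refine ⟨χ.toSubring _ hχ, ?_, ?_, ?_⟩
    · exact ((Polynomial.monic_toSubring χ _ hχ).2 hmonic).ne_zero
    · rw [Polynomial.natDegree_toSubring,
        show χ = ∏ g : G, (Polynomial.X - Polynomial.C (g • z)) from rfl,
        Polynomial.natDegree_prod_of_monic _ _ fun g _ => Polynomial.monic_X_sub_C _]
      simp
    · rw [Polynomial.aeval_def, ← Polynomial.eval_map]
      exact (congrArg (Polynomial.eval z) (Polynomial.map_toSubring χ _ hχ)).trans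
        (MulSemiringAction.eval_charpoly G z)

/-- A Hopf algebra with a basis of orthogonal idempotents dual to a finite group. -/
theorem krullDimension_cokerGamma_add_two_le_of_idempotents [CharZero k] [IsNoetherianRing R]
    (hR : IsPrimeRing R) (hfin : Module.Finite (Subring.center R) R) (hmax : IsMaximalOrder R)
    {G : Type*} [Group G] [Fintype G] (p : G → H) (hself : ∀ g, p g * p g = p g)
    (hne : ∀ g h, g ≠ h → p g * p h = 0) (hsum : ∑ g, p g = 1)
    (hcomul : ∀ g, Coalgebra.comul (R := k) (p g) = ∑ a, p a ⊗ₜ[k] p (a⁻¹ * g))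
    (he : ∀ h : H, h * p 1 = Coalgebra.counit (R := k) h • p 1)
    (he1 : Coalgebra.counit (R := k) (p 1) = 1) :
    krullDimension R (CokerGamma (hopfInvariants k H R) R R) + 2 ≤ krullDimension R R ∧
      krullDimension Rᵈᵐᵃ (CokerGammaRight (hopfInvariants k H R) R R) + 2 ≤
        krullDimension Rᵐᵒᵖ R := by
  -- The idempotents p g cut R into the components of a G-grading, and the invariants are the
  -- component of degree 1.
  have hπ : IsGradingProjection (hopfInvariants k H R)
      (fun g => DistribSMul.toAddMonoidHom R (p g)) :=
    { self := fun g r => by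
        change p g • p g • r = p g • r
        rw [← mul_smul, hself]
      ne := fun g h r hgh => by
        change p g • p h • r = 0
        rw [← mul_smul, hne g h hgh, zero_smul]
      sum := fun r => by
        change ∑ g, p g • r = r
        rw [← Finset.sum_smul, hsum, one_smul]
      mul := fun g r s => by
        change p g • (r * s) = ∑ a, (p a • r) * (p (a⁻¹ * g) • s)
        rw [IsHopfModuleAlgebra.smul_mul (k := k), hcomul, map_sum, map_sum]
        rfl
      mem_iff := fun r => by
        change _ ↔ p 1 • r = r
        refine ⟨fun hr => by rw [hr (p 1), he1, one_smul], fun hr h => ?_⟩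
        rw [← hr, ← mul_smul, he, smul_assoc] }
  have := hR.isDomain_center
  exact krullDimension_cokerGamma_add_two_le_of_integral hR hfin hmax (p 1) he he1
    (fun z hz => hπ.component_one_mem_center hz) _ fun z => hπ.exists_polynomial z

end HopfExpectation

/-- The isomorphism transports to `H` either the group-like basis of kG or the idempotents δ_g of
its dual; in the latter case δ_1 is the normalized integral. -/
theorem lemma1p18 {k : Type*} [Field k] [IsAlgClosed k] [CharZero k]
    {G : Type*} [Group G] [Fintype G]
    {H : Type*} [Ring H] [HopfAlgebra k H]
    (hH : Nonempty (H ≃ₐc[k] MonoidAlgebra k G) ∨ Nonempty (H ≃ₐc[k] DualGroupAlgebra k G))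
    {R : Type v} [Ring R] [Algebra k R]
    [IsNoetherianRing R] [IsNoetherianRing Rᵐᵒᵖ]
    (hprime : IsPrimeRing R) (hfin : Module.Finite (Subring.center R) R)
    [Module H R] [IsScalarTower k H R] [IsHopfModuleAlgebra k H R]
    (hfaithful : IsInnerFaithful k H R)
    (hmax : IsMaximalOrder R) :
    krullDimension R (CokerGamma (hopfInvariants k H R) R R) + 2 ≤ krullDimension R R ∧
      krullDimension Rᵈᵐᵃ (CokerGammaRight (hopfInvariants k H R) R R) + 2 ≤
        krullDimension Rᵐᵒᵖ R := by
  rcases hH with ⟨⟨φ⟩⟩ | ⟨⟨φ⟩⟩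
  · let u : G →* H := (φ.symm : MonoidAlgebra k G →* H).comp (MonoidAlgebra.of k G)
    have hu : ∀ g, u g = φ.symm (MonoidAlgebra.single g 1) := fun g => rfl
    refine krullDimension_cokerGamma_add_two_le_of_groupLike (k := k) hprime hfin hmax u
      (fun g => ?_) (fun g => ?_) fun h => ?_
    · rw [hu, ← CoalgHomClass.map_comp_comul_apply φ.symm, MonoidAlgebra.comul_single]
      simp
    · rw [hu, CoalgHomClass.counit_comp_apply φ.symm, MonoidAlgebra.counit_single]
      simp
    · rw [← φ.symm_apply_apply h]
      induction φ h using MonoidAlgebra.induction_linear with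
      | zero => rw [map_zero]; exact zero_mem _
      | add x y hx hy => rw [map_add]; exact add_mem hx hy
      | single g c =>
        have h1 : MonoidAlgebra.single g c = c • (MonoidAlgebra.single g 1 : MonoidAlgebra k G) := by simp
        rw [h1, map_smul]
        exact Submodule.smul_mem _ _ (Submodule.subset_span ⟨g, rfl⟩)
  · classical
    let p : G → H := fun g => φ.symm (DualGroupAlgebra.delta k g)
    have hp : ∀ g, p g = φ.symm (DualGroupAlgebra.delta k g) := fun g => rfl
    refine krullDimension_cokerGamma_add_two_le_of_idempotents (k := k) hprime hfin hmax p
      (fun g => ?_) (fun g h hgh => ?_) ?_ (fun g => ?_) (fun h => ?_) ?_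
    · rw [hp, ← map_mul, DualGroupAlgebra.delta_mul_delta, if_pos rfl]
    · rw [hp, hp, ← map_mul, DualGroupAlgebra.delta_mul_delta, if_neg hgh, map_zero]
    · have h1 : ∑ g : G, DualGroupAlgebra.delta k g = 1 := by
        simpa using DualGroupAlgebra.sum_smul_delta (1 : DualGroupAlgebra k G)
      rw [← map_one φ.symm, ← h1, map_sum]
    · have h1 : Coalgebra.comul (R := k) (DualGroupAlgebra.delta k g) =
          ∑ a : G, DualGroupAlgebra.delta k a ⊗ₜ[k] DualGroupAlgebra.delta k (a⁻¹ * g) := by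
        rw [DualGroupAlgebra.comul_apply]
        refine Finset.sum_congr rfl fun a _ => ?_
        rw [Finset.sum_eq_single (a⁻¹ * g)]
        · simp [DualGroupAlgebra.delta_apply]
        · intro b _ hb
          rw [DualGroupAlgebra.delta_apply, if_neg, zero_smul]
          rintro rfl
          exact hb (by group)
        · simp
      rw [hp, ← CoalgHomClass.map_comp_comul_apply φ.symm, h1, map_sum]
      rfl
    · rw [← φ.symm_apply_apply h, CoalgHomClass.counit_comp_apply φ.symm, hp, ← map_mul,
        ← map_smul, DualGroupAlgebra.counit_apply]
      congr 1
      ext x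
      simp only [DualGroupAlgebra.mul_apply, DualGroupAlgebra.smul_apply,
        DualGroupAlgebra.delta_apply]
      split_ifs with hx
      · rw [hx]
      · rw [mul_zero, mul_zero]
    · rw [hp, CoalgHomClass.counit_comp_apply φ.symm, DualGroupAlgebra.counit_apply,
        DualGroupAlgebra.delta_apply, if_pos rfl]
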